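/- Throughout $0<q<1$, $\sigma,\tau\in\mathbb R$, and $(a;p)_k=\prod_{r=0}^{k-1}(1-ap^r)$, $(a_1,\dots,a_s;p)_k=\prod_r(a_r;p)_k$, $\left[{n\atop k}\right]_p=(p^n;p^{-1})_k/(p;p)_k$; the letter $i$ is the imaginary unit where it occurs as a factor or as the base in $i^{n-l}$, and otherwise an index. **Algebras.** $\mathcal A=\mathcal A_q(SU(2))$ is the complex unital algebra with generators $\alpha,\beta,\gamma,\delta$ and relations $\alpha\beta=q\beta\alpha$, $\alpha\gamma=q\gamma\alpha$, $\beta\delta=q\delta\beta$, $\gamma\delta=q\delta\gamma$, $\beta\gamma=\gamma\beta$, $\alpha\delta-q\beta\gamma=\delta\alpha-q^{-1}\beta\gamma=1$. Its comultiplication $\Delta$ and counit $\varepsilon$ are the algebra homomorphisms with $\Delta\begin{pmatrix}\alpha&\beta\\ \gamma&\delta\end{pmatrix}=\begin{pmatrix}\alpha\otimes\alpha+\beta\otimes\gamma&\alpha\otimes\beta+\beta\otimes\delta\\ \gamma\otimes\alpha+\delta\otimes\gamma&\gamma\otimes\beta+\delta\otimes\delta\end{pmatrix}$, $\varepsilon\begin{pmatrix}\alpha&\beta\\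 \gamma&\delta\end{pmatrix}=\begin{pmatrix}1&0\\0&1\end{pmatrix}$. For $\lambda\in\mathbb C\setminus\{0\}$ let $\tau_\lambda:\mathcal A\to\mathbb C$ be the algebra homomorphism with $\alpha\mapsto\lambda$, $\delta\mapsto\lambda^{-1}$, $\beta,\gamma\mapsto 0$. $\mathcal U=\mathcal U_q(\mathfrak{su}(2))$ is the complex unital algebra with generators $A,B,C,D$ and relations $AD=DA=1$, $AB=qBA$, $AC=q^{-1}CA$, $BC-CB=(A^2-D^2)/(q-q^{-1})$. The pairing $\langle\cdot,\cdot\rangle:\mathcal U\times\mathcal A\to\mathbb C$ is the bilinear form with $\langle 1,\xi\rangle=\varepsilon(\xi)$ and $\langle XY,\xi\rangle=\langle X\otimes Y,\Delta\xi\rangle$ for which $\langle A,\cdot\rangle=\tau_{q^{1/2}}$, $\langle D,\cdot\rangle=\tau_{q^{-1/2}}$, while $Y\in\{B,C\}$ satisfy $\langle Y,1\rangle=0$ and $\langle Y,\xi\eta\rangle=\langle A,\xi\rangle\langle Y,\eta\rangle+\langle Y,\xi\rangle\langle D,\eta\rangle$, with $\langle B,\beta\rangle=1=\langle C,\gamma\rangle$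 and $\langle B,\cdot\rangle$, $\langle C,\cdot\rangle$ equal to $0$ at the other generators of $\mathcal A$. For $X\in\mathcal U$, $\xi\in\mathcal A$ put $X.\xi=(\mathrm{id}\otimes\langle X,\cdot\rangle)\Delta(\xi)$. **Representations.** For $l\in\frac12\mathbb Z_+$ let $t^l$ be the representation of $\mathcal U$ on the Hilbert space with orthonormal basis $e^l_n$, $n=-l,-l+1,\dots,l$, given by $t^l(A)e^l_n=q^{-n}e^l_n$, $t^l(D)e^l_n=q^ne^l_n$ and $$t^l(B)e^l_n=\frac{\sqrt{(q^{-l+n-1}-q^{l-n+1})(q^{-l-n}-q^{l+n})}}{q^{-1}-q}\,e^l_{n-1},\qquad t^l(C)e^l_n=\frac{\sqrt{(q^{-l+n}-q^{l-n})(q^{-l-n-1}-q^{l+n+1})}}{q^{-1}-q}\,e^l_{n+1}.$$ Let $t^l_{n,m}\in\mathcal A$ be the matrix elements of the corresponding corepresentation of $\mathcal A$: in the algebra tensor product of the quantum plane algebra $\mathbb C\langle x,y\mid xy=qyx\rangle$ and $\mathcal A$, with $e^l_{k-l}=\left[{2l\atop k}\right]_{q^2}^{1/2}y^kx^{2l-k}$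 for $0\le k\le 2l$, the algebra homomorphism $x\mapsto x\otimes\alpha+y\otimes\gamma$, $y\mapsto x\otimes\beta+y\otimes\delta$ maps $e^l_m$ to $\sum_n e^l_n\otimes t^l_{n,m}$. **Generalised matrix elements.** For $j=-l,-l+1,\dots,l$ let $$C^{l,j}(\sigma)=q^{l+j}\left[{2l\atop l-j}\right]_{q^2}^{1/2}\left(\frac{1+q^{-4j-2\sigma}}{1+q^{-2\sigma}}\right)^{1/2}\bigl((-q^{2-2\sigma};q^2)_{l-j}(-q^{2+2\sigma};q^2)_{l+j}\bigr)^{-1/2},$$ and let $v^{l,j}(\sigma)=\sum_{n=-l}^{l}v^{l,j}_n(\sigma)e^l_n$ with $$v^{l,j}_n(\sigma)=C^{l,j}(\sigma)\,i^{n-l}q^{\sigma(l-n)}q^{\frac12(l-n)(l-n-1)}\left(\frac{(q^{4l};q^{-2})_{l-n}}{(q^2;q^2)_{l-n}}\right)^{1/2}R_{l-n}(q^{2j-2l}-q^{-2j-2l-2\sigma};q^{2\sigma},2l;q^2),$$ where $R_n$ is the dual $q$-Krawtchouk polynomial: for $n,x\in\{0,\dots,N\}$ and $0<p<1$, $$R_n(p^{-x}-p^{x-N-s};p^s,N;p)=\sum_{k=0}^{n}\frac{(p^{-n},p^{-x},-p^{x-N-s};p)_k}{(p^{-N},p;p)_k}\,p^k.$$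 (These $v^{l,j}(\sigma)$ form the dual $q$-Krawtchouk eigenbasis of $t^l(X_\sigma A)$, $X_\sigma=iq^{1/2}B-iq^{-1/2}C-\frac{q^\sigma-q^{-\sigma}}{q-q^{-1}}(A-D)$.) For $i,j=-l,-l+1,\dots,l$ the generalised matrix element is $$a^l_{i,j}(\tau,\sigma)=\sum_{n,m=-l}^{l}v^{l,j}_m(\sigma)\,\overline{v^{l,i}_n(\tau)}\;t^l_{n,m}\in\mathcal A .$$ **Polynomials and constants.** Let $$\begin{aligned}\rho_{\tau,\sigma}=\tfrac12\bigl(&\alpha^2+\delta^2+q\gamma^2+q^{-1}\beta^2+i(q^{-\sigma}-q^\sigma)(q\delta\gamma+\beta\alpha)\\&-i(q^{-\tau}-q^\tau)(\delta\beta+q\gamma\alpha)+(q^{-\sigma}-q^\sigma)(q^{-\tau}-q^\tau)\beta\gamma\bigr).\end{aligned}$$ Askey–Wilson polynomials are, for $x=\cos\theta$, $$p_n(x;a,b,c,d\mid p)=a^{-n}(ab,ac,ad;p)_n\sum_{k=0}^{n}\frac{(p^{-n},abcdp^{n-1},ae^{i\theta},ae^{-i\theta};p)_k}{(ab,ac,ad,p;p)_k}\,p^k,$$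 $$p_n^{(a,b)}(x;s,t\mid p)=p_n\bigl(x;\,p^{1/2}t/s,\;p^{1/2+a}s/t,\;-p^{1/2}/(st),\;-st\,p^{1/2+b}\mid p\bigr).$$ For $i\ge0$, $|j|\le i\le l$, put $$d^l_{i,j}(\tau,\sigma)=\frac{C^{l,j}(\sigma)C^{l,i}(\tau)}{C^{i,j}(\sigma)C^{i,i}(\tau)}\;\frac{q^{i-l}}{(q^{4l};q^{-2})_{l-i}} .$$ **Corollary 7.7 (the Noumi–Mimachi theorem).** Let $l\in\frac12\mathbb Z_+$ and $i,j\in\frac12\mathbb Z$ with $i-j\in\mathbb Z$, $m=\max(|i|,|j|)$ and $l-m\in\mathbb Z_+$. Then $a^l_{i,j}(\tau,\sigma)$ represents the functional $X\mapsto\langle t^l(X)v^{l,j}(\sigma),v^{l,i}(\tau)\rangle$, that is, $\langle X,a^l_{i,j}(\tau,\sigma)\rangle=\langle t^l(X)v^{l,j}(\sigma),v^{l,i}(\tau)\rangle$ for all $X\in\mathcal U$, and for all $\lambda\in\mathbb C\setminus\{0\}$: (i) If $m=i$, that is $-i\le j\le i$, then $$\begin{aligned}a^l_{i,j}(\tau,\sigma)&=d^l_{i,j}(\tau,\sigma)\,a^i_{i,j}(\tau,\sigma)\,p^{(i-j,i+j)}_{l-i}(D.\rho_{\tau,\sigma};q^\tau,q^\sigma\mid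 q^2),\\ \tau_\lambda\bigl(a^i_{i,j}(\tau,\sigma)\bigr)&=C^{i,j}(\sigma)C^{i,i}(\tau)\lambda^{-2i}(\lambda^2q^{\tau-\sigma};q^2)_{i-j}(-\lambda^2q^{\tau+\sigma};q^2)_{i+j}.\end{aligned}$$ (ii) If $m=j$, that is $-j\le i\le j$, then $$\begin{aligned}a^l_{i,j}(\tau,\sigma)&=d^l_{j,i}(\sigma,\tau)\,a^j_{i,j}(\tau,\sigma)\,p^{(j-i,i+j)}_{l-j}(D.\rho_{\tau,\sigma};q^\sigma,q^\tau\mid q^2),\\ \tau_\lambda\bigl(a^j_{i,j}(\tau,\sigma)\bigr)&=C^{j,i}(\tau)C^{j,j}(\sigma)\lambda^{-2j}(\lambda^2q^{\sigma-\tau};q^2)_{j-i}(-\lambda^2q^{\tau+\sigma};q^2)_{i+j}.\end{aligned}$$ (iii) If $m=-i$, that is $i\le j\le -i$, then $$\begin{aligned}a^l_{i,j}(\tau,\sigma)&=d^l_{-i,-j}(-\tau,-\sigma)\,a^{-i}_{i,j}(\tau,\sigma)\,p^{(j-i,-i-j)}_{l+i}(D.\rho_{\tau,\sigma};q^{-\tau},q^{-\sigma}\mid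 q^2),\\ \tau_\lambda\bigl(a^{-i}_{i,j}(\tau,\sigma)\bigr)&=C^{-i,-j}(-\sigma)C^{-i,-i}(-\tau)\lambda^{2i}(\lambda^2q^{-\tau+\sigma};q^2)_{j-i}(-\lambda^2q^{-\tau-\sigma};q^2)_{-i-j}.\end{aligned}$$ (iv) If $m=-j$, that is $j\le i\le -j$, then $$\begin{aligned}a^l_{i,j}(\tau,\sigma)&=d^l_{-j,-i}(-\sigma,-\tau)\,a^{-j}_{i,j}(\tau,\sigma)\,p^{(i-j,-i-j)}_{l+j}(D.\rho_{\tau,\sigma};q^{-\sigma},q^{-\tau}\mid q^2),\\ \tau_\lambda\bigl(a^{-j}_{i,j}(\tau,\sigma)\bigr)&=C^{-j,-i}(-\tau)C^{-j,-j}(-\sigma)\lambda^{2j}(\lambda^2q^{-\sigma+\tau};q^2)_{i-j}(-\lambda^2q^{-\tau-\sigma};q^2)_{-i-j}.\end{aligned}$$ -/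

import Mathlib

open scoped TensorProduct

namespace QSU2

/-! ## The deformation parameter, `q`-shifted factorials and orthogonal polynomials -/

/-- The deformation parameter: a real number `q` with `0 < q < 1`. -/
abbrev QParam := Set.Ioo (0 : ℝ) 1

/-- The real power `q ^ x`, as a complex number. -/
noncomputable def qpow (q : QParam) (x : ℝ) : ℂ := (((q : ℝ) ^ x : ℝ) : ℂ)

/-- The deformation parameter as a complex number. -/
def qc (q : QParam) : ℂ := ((q : ℝ) : ℂ)

/-- The `q`-shifted factorial `(a; p)_k = ∏_{i < k} (1 - a p^i)`. -/
def qPoch {R : Type*} [CommRing R] (a p : R) (k : ℕ) : R :=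
  ∏ i ∈ Finset.range k, (1 - a * p ^ i)

/-- The `p`-binomial coefficient `[n, k]_p = (p^n; p⁻¹)_k / (p; p)_k`. -/
noncomputable def qBinom (p : ℝ) (n k : ℕ) : ℝ :=
  qPoch (p ^ n) p⁻¹ k / qPoch p p k

/-- The dual `p`-Krawtchouk polynomial of degree `n`, of order `N` and with parameter `p ^ s`,
at the point `p^{-x} - p^{x-N-s}` for `x ∈ {0, …, N}`: the terminating series
`₃φ₂ (p^{-n}, p^{-x}, -p^{x-N-s}; p^{-N}, 0; p, p)`, which is summed up to `k = n ≤ N`. -/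
noncomputable def dualKrawtchouk (p s : ℝ) (N n x : ℕ) : ℝ :=
  ∑ k ∈ Finset.range (n + 1),
    (qPoch (p ^ (-(n : ℝ))) p k * qPoch (p ^ (-(x : ℝ))) p k
        * qPoch (-p ^ ((x : ℝ) - N - s)) p k)
      / (qPoch (p ^ (-(N : ℝ))) p k * qPoch 0 p k * qPoch p p k) * p ^ k

/-- The Askey-Wilson polynomial `p_n(x; a, b, c, d | p)`, in the variable `x = cos θ`:
`a^{-n} (ab, ac, ad; p)_n ₄φ₃ (p^{-n}, abcd p^{n-1}, a e^{iθ}, a e^{-iθ}; ab, ac, ad; p, p)`,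
where `(a e^{iθ}, a e^{-iθ}; p)_k = ∏_{i < k} (1 - 2 a p^i x + a² p^{2i})`. -/
noncomputable def askeyWilson (n : ℕ) (a b c d p : ℂ) : Polynomial ℂ :=
  Polynomial.C ((a ^ n)⁻¹ * (qPoch (a * b) p n * qPoch (a * c) p n * qPoch (a * d) p n)) *
    ∑ k ∈ Finset.range (n + 1),
      Polynomial.C ((qPoch (p ^ (-(n : ℤ))) p k * qPoch (a * b * c * d * p ^ ((n : ℤ) - 1)) p k)
          / (qPoch (a * b) p k * qPoch (a * c) p k * qPoch (a * d) p k * qPoch p p k) * p ^ k) *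
        ∏ i ∈ Finset.range k,
          (1 - Polynomial.C (2 * a * p ^ i) * Polynomial.X + Polynomial.C (a ^ 2 * p ^ (2 * i)))

/-- The Askey-Wilson polynomial in `q`-Jacobi notation,
`p_n^{(α, β)}(x; s, t | p)
  = p_n(x; p^{1/2} t/s, p^{1/2+α} s/t, -p^{1/2}/(st), -s t p^{1/2+β} | p)`. -/
noncomputable def askeyWilsonJacobi (n : ℕ) (α β s t p : ℝ) : Polynomial ℂ :=
  askeyWilson n ((p ^ (1 / 2 : ℝ) * t / s : ℝ) : ℂ) ((p ^ (1 / 2 + α) * s / t : ℝ) : ℂ)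
    ((-p ^ (1 / 2 : ℝ) / (s * t) : ℝ) : ℂ) ((-(s * t * p ^ (1 / 2 + β)) : ℝ) : ℂ) (p : ℂ)

section Powers

variable (q : QParam)

theorem q_pos : 0 < (q : ℝ) := q.2.1

theorem qc_ne_zero : qc q ≠ 0 := by
  unfold qc
  exact_mod_cast (q_pos q).ne'

theorem qpow_add (x y : ℝ) : qpow q (x + y) = qpow q x * qpow q y := by
  simp [qpow, Real.rpow_add (q_pos q)]

theorem qpow_zero : qpow q 0 = 1 := by simp [qpow]

theorem qpow_one : qpow q 1 = qc q := by simp [qpow, qc]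

theorem qpow_neg_one : qpow q (-1) = (qc q)⁻¹ := by simp [qpow, qc, Real.rpow_neg_one]

theorem qpow_ne_zero (x : ℝ) : qpow q x ≠ 0 := by
  simp [qpow, (Real.rpow_pos_of_pos (q_pos q) x).ne']

end Powers

/-! ## The quantised function algebra -/

/-- The four generators of the quantised algebra of polynomials on `SU(2)`. -/
inductive AGen
  | al
  | be
  | ga
  | de

/-- The defining relations between elements `a, b, c, d` (in the roles of `α, β, γ, δ`) of a
complex algebra. -/
structure ARels {R : Type*} [Ring R] [Algebra ℂ R] (q : QParam) (a b c d : R) : Prop where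
  ab : a * b = qc q • (b * a)
  ac : a * c = qc q • (c * a)
  bd : b * d = qc q • (d * b)
  cd : c * d = qc q • (d * c)
  bc : b * c = c * b
  ad : a * d - qc q • (b * c) = 1
  da : d * a - (qc q)⁻¹ • (b * c) = 1

section

open FreeAlgebra AGen

/-- The defining relations, on the free algebra. -/
inductive ARel (q : QParam) : FreeAlgebra ℂ AGen → FreeAlgebra ℂ AGen → Prop
  | ab : ARel q (ι ℂ al * ι ℂ be) (qc q • (ι ℂ be * ι ℂ al))
  | ac : ARel q (ι ℂ al * ι ℂ ga) (qc q • (ι ℂ ga * ι ℂ al))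
  | bd : ARel q (ι ℂ be * ι ℂ de) (qc q • (ι ℂ de * ι ℂ be))
  | cd : ARel q (ι ℂ ga * ι ℂ de) (qc q • (ι ℂ de * ι ℂ ga))
  | bc : ARel q (ι ℂ be * ι ℂ ga) (ι ℂ ga * ι ℂ be)
  | ad : ARel q (ι ℂ al * ι ℂ de - qc q • (ι ℂ be * ι ℂ ga)) 1
  | da : ARel q (ι ℂ de * ι ℂ al - (qc q)⁻¹ • (ι ℂ be * ι ℂ ga)) 1

end

/-- The algebra `A_q(SU(2))`: the complex unital algebra with generators `α, β, γ, δ` and the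
defining relations. -/
def FunAlg (q : QParam) : Type := RingQuot (ARel q)

noncomputable instance (q : QParam) : Ring (FunAlg q) := inferInstanceAs (Ring (RingQuot (ARel q)))

noncomputable instance (q : QParam) : Algebra ℂ (FunAlg q) :=
  inferInstanceAs (Algebra ℂ (RingQuot (ARel q)))

namespace FunAlg

variable {q : QParam}

/-- The quotient map from the free algebra. -/
noncomputable def mk (q : QParam) : FreeAlgebra ℂ AGen →ₐ[ℂ] FunAlg q :=
  RingQuot.mkAlgHom ℂ (ARel q)

/-- The generators `α, β, γ, δ` of `A_q(SU(2))`. -/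
noncomputable def gen (q : QParam) (g : AGen) : FunAlg q := mk q (FreeAlgebra.ι ℂ g)

theorem mk_surjective (q : QParam) : Function.Surjective (mk q) :=
  RingQuot.mkAlgHom_surjective ℂ (ARel q)

theorem mk_rel {x y : FreeAlgebra ℂ AGen} (h : ARel q x y) : mk q x = mk q y :=
  RingQuot.mkAlgHom_rel ℂ h

theorem gen_rels (q : QParam) :
    ARels q (gen q .al) (gen q .be) (gen q .ga) (gen q .de) where
  ab := by simpa [gen] using mk_rel (ARel.ab (q := q))
  ac := by simpa [gen] using mk_rel (ARel.ac (q := q))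
  bd := by simpa [gen] using mk_rel (ARel.bd (q := q))
  cd := by simpa [gen] using mk_rel (ARel.cd (q := q))
  bc := by simpa [gen] using mk_rel (ARel.bc (q := q))
  ad := by simpa [gen] using mk_rel (ARel.ad (q := q))
  da := by simpa [gen] using mk_rel (ARel.da (q := q))

/-- The assignment of four elements to the four generators. -/
def assign {R : Type*} (a b c d : R) : AGen → R
  | .al => a
  | .be => b
  | .ga => c
  | .de => d

/-- The algebra homomorphism out of `A_q(SU(2))` with prescribed values on the generators. -/
noncomputable def lift {R : Type*} [Ring R] [Algebra ℂ R] {a b c d : R} (h : ARels q a b c d) :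
    FunAlg q →ₐ[ℂ] R :=
  RingQuot.liftAlgHom ℂ ⟨FreeAlgebra.lift ℂ (assign a b c d), by
    intro x y hxy
    cases hxy
    · simpa [assign] using h.ab
    · simpa [assign] using h.ac
    · simpa [assign] using h.bd
    · simpa [assign] using h.cd
    · simpa [assign] using h.bc
    · simpa [assign] using h.ad
    · simpa [assign] using h.da⟩

theorem lift_gen {R : Type*} [Ring R] [Algebra ℂ R] {a b c d : R} (h : ARels q a b c d)
    (g : AGen) : lift h (gen q g) = assign a b c d g := by
  unfold lift gen mk
  exact (RingQuot.liftAlgHom_mkAlgHom_apply ℂ _ _ _).trans (by simp)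

theorem induction {P : FunAlg q → Prop} (hs : ∀ z : ℂ, P (algebraMap ℂ _ z))
    (hg : ∀ g, P (gen q g)) (hadd : ∀ x y, P x → P y → P (x + y))
    (hmul : ∀ x y, P x → P y → P (x * y)) (x : FunAlg q) : P x := by
  obtain ⟨w, rfl⟩ := mk_surjective q x
  induction w using FreeAlgebra.induction with
  | grade0 z => simpa using hs z
  | grade1 g => exact hg g
  | mul a b ha hb => simpa using hmul _ _ ha hb
  | add a b ha hb => simpa using hadd _ _ ha hb

theorem algHom_ext {R : Type*} [Ring R] [Algebra ℂ R] {f g : FunAlg q →ₐ[ℂ] R}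
    (h : ∀ x, f (gen q x) = g (gen q x)) : f = g := by
  ext x
  induction x using FunAlg.induction with
  | hs z => simp
  | hg y => exact h y
  | hadd x y hx hy => simp [hx, hy]
  | hmul x y hx hy => simp [hx, hy]

theorem comul_rels (q : QParam) :
    ARels q (gen q .al ⊗ₜ[ℂ] gen q .al + gen q .be ⊗ₜ[ℂ] gen q .ga)
      (gen q .al ⊗ₜ[ℂ] gen q .be + gen q .be ⊗ₜ[ℂ] gen q .de)
      (gen q .ga ⊗ₜ[ℂ] gen q .al + gen q .de ⊗ₜ[ℂ] gen q .ga)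
      (gen q .ga ⊗ₜ[ℂ] gen q .be + gen q .de ⊗ₜ[ℂ] gen q .de) := by
  have h0 := qc_ne_zero q
  obtain ⟨ab, ac, bd, cd, bc, ad, da⟩ := gen_rels q
  have ad' := sub_eq_iff_eq_add.mp ad
  have da' := sub_eq_iff_eq_add.mp da
  have cb := bc.symm
  have one_def : (1 : FunAlg q ⊗[ℂ] FunAlg q) = 1 ⊗ₜ 1 := rfl
  constructor <;>
  · simp only [one_def, add_mul, mul_add, Algebra.TensorProduct.tmul_mul_tmul, ab, ac, bd, cd, cb,
      ad', da', TensorProduct.add_tmul, TensorProduct.tmul_add, ← TensorProduct.smul_tmul',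
      TensorProduct.tmul_smul]
    match_scalars <;> field_simp <;> ring

theorem counit_rels (q : QParam) : ARels q (1 : ℂ) 0 0 1 := by
  constructor <;> simp

/-- The comultiplication: `Δα = α⊗α + β⊗γ`, `Δβ = α⊗β + β⊗δ`, `Δγ = γ⊗α + δ⊗γ`,
`Δδ = γ⊗β + δ⊗δ`. -/
noncomputable def comulHom (q : QParam) : FunAlg q →ₐ[ℂ] FunAlg q ⊗[ℂ] FunAlg q :=
  lift (comul_rels q)

/-- The counit. -/
noncomputable def counitHom (q : QParam) : FunAlg q →ₐ[ℂ] ℂ := lift (counit_rels q)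

theorem coassoc_hom (q : QParam) :
    (Algebra.TensorProduct.assoc ℂ ℂ ℂ (FunAlg q) (FunAlg q) (FunAlg q)).toAlgHom.comp
      ((Algebra.TensorProduct.map (comulHom q) (.id ℂ _)).comp (comulHom q))
      = (Algebra.TensorProduct.map (.id ℂ _) (comulHom q)).comp (comulHom q) := by
  apply algHom_ext
  rintro (_ | _ | _ | _) <;>
  · simp [comulHom, lift_gen, assign, TensorProduct.add_tmul, TensorProduct.tmul_add]
    abel

theorem counit_left_hom (q : QParam) :
    (Algebra.TensorProduct.map (counitHom q) (.id ℂ _)).comp (comulHom q)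
      = (Algebra.TensorProduct.lid ℂ (FunAlg q)).symm.toAlgHom := by
  apply algHom_ext
  rintro (_ | _ | _ | _) <;>
  simp [comulHom, counitHom, lift_gen, assign]

theorem counit_right_hom (q : QParam) :
    (Algebra.TensorProduct.map (.id ℂ _) (counitHom q)).comp (comulHom q)
      = (Algebra.TensorProduct.rid ℂ ℂ (FunAlg q)).symm.toAlgHom := by
  apply algHom_ext
  rintro (_ | _ | _ | _) <;>
  simp [comulHom, counitHom, lift_gen, assign]

noncomputable instance (q : QParam) : Coalgebra ℂ (FunAlg q) where
  comul := (comulHom q).toLinearMap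
  counit := (counitHom q).toLinearMap
  coassoc := congr(($(coassoc_hom q)).toLinearMap)
  rTensor_counit_comp_comul := congr(($(counit_left_hom q)).toLinearMap)
  lTensor_counit_comp_comul := congr(($(counit_right_hom q)).toLinearMap)

end FunAlg

/-! ## The quantised universal enveloping algebra -/

/-- The four generators of the quantised universal enveloping algebra. -/
inductive UGen
  | A
  | B
  | C
  | D

/-- The defining relations between elements `a, b, c, d` (in the roles of `A, B, C, D`) of a
complex algebra. -/
structure URels {R : Type*} [Ring R] [Algebra ℂ R] (q : QParam) (a b c d : R) : Prop where
  ad : a * d = 1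
  da : d * a = 1
  ab : a * b = qc q • (b * a)
  ac : a * c = (qc q)⁻¹ • (c * a)
  bc : b * c - c * b = (qc q - (qc q)⁻¹)⁻¹ • (a * a - d * d)

section

open FreeAlgebra UGen

/-- The defining relations, on the free algebra. -/
inductive URel (q : QParam) : FreeAlgebra ℂ UGen → FreeAlgebra ℂ UGen → Prop
  | ad : URel q (ι ℂ A * ι ℂ D) 1
  | da : URel q (ι ℂ D * ι ℂ A) 1
  | ab : URel q (ι ℂ A * ι ℂ B) (qc q • (ι ℂ B * ι ℂ A))
  | ac : URel q (ι ℂ A * ι ℂ C) ((qc q)⁻¹ • (ι ℂ C * ι ℂ A))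
  | bc : URel q (ι ℂ B * ι ℂ C - ι ℂ C * ι ℂ B)
      ((qc q - (qc q)⁻¹)⁻¹ • (ι ℂ A * ι ℂ A - ι ℂ D * ι ℂ D))

end

/-- The algebra `U_q(su(2))`: the complex unital algebra with generators `A, B, C, D` and the
defining relations. -/
def EnvAlg (q : QParam) : Type := RingQuot (URel q)

noncomputable instance (q : QParam) : Ring (EnvAlg q) := inferInstanceAs (Ring (RingQuot (URel q)))

noncomputable instance (q : QParam) : Algebra ℂ (EnvAlg q) :=
  inferInstanceAs (Algebra ℂ (RingQuot (URel q)))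

namespace EnvAlg

variable {q : QParam}

/-- The generators `A, B, C, D` of `U_q(su(2))`. -/
noncomputable def gen (q : QParam) (g : UGen) : EnvAlg q :=
  RingQuot.mkAlgHom ℂ (URel q) (FreeAlgebra.ι ℂ g)

/-- The assignment of four elements to the four generators. -/
def assign {R : Type*} (a b c d : R) : UGen → R
  | .A => a
  | .B => b
  | .C => c
  | .D => d

/-- The algebra homomorphism out of `U_q(su(2))` with prescribed values on the generators. -/
noncomputable def lift {R : Type*} [Ring R] [Algebra ℂ R] {a b c d : R} (h : URels q a b c d) :
    EnvAlg q →ₐ[ℂ] R :=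
  RingQuot.liftAlgHom ℂ ⟨FreeAlgebra.lift ℂ (assign a b c d), by
    intro x y hxy
    cases hxy
    · simpa [assign] using h.ad
    · simpa [assign] using h.da
    · simpa [assign] using h.ab
    · simpa [assign] using h.ac
    · simpa [assign] using h.bc⟩

theorem lift_gen {R : Type*} [Ring R] [Algebra ℂ R] {a b c d : R} (h : URels q a b c d)
    (g : UGen) : lift h (gen q g) = assign a b c d g := by
  unfold lift gen
  exact (RingQuot.liftAlgHom_mkAlgHom_apply ℂ _ _ _).trans (by simp)

end EnvAlg

/-! ## The duality -/

section Duality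

variable (q : QParam)

theorem half_mul_half : qpow q (1 / 2) * qpow q (1 / 2) = qc q := by
  rw [← qpow_add, ← qpow_one]; norm_num

theorem half_mul_neg_half : qpow q (1 / 2) * qpow q (-(1 / 2)) = 1 := by
  rw [← qpow_add, ← qpow_zero q]; norm_num

theorem neg_half_eq : qpow q (-(1 / 2)) = (qpow q (1 / 2))⁻¹ :=
  eq_inv_of_mul_eq_one_right (half_mul_neg_half q)

theorem character_rels (z : ℂˣ) : ARels q (z : ℂ) 0 0 ((z⁻¹ : ℂˣ) : ℂ) := by
  constructor <;> simp

/-- The one-dimensional representation `τ_z` of `A_q(SU(2))`, for `z ≠ 0`: `α ↦ z`, `δ ↦ z⁻¹`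
and `β, γ ↦ 0`. -/
noncomputable def character (z : ℂˣ) : FunAlg q →ₐ[ℂ] ℂ := FunAlg.lift (character_rels q z)

/-- The algebra homomorphism `⟨A, ·⟩`, with `α ↦ q^{1/2}`, `δ ↦ q^{-1/2}`, `β, γ ↦ 0`. -/
noncomputable def pairA : FunAlg q →ₐ[ℂ] ℂ :=
  character q (Units.mk0 (qpow q (1 / 2)) (qpow_ne_zero q _))

/-- The algebra homomorphism `⟨D, ·⟩`, with `α ↦ q^{-1/2}`, `δ ↦ q^{1/2}`, `β, γ ↦ 0`. -/
noncomputable def pairD : FunAlg q →ₐ[ℂ] ℂ :=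
  character q (Units.mk0 (qpow q (1 / 2)) (qpow_ne_zero q _))⁻¹

theorem upper_rels (x y : ℂ) :
    ARels q (!![qpow q (1 / 2), 0; 0, qpow q (-(1 / 2))] : Matrix (Fin 2) (Fin 2) ℂ)
      !![0, x; 0, 0] !![0, y; 0, 0] !![qpow q (-(1 / 2)), 0; 0, qpow q (1 / 2)] := by
  have h1 := half_mul_half q
  have h2 := half_mul_neg_half q
  have h3 : qc q * qpow q (-(1 / 2)) = qpow q (1 / 2) := by
    rw [← h1, mul_assoc, h2, mul_one]
  constructor <;>
  · ext i j
    fin_cases i <;> fin_cases j <;>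
    simp [-one_div, ← mul_assoc, mul_comm, h2] <;>
    first | linear_combination -x * h3 | linear_combination -y * h3

/-- Upper triangular `2 × 2` representations of `A_q(SU(2))` with diagonal entries `⟨A, ·⟩` and
`⟨D, ·⟩`; the corner entry `f` satisfies `f(ξη) = ⟨A, ξ⟩ f(η) + f(ξ) ⟨D, η⟩`, and takes the value
`x` at `β`, the value `y` at `γ`, and `0` at `α` and `δ`. -/
noncomputable def upperRep (x y : ℂ) :
    FunAlg q →ₐ[ℂ] Matrix (Fin 2) (Fin 2) ℂ :=
  FunAlg.lift (upper_rels q x y)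

/-- The functional `⟨B, ·⟩`. -/
noncomputable def pairB : FunAlg q →ₗ[ℂ] ℂ :=
  Matrix.entryLinearMap ℂ ℂ (0 : Fin 2) (1 : Fin 2) ∘ₗ (upperRep q 1 0).toLinearMap

/-- The functional `⟨C, ·⟩`. -/
noncomputable def pairC : FunAlg q →ₗ[ℂ] ℂ :=
  Matrix.entryLinearMap ℂ ℂ (0 : Fin 2) (1 : Fin 2) ∘ₗ (upperRep q 0 1).toLinearMap

theorem upperRep_entries (x y : ℂ) (ξ : FunAlg q) :
    upperRep q x y ξ 0 0 = pairA q ξ ∧ upperRep q x y ξ 1 0 = 0 ∧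
      upperRep q x y ξ 1 1 = pairD q ξ := by
  induction ξ using FunAlg.induction with
  | hs z => simp [Matrix.algebraMap_matrix_apply]
  | hg g =>
    cases g <;>
    simp [-one_div, upperRep, pairA, pairD, character, FunAlg.lift_gen, FunAlg.assign, neg_half_eq]
  | hadd x y hx hy => simp [hx, hy]
  | hmul x y hx hy => simp [hx, hy, Matrix.mul_apply, Fin.sum_univ_two]

theorem pairB_mul (x y : FunAlg q) :
    pairB q (x * y) = pairA q x * pairB q y + pairB q x * pairD q y := by
  have h1 := upperRep_entries q 1 0 x
  have h2 := upperRep_entries q 1 0 y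
  simp [pairB, Matrix.mul_apply, Fin.sum_univ_two, h1, h2]

theorem pairC_mul (x y : FunAlg q) :
    pairC q (x * y) = pairA q x * pairC q y + pairC q x * pairD q y := by
  have h1 := upperRep_entries q 0 1 x
  have h2 := upperRep_entries q 0 1 y
  simp [pairC, Matrix.mul_apply, Fin.sum_univ_two, h1, h2]

theorem pairA_gen (g : AGen) :
    pairA q (FunAlg.gen q g) = FunAlg.assign (qpow q (1 / 2)) 0 0 (qpow q (1 / 2))⁻¹ g := by
  cases g <;> simp [pairA, character, FunAlg.lift_gen, FunAlg.assign]

theorem pairD_gen (g : AGen) :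
    pairD q (FunAlg.gen q g) = FunAlg.assign (qpow q (1 / 2))⁻¹ 0 0 (qpow q (1 / 2)) g := by
  cases g <;> simp [pairD, character, FunAlg.lift_gen, FunAlg.assign]

theorem pairB_gen (g : AGen) : pairB q (FunAlg.gen q g) = FunAlg.assign 0 1 0 0 g := by
  cases g <;> simp [pairB, upperRep, FunAlg.lift_gen, FunAlg.assign]

theorem pairC_gen (g : AGen) : pairC q (FunAlg.gen q g) = FunAlg.assign 0 0 1 0 g := by
  cases g <;> simp [pairC, upperRep, FunAlg.lift_gen, FunAlg.assign]

open WithConv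

/-- The algebra of linear functionals on `A_q(SU(2))`, under convolution. -/
abbrev Functional (q : QParam) := WithConv (FunAlg q →ₗ[ℂ] ℂ)

/-- The convolution product of twisted derivations, at a product. -/
theorem conv_mul_apply {q : QParam} (f g a b c d : Functional q)
    (hf : ∀ x y, f (x * y) = a x * f y + f x * b y)
    (hg : ∀ x y, g (x * y) = c x * g y + g x * d y) (x y : FunAlg q) :
    (f * g) (x * y) =
      (a * c) x * (f * g) y + (a * g) x * (f * d) y + (f * c) x * (b * g) y
      + (f * g) x * (b * d) y := by
  have key : ∀ u v : FunAlg q ⊗[ℂ] FunAlg q,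
      LinearMap.mul' ℂ ℂ (TensorProduct.map f.ofConv g.ofConv (u * v)) =
        LinearMap.mul' ℂ ℂ (TensorProduct.map a.ofConv c.ofConv u)
          * LinearMap.mul' ℂ ℂ (TensorProduct.map f.ofConv g.ofConv v)
        + LinearMap.mul' ℂ ℂ (TensorProduct.map a.ofConv g.ofConv u)
          * LinearMap.mul' ℂ ℂ (TensorProduct.map f.ofConv d.ofConv v)
        + LinearMap.mul' ℂ ℂ (TensorProduct.map f.ofConv c.ofConv u)
          * LinearMap.mul' ℂ ℂ (TensorProduct.map b.ofConv g.ofConv v)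
        + LinearMap.mul' ℂ ℂ (TensorProduct.map f.ofConv g.ofConv u)
          * LinearMap.mul' ℂ ℂ (TensorProduct.map b.ofConv d.ofConv v) := by
    intro u v
    induction u using TensorProduct.induction_on with
    | zero => simp
    | add u1 u2 h1 h2 => simp only [add_mul, map_add, h1, h2]; ring
    | tmul x x' =>
      induction v using TensorProduct.induction_on with
      | zero => simp
      | add v1 v2 h1 h2 => simp only [mul_add, map_add, h1, h2]; ring
      | tmul y y' => simp [hf, hg]; ring
  have hc : Coalgebra.comul (R := ℂ) (x * y)
      = Coalgebra.comul (R := ℂ) x * Coalgebra.comul (R := ℂ) y :=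
    map_mul (FunAlg.comulHom q) x y
  simp only [LinearMap.convMul_apply, hc]
  exact key _ _

theorem conv_gen {q : QParam} (f g : Functional q) (x : AGen) :
    (f * g) (FunAlg.gen q x) =
      FunAlg.assign
        (f (.gen q .al) * g (.gen q .al) + f (.gen q .be) * g (.gen q .ga))
        (f (.gen q .al) * g (.gen q .be) + f (.gen q .be) * g (.gen q .de))
        (f (.gen q .ga) * g (.gen q .al) + f (.gen q .de) * g (.gen q .ga))
        (f (.gen q .ga) * g (.gen q .be) + f (.gen q .de) * g (.gen q .de)) x := by
  have hc : Coalgebra.comul (R := ℂ) (FunAlg.gen q x) = FunAlg.comulHom q (FunAlg.gen q x) := rfl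
  simp only [LinearMap.convMul_apply, hc, FunAlg.comulHom, FunAlg.lift_gen]
  cases x <;> simp [FunAlg.assign]

theorem conv_at_one {q : QParam} (f g : Functional q) : (f * g) 1 = f 1 * g 1 := by
  have hc : Coalgebra.comul (R := ℂ) (1 : FunAlg q) = 1 ⊗ₜ 1 :=
    (map_one (FunAlg.comulHom q)).trans rfl
  simp [LinearMap.convMul_apply, hc]

theorem one_conv_apply {q : QParam} (x : FunAlg q) :
    (1 : Functional q) x = FunAlg.counitHom q x := rfl

/-- Two functionals which are twisted derivations for the same functionals, or which are both
multiplicative, agree if they agree at `1` and on the generators. -/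
theorem functional_ext {q : QParam} {f g : Functional q} (h1 : f 1 = g 1)
    (h : ∀ x, f (.gen q x) = g (.gen q x))
    (hmul : ∀ x y, f x = g x → f y = g y → f (x * y) = g (x * y)) : f = g := by
  refine ofConv_injective (LinearMap.ext fun x => ?_)
  induction x using FunAlg.induction with
  | hs z => simp only [Algebra.algebraMap_eq_smul_one, map_smul, h1]
  | hg y => exact h y
  | hadd x y hx hy => simp only [map_add, hx, hy]
  | hmul x y hx hy => exact hmul x y hx hy

/-- The functionals `⟨A, ·⟩`, `⟨B, ·⟩`, `⟨C, ·⟩`, `⟨D, ·⟩`. -/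
noncomputable def pairGen : UGen → Functional q
  | .A => toConv (pairA q).toLinearMap
  | .B => toConv (pairB q)
  | .C => toConv (pairC q)
  | .D => toConv (pairD q).toLinearMap

theorem pairGen_gen (u : UGen) (x : AGen) :
    pairGen q u (FunAlg.gen q x) =
      EnvAlg.assign (FunAlg.assign (qpow q (1 / 2)) 0 0 (qpow q (1 / 2))⁻¹ x)
        (FunAlg.assign 0 1 0 0 x) (FunAlg.assign 0 0 1 0 x)
        (FunAlg.assign (qpow q (1 / 2))⁻¹ 0 0 (qpow q (1 / 2)) x) u := by
  cases u
  · exact pairA_gen q x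
  · exact pairB_gen q x
  · exact pairC_gen q x
  · exact pairD_gen q x

theorem pairGen_one (u : UGen) : pairGen q u 1 = EnvAlg.assign 1 0 0 1 u := by
  cases u <;> simp [pairGen, pairB, pairC, EnvAlg.assign]

theorem pairGen_A_mul (x y : FunAlg q) : pairGen q .A (x * y) =
    (0 : Functional q) x * pairGen q .A y + pairGen q .A x * pairGen q .A y := by
  simp [pairGen]

theorem pairGen_D_mul (x y : FunAlg q) : pairGen q .D (x * y) =
    (0 : Functional q) x * pairGen q .D y + pairGen q .D x * pairGen q .D y := by
  simp [pairGen]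

theorem pairGen_B_mul (x y : FunAlg q) : pairGen q .B (x * y) =
    pairGen q .A x * pairGen q .B y + pairGen q .B x * pairGen q .D y :=
  pairB_mul q x y

theorem pairGen_C_mul (x y : FunAlg q) : pairGen q .C (x * y) =
    pairGen q .A x * pairGen q .C y + pairGen q .C x * pairGen q .D y :=
  pairC_mul q x y

theorem pair_ad : pairGen q .A * pairGen q .D = 1 := by
  refine functional_ext ?_ (fun x => ?_) fun x y hx hy => ?_
  · rw [conv_at_one, one_conv_apply]
    simp [pairGen_one, EnvAlg.assign]
  · rw [conv_gen, one_conv_apply, FunAlg.counitHom, FunAlg.lift_gen]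
    cases x <;> simp [pairGen_gen, FunAlg.assign, EnvAlg.assign, -one_div, qpow_ne_zero]
  · rw [conv_mul_apply _ _ _ _ _ _ (pairGen_A_mul q) (pairGen_D_mul q), hx, hy]
    simp [one_conv_apply, -LinearMap.convOne_apply]

theorem pair_da : pairGen q .D * pairGen q .A = 1 := by
  refine functional_ext ?_ (fun x => ?_) fun x y hx hy => ?_
  · rw [conv_at_one, one_conv_apply]
    simp [pairGen_one, EnvAlg.assign]
  · rw [conv_gen, one_conv_apply, FunAlg.counitHom, FunAlg.lift_gen]
    cases x <;> simp [pairGen_gen, FunAlg.assign, EnvAlg.assign, -one_div, qpow_ne_zero]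
  · rw [conv_mul_apply _ _ _ _ _ _ (pairGen_D_mul q) (pairGen_A_mul q), hx, hy]
    simp [one_conv_apply, -LinearMap.convOne_apply]

theorem pair_ab : pairGen q .A * pairGen q .B = qc q • (pairGen q .B * pairGen q .A) := by
  have hs : ∀ x, (qc q • (pairGen q .B * pairGen q .A)) x
    = qc q * (pairGen q .B * pairGen q .A) x := fun x => rfl
  refine functional_ext ?_ (fun x => ?_) fun x y hx hy => ?_
  · simp only [hs, conv_at_one, pairGen_one, EnvAlg.assign]; ring
  · rw [hs, conv_gen, conv_gen, ← half_mul_half]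
    have := qpow_ne_zero q (1 / 2)
    cases x <;> simp only [pairGen_gen, FunAlg.assign, EnvAlg.assign] <;> field_simp <;> ring
  · rw [hs] at *
    rw [conv_mul_apply _ _ _ _ _ _ (pairGen_A_mul q) (pairGen_B_mul q),
      conv_mul_apply _ _ _ _ _ _ (pairGen_B_mul q) (pairGen_A_mul q), hx, hy, pair_ad, pair_da]
    simp
    ring

theorem pair_ac : pairGen q .A * pairGen q .C = (qc q)⁻¹ • (pairGen q .C * pairGen q .A) := by
  have hs : ∀ x, ((qc q)⁻¹ • (pairGen q .C * pairGen q .A)) x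
    = (qc q)⁻¹ * (pairGen q .C * pairGen q .A) x := fun x => rfl
  refine functional_ext ?_ (fun x => ?_) fun x y hx hy => ?_
  · simp only [hs, conv_at_one, pairGen_one, EnvAlg.assign]; ring
  · rw [hs, conv_gen, conv_gen, ← half_mul_half]
    have := qpow_ne_zero q (1 / 2)
    cases x <;> simp only [pairGen_gen, FunAlg.assign, EnvAlg.assign] <;> field_simp <;> ring
  · rw [hs] at *
    rw [conv_mul_apply _ _ _ _ _ _ (pairGen_A_mul q) (pairGen_C_mul q),
      conv_mul_apply _ _ _ _ _ _ (pairGen_C_mul q) (pairGen_A_mul q), hx, hy, pair_ad, pair_da]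
    simp
    ring

theorem pair_bd : pairGen q .B * pairGen q .D = qc q • (pairGen q .D * pairGen q .B) := by
  calc pairGen q .B * pairGen q .D
      = pairGen q .D * (pairGen q .A * pairGen q .B) * pairGen q .D := by
        rw [← mul_assoc, pair_da, one_mul]
    _ = qc q • (pairGen q .D * pairGen q .B) := by
        rw [pair_ab, mul_smul_comm, smul_mul_assoc, mul_assoc, mul_assoc, pair_ad, mul_one]

theorem pair_cd : pairGen q .C * pairGen q .D = (qc q)⁻¹ • (pairGen q .D * pairGen q .C) := by
  calc pairGen q .C * pairGen q .D
      = pairGen q .D * (pairGen q .A * pairGen q .C) * pairGen q .D := by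
        rw [← mul_assoc, pair_da, one_mul]
    _ = (qc q)⁻¹ • (pairGen q .D * pairGen q .C) := by
        rw [pair_ac, mul_smul_comm, smul_mul_assoc, mul_assoc, mul_assoc, pair_ad, mul_one]

theorem qc_sub_ne_zero : qc q - (qc q)⁻¹ ≠ 0 := by
  have h0 : (0 : ℝ) < q := q.2.1
  have h1 : (q : ℝ) < 1 := q.2.2
  have h2 : (q : ℝ) - (q : ℝ)⁻¹ ≠ 0 := by
    have : 1 < (q : ℝ)⁻¹ := (one_lt_inv₀ h0).mpr h1
    linarith
  unfold qc
  exact_mod_cast h2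

theorem pair_bc : pairGen q .B * pairGen q .C - pairGen q .C * pairGen q .B =
    (qc q - (qc q)⁻¹)⁻¹ • (pairGen q .A * pairGen q .A - pairGen q .D * pairGen q .D) := by
  have h0 := qc_ne_zero q
  have hl : ∀ x, (pairGen q .B * pairGen q .C - pairGen q .C * pairGen q .B) x
    = (pairGen q .B * pairGen q .C) x - (pairGen q .C * pairGen q .B) x := fun x => rfl
  have hr : ∀ x, ((qc q - (qc q)⁻¹)⁻¹ •
      (pairGen q .A * pairGen q .A - pairGen q .D * pairGen q .D)) x
    = (qc q - (qc q)⁻¹)⁻¹ *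
      ((pairGen q .A * pairGen q .A) x - (pairGen q .D * pairGen q .D) x) := fun x => rfl
  refine functional_ext ?_ (fun x => ?_) fun x y hx hy => ?_
  · simp only [hl, hr, conv_at_one, pairGen_one, EnvAlg.assign]; ring
  · rw [hl, hr, conv_gen, conv_gen, conv_gen, conv_gen]
    have h1 := qpow_ne_zero q (1 / 2)
    have h2 := qc_sub_ne_zero q
    have h3 : (qpow q (1 / 2))⁻¹ * (qpow q (1 / 2))⁻¹ = (qc q)⁻¹ := by
      rw [← mul_inv, half_mul_half]
    cases x <;>
    simp only [pairGen_gen, FunAlg.assign, EnvAlg.assign, half_mul_half, h3, mul_zero, zero_mul,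
      add_zero, zero_add, mul_one, sub_zero, sub_self, zero_sub]
    · exact (inv_mul_cancel₀ h2).symm
    · rw [← neg_sub (qc q), mul_neg, inv_mul_cancel₀ h2]
  · have e1 : ∀ x, (pairGen q .A * pairGen q .C) x
      = (qc q)⁻¹ * (pairGen q .C * pairGen q .A) x := fun x => by rw [pair_ac]; rfl
    have e2 : ∀ x, (pairGen q .A * pairGen q .B) x
      = qc q * (pairGen q .B * pairGen q .A) x := fun x => by rw [pair_ab]; rfl
    have e3 : ∀ x, (pairGen q .B * pairGen q .D) x
      = qc q * (pairGen q .D * pairGen q .B) x := fun x => by rw [pair_bd]; rfl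
    have e4 : ∀ x, (pairGen q .C * pairGen q .D) x
      = (qc q)⁻¹ * (pairGen q .D * pairGen q .C) x := fun x => by rw [pair_cd]; rfl
    have e5 : ∀ x, (0 : Functional q) x = 0 := fun x => rfl
    rw [hl, hr] at *
    rw [conv_mul_apply _ _ _ _ _ _ (pairGen_B_mul q) (pairGen_C_mul q),
      conv_mul_apply _ _ _ _ _ _ (pairGen_C_mul q) (pairGen_B_mul q),
      conv_mul_apply _ _ _ _ _ _ (pairGen_A_mul q) (pairGen_A_mul q),
      conv_mul_apply _ _ _ _ _ _ (pairGen_D_mul q) (pairGen_D_mul q)]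
    simp only [mul_zero, zero_mul, e1, e2, e3, e4, e5, add_zero, zero_add]
    have e6 : qc q * (qc q)⁻¹ = 1 := mul_inv_cancel₀ h0
    linear_combination (pairGen q .A * pairGen q .A) x * hy + (pairGen q .D * pairGen q .D) y * hx
      + ((pairGen q .C * pairGen q .A) x * (pairGen q .D * pairGen q .B) y
        - (pairGen q .B * pairGen q .A) x * (pairGen q .D * pairGen q .C) y) * e6

theorem pair_rels : URels q (pairGen q .A) (pairGen q .B) (pairGen q .C) (pairGen q .D) :=
  ⟨pair_ad q, pair_da q, pair_ab q, pair_ac q, pair_bc q⟩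

/-- The homomorphism from `U_q(su(2))` to the convolution algebra of linear functionals on
`A_q(SU(2))` which is given on the generators by the explicit duality. -/
noncomputable def pairingHom : EnvAlg q →ₐ[ℂ] Functional q := EnvAlg.lift (pair_rels q)

/-- The duality `⟨X, ξ⟩` between `U_q(su(2))` and `A_q(SU(2))`. -/
noncomputable def pairing (X : EnvAlg q) : FunAlg q →ₗ[ℂ] ℂ := (pairingHom q X).ofConv

/-- The left action `X.ξ = (id ⊗ X)(Δ ξ)` of `U_q(su(2))` on `A_q(SU(2))`. -/
noncomputable def leftAction (X : EnvAlg q) (ξ : FunAlg q) : FunAlg q :=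
  TensorProduct.rid ℂ (FunAlg q)
    (LinearMap.lTensor (FunAlg q) (pairing q X) (FunAlg.comulHom q ξ))

end Duality

/-! ## The irreducible representations of `U_q(su(2))`

A spin `l ∈ {0, 1/2, 1, …}` is given by the natural number `L = 2 l`, and the orthonormal basis
`e^l_{-l}, …, e^l_l` of the representation space is indexed by `Fin (L + 1)`: the index `k` stands
for `e^l_n` with `n = k - l`. -/

section Spin

variable (q : QParam)

/-- The weight `n = k - l` that belongs to the index `k`. -/
noncomputable def weight (L : ℕ) (k : Fin (L + 1)) : ℝ := (k : ℝ) - (L : ℝ) / 2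

/-- The coefficient of `C e^l_n = c e^l_{n+1}`, which is also that of `B e^l_{n+1} = c e^l_n`:
`√((q^{-l+n} - q^{l-n}) (q^{-l-n-1} - q^{l+n+1})) / (q⁻¹ - q)`. -/
noncomputable def ladder (l n : ℝ) : ℝ :=
  √(((q : ℝ) ^ (-l + n) - (q : ℝ) ^ (l - n)) *
      ((q : ℝ) ^ (-l - n - 1) - (q : ℝ) ^ (l + n + 1))) / ((q : ℝ)⁻¹ - q)

/-- `A e^l_n = q^{-n} e^l_n`. -/
noncomputable def spinA (L : ℕ) : Matrix (Fin (L + 1)) (Fin (L + 1)) ℂ :=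
  Matrix.diagonal fun k => qpow q (-weight L k)

/-- `D e^l_n = q^n e^l_n`. -/
noncomputable def spinD (L : ℕ) : Matrix (Fin (L + 1)) (Fin (L + 1)) ℂ :=
  Matrix.diagonal fun k => qpow q (weight L k)

/-- `B e^l_n = √((q^{-l+n-1} - q^{l-n+1}) (q^{-l-n} - q^{l+n})) / (q⁻¹ - q) e^l_{n-1}`. -/
noncomputable def spinB (L : ℕ) : Matrix (Fin (L + 1)) (Fin (L + 1)) ℂ :=
  Matrix.of fun r k =>
    if (r : ℕ) + 1 = k then ((ladder q (L / 2) (weight L k - 1) : ℝ) : ℂ) else 0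

/-- `C e^l_n = √((q^{-l+n} - q^{l-n}) (q^{-l-n-1} - q^{l+n+1})) / (q⁻¹ - q) e^l_{n+1}`. -/
noncomputable def spinC (L : ℕ) : Matrix (Fin (L + 1)) (Fin (L + 1)) ℂ :=
  Matrix.of fun r k =>
    if (r : ℕ) = k + 1 then ((ladder q (L / 2) (weight L k) : ℝ) : ℂ) else 0

theorem ladder_top (l : ℝ) : ladder q l l = 0 := by simp [ladder]

theorem ladder_bot (l : ℝ) : ladder q l (-l - 1) = 0 := by
  have h : l + (-l - 1) + 1 = 0 := by ring
  simp [ladder, h]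

theorem spin_bc_entry (L : ℕ) (k : Fin (L + 1)) :
    (spinB q L * spinC q L) k k = ((ladder q (L / 2) (weight L k) ^ 2 : ℝ) : ℂ) := by
  rw [Matrix.mul_apply]
  by_cases hk : (k : ℕ) = L
  · rw [Finset.sum_eq_zero]
    · have : weight L k = (L : ℝ) / 2 := by
        simp only [weight, hk]; ring
      rw [this, ladder_top]
      simp
    · intro j _
      have := j.2
      simp [spinB, show ¬ (k : ℕ) + 1 = j by omega]
  · have hk' := k.2
    rw [Finset.sum_eq_single (⟨k + 1, by omega⟩ : Fin (L + 1))]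
    · simp [spinB, spinC, weight, sq]
      left
      ring_nf
    · intro j _ hj
      have : ¬ (k : ℕ) + 1 = j := fun h => hj (Fin.ext h.symm)
      simp [spinB, this]
    · simp

theorem spin_cb_entry (L : ℕ) (k : Fin (L + 1)) :
    (spinC q L * spinB q L) k k = ((ladder q (L / 2) (weight L k - 1) ^ 2 : ℝ) : ℂ) := by
  rw [Matrix.mul_apply]
  by_cases hk : (k : ℕ) = 0
  · rw [Finset.sum_eq_zero]
    · have : weight L k = -((L : ℝ) / 2) := by simp [weight, hk]
      rw [this, ladder_bot]
      simp
    · intro j _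
      simp [spinC, show ¬ (k : ℕ) = j + 1 by omega]
  · have hk' := k.2
    rw [Finset.sum_eq_single (⟨k - 1, by omega⟩ : Fin (L + 1))]
    · have h1 : (k : ℕ) = (k : ℕ) - 1 + 1 := by omega
      have h2 : (((k : ℕ) - 1 : ℕ) : ℝ) = (k : ℝ) - 1 := by
        rw [Nat.cast_sub (by omega)]; simp
      have h3 : (k : ℝ) - 1 - (L : ℝ) / 2 = (k : ℝ) - (L : ℝ) / 2 - 1 := by ring
      simp [spinB, spinC, weight, sq, ← h1, h2, h3]
    · intro j _ hj
      have : ¬ (k : ℕ) = j + 1 := fun h => hj (Fin.ext (by simp; omega))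
      simp [spinC, this]
    · simp

theorem spin_bc_off (L : ℕ) {r k : Fin (L + 1)} (h : r ≠ k) :
    (spinB q L * spinC q L) r k = 0 := by
  rw [Matrix.mul_apply]
  refine Finset.sum_eq_zero fun j _ => ?_
  have h' : (r : ℕ) ≠ k := fun e => h (Fin.ext e)
  by_cases h1 : (r : ℕ) + 1 = j
  · simp [spinC, show ¬ (j : ℕ) = k + 1 by omega]
  · simp [spinB, h1]

theorem spin_cb_off (L : ℕ) {r k : Fin (L + 1)} (h : r ≠ k) :
    (spinC q L * spinB q L) r k = 0 := by
  rw [Matrix.mul_apply]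
  refine Finset.sum_eq_zero fun j _ => ?_
  have h' : (r : ℕ) ≠ k := fun e => h (Fin.ext e)
  by_cases h1 : (r : ℕ) = j + 1
  · simp [spinB, show ¬ (j : ℕ) + 1 = k by omega]
  · simp [spinC, h1]

theorem ladder_sq (l n : ℝ) (h1 : n ≤ l) (h2 : -l - 1 ≤ n) :
    ladder q l n ^ 2 = ((q : ℝ) ^ (-l + n) - (q : ℝ) ^ (l - n)) *
      ((q : ℝ) ^ (-l - n - 1) - (q : ℝ) ^ (l + n + 1)) / ((q : ℝ)⁻¹ - q) ^ 2 := by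
  rw [ladder, div_pow, Real.sq_sqrt]
  refine mul_nonneg (sub_nonneg.mpr ?_) (sub_nonneg.mpr ?_)
  · exact Real.rpow_le_rpow_of_exponent_ge q.2.1 q.2.2.le (by linarith)
  · exact Real.rpow_le_rpow_of_exponent_ge q.2.1 q.2.2.le (by linarith)

theorem ladder_sub (l n : ℝ) (h1 : n ≤ l) (h2 : -l ≤ n) :
    ladder q l n ^ 2 - ladder q l (n - 1) ^ 2 =
      ((q : ℝ) - (q : ℝ)⁻¹)⁻¹ * ((q : ℝ) ^ (-n) * (q : ℝ) ^ (-n) - (q : ℝ) ^ n * (q : ℝ) ^ n) := by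
  rw [ladder_sq q l n h1 (by linarith), ladder_sq q l (n - 1) (by linarith) (by linarith)]
  have h0 : (0 : ℝ) < q := q.2.1
  have hq1 : (q : ℝ) < 1 := q.2.2
  have h3 : (q : ℝ)⁻¹ - q ≠ 0 := by
    have : 1 < (q : ℝ)⁻¹ := (one_lt_inv₀ h0).mpr hq1
    linarith
  have h4 : (q : ℝ) - (q : ℝ)⁻¹ ≠ 0 := fun h => h3 (by linarith)
  have hl := (Real.rpow_pos_of_pos h0 l).ne'
  have hn := (Real.rpow_pos_of_pos h0 n).ne'
  have hsq : (1 : ℝ) - (q : ℝ) ^ 2 ≠ 0 := by nlinarith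
  have hsq' : (q : ℝ) ^ 2 - 1 ≠ 0 := by nlinarith
  simp only [Real.rpow_add h0, Real.rpow_sub h0, Real.rpow_neg h0.le, Real.rpow_one]
  have e1 : ((q : ℝ)⁻¹ - q) = (1 - (q : ℝ) ^ 2) / q := by field_simp
  have e2 : ((q : ℝ) - (q : ℝ)⁻¹) = -((1 - (q : ℝ) ^ 2) / q) := by field_simp; ring
  rw [e2, e1]
  field_simp
  ring

theorem spin_rels (L : ℕ) : URels q (spinA q L) (spinB q L) (spinC q L) (spinD q L) where
  ad := by
    rw [spinA, spinD, Matrix.diagonal_mul_diagonal, ← Matrix.diagonal_one]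
    congr 1
    ext k
    rw [← qpow_add, neg_add_cancel, qpow_zero]
  da := by
    rw [spinA, spinD, Matrix.diagonal_mul_diagonal, ← Matrix.diagonal_one]
    congr 1
    ext k
    rw [← qpow_add, add_neg_cancel, qpow_zero]
  ab := by
    ext r k
    rw [Matrix.smul_apply, spinA, Matrix.diagonal_mul, Matrix.mul_diagonal]
    by_cases h : (r : ℕ) + 1 = k
    · have e : -weight L r = 1 + -weight L k := by simp [weight, ← h]; ring
      rw [e, qpow_add, qpow_one, smul_eq_mul]
      ring
    · simp [spinB, h]
  ac := by
    ext r k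
    rw [Matrix.smul_apply, spinA, Matrix.diagonal_mul, Matrix.mul_diagonal]
    by_cases h : (r : ℕ) = k + 1
    · have e : -weight L r = -1 + -weight L k := by simp [weight, h]; ring
      rw [e, qpow_add, qpow_neg_one, smul_eq_mul]
      ring
    · simp [spinC, h]
  bc := by
    ext r k
    by_cases h : r = k
    · subst h
      have h1 : weight L r ≤ (L : ℝ) / 2 := by
        have : (r : ℝ) ≤ L := by exact_mod_cast Nat.lt_succ_iff.mp r.2
        unfold weight; linarith
      have h2 : -((L : ℝ) / 2) ≤ weight L r := by
        have : (0 : ℝ) ≤ r := by positivity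
        unfold weight; linarith
      rw [Matrix.sub_apply, spin_bc_entry, spin_cb_entry, ← Complex.ofReal_sub,
        ladder_sub q _ _ h1 h2]
      simp [spinA, spinD, qpow, qc]
    · simp [Matrix.sub_apply, spin_bc_off q L h, spin_cb_off q L h, spinA, spinD, h]

/-- The `(2l+1)`-dimensional representation `t^l` of `U_q(su(2))`, where `L = 2 l`. -/
noncomputable def spinRep (L : ℕ) : EnvAlg q →ₐ[ℂ] Matrix (Fin (L + 1)) (Fin (L + 1)) ℂ :=
  EnvAlg.lift (spin_rels q L)

end Spin

/-! ## Generalised matrix elements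

All half-integers are doubled: `L = 2 l`, `I = 2 i` and `J = 2 j`. -/

section GeneralisedMatrixElements

variable (q : QParam)

/-- The natural number `z / 2`, for an even integer `z ≥ 0`. -/
def half (z : ℤ) : ℕ := (z / 2).toNat

/-- Left multiplication by `x ⊗ u + y ⊗ v` on `∑_k y^k x^{N-k} ⊗ f k`, in terms of the
coefficients `f`, where `x` and `y` are the coordinates of the quantum plane, `x y = q y x`. -/
noncomputable def coactStep (u v : FunAlg q) (f : ℕ → FunAlg q) : ℕ → FunAlg q
  | 0 => u * f 0
  | k + 1 => qc q ^ (k + 1) • (u * f (k + 1)) + v * f k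

/-- The coefficients of the coaction `x ↦ x ⊗ α + y ⊗ γ`, `y ↦ x ⊗ β + y ⊗ δ` on the quantum
plane: the image of `y^b x^a` is `∑_k y^k x^{a+b-k} ⊗ coactCoeff b a k`. -/
noncomputable def coactCoeff (b a : ℕ) : ℕ → FunAlg q :=
  (coactStep q (.gen q .be) (.gen q .de))^[b]
    ((coactStep q (.gen q .al) (.gen q .ga))^[a] (Pi.single 0 1))

/-- The matrix element `t^l_{n - l, m - l}` of the irreducible corepresentation of `A_q(SU(2))` of
dimension `L + 1 = 2 l + 1`, for `n, m ∈ {0, …, 2 l}`: this corepresentation is the coaction on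
the homogeneous polynomials of degree `2 l` on the quantum plane, with the orthonormal basis
`e^l_{k - l} = [2 l, k]_{q²}^{1/2} y^k x^{2 l - k}`. -/
noncomputable def matrixElement (L : ℕ) (n m : Fin (L + 1)) : FunAlg q :=
  ((√(qBinom ((q : ℝ) ^ 2) L m / qBinom ((q : ℝ) ^ 2) L n) : ℝ) : ℂ) • coactCoeff q m (L - m) n

/-- The constant `C^{l,j}(σ) = q^{l+j} [2l, l-j]_{q²}^{1/2}
((1 + q^{-4j-2σ}) / (1 + q^{-2σ}))^{1/2} ((-q^{2-2σ}; q²)_{l-j} (-q^{2+2σ}; q²)_{l+j})^{-1/2}`. -/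
noncomputable def normConst (L : ℕ) (J : ℤ) (σ : ℝ) : ℝ :=
  (q : ℝ) ^ (((L : ℝ) + J) / 2) * √(qBinom ((q : ℝ) ^ 2) L (half (L - J)))
    * √((1 + (q : ℝ) ^ (-2 * (J : ℝ) - 2 * σ)) / (1 + (q : ℝ) ^ (-2 * σ)))
    * (√(qPoch (-(q : ℝ) ^ (2 - 2 * σ)) ((q : ℝ) ^ 2) (half (L - J))
        * qPoch (-(q : ℝ) ^ (2 + 2 * σ)) ((q : ℝ) ^ 2) (half (L + J))))⁻¹

/-- The coordinate `v^{l,j}_n(σ) = C^{l,j}(σ) i^{n-l} q^{σ(l-n)} q^{(l-n)(l-n-1)/2}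
((q^{4l}; q^{-2})_{l-n} / (q²; q²)_{l-n})^{1/2}
R_{l-n}(q^{2j-2l} - q^{-2j-2l-2σ}; q^{2σ}, 2l; q²)` in terms of `r = l - n`. -/
noncomputable def eigenCoord (L : ℕ) (J : ℤ) (σ : ℝ) (r : ℕ) : ℂ :=
  Complex.I ^ (-(r : ℤ)) *
    ((normConst q L J σ * (q : ℝ) ^ (σ * r) * (q : ℝ) ^ ((r : ℝ) * ((r : ℝ) - 1) / 2)
      * √(qBinom ((q : ℝ) ^ 2) L r)
      * dualKrawtchouk ((q : ℝ) ^ 2) σ L r (half (L - J)) : ℝ) : ℂ)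

/-- The vector `v^{l,j}(σ) = ∑_n v^{l,j}_n(σ) e^l_n`. -/
noncomputable def eigenVector (L : ℕ) (J : ℤ) (σ : ℝ) : EuclideanSpace ℂ (Fin (L + 1)) :=
  WithLp.toLp 2 fun k => eigenCoord q L J σ (L - k)

/-- The linear functional `X ↦ ⟨t^l(X) v^{l,j}(σ), v^{l,i}(τ)⟩` on `U_q(su(2))`. -/
noncomputable def genFunctional (L : ℕ) (I J : ℤ) (τ σ : ℝ) (X : EnvAlg q) : ℂ :=
  inner ℂ (eigenVector q L I τ)
    (WithLp.toLp 2 (Matrix.mulVec (spinRep q L X) (eigenVector q L J σ).ofLp))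

/-- The generalised matrix element `a^l_{i,j}(τ,σ) = ∑_{n,m} v^{l,j}_m(σ) conj(v^{l,i}_n(τ))
t^l_{n,m}` in `A_q(SU(2))`. -/
noncomputable def genElement (L : ℕ) (I J : ℤ) (τ σ : ℝ) : FunAlg q :=
  ∑ n : Fin (L + 1), ∑ m : Fin (L + 1),
    (eigenVector q L J σ m * (starRingEnd ℂ) (eigenVector q L I τ n)) • matrixElement q L n m

/-- The element `ρ_{τ,σ} = ½ (α² + δ² + q γ² + q⁻¹ β² + i (q^{-σ} - q^σ) (q δγ + βα)
- i (q^{-τ} - q^τ) (δβ + q γα) + (q^{-σ} - q^σ) (q^{-τ} - q^τ) βγ)`. -/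
noncomputable def rho (τ σ : ℝ) : FunAlg q :=
  let a := FunAlg.gen q .al
  let b := FunAlg.gen q .be
  let c := FunAlg.gen q .ga
  let d := FunAlg.gen q .de
  (1 / 2 : ℂ) • (a * a + d * d + qc q • (c * c) + (qc q)⁻¹ • (b * b)
    + (Complex.I * (qpow q (-σ) - qpow q σ)) • (qc q • (d * c) + b * a)
    - (Complex.I * (qpow q (-τ) - qpow q τ)) • (d * b + qc q • (c * a))
    + ((qpow q (-σ) - qpow q σ) * (qpow q (-τ) - qpow q τ)) • (b * c))

/-- The element `D.ρ_{τ,σ}`. -/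
noncomputable def shiftedRho (τ σ : ℝ) : FunAlg q := leftAction q (.gen q .D) (rho q τ σ)

/-- The constant `d^l_{i,j}(τ,σ) = C^{l,j}(σ) C^{l,i}(τ) / (C^{i,j}(σ) C^{i,i}(τ))
q^{i-l} / (q^{4l}; q^{-2})_{l-i}`, for `i ≥ 0`. -/
noncomputable def ratioConst (L : ℕ) (I J : ℤ) (τ σ : ℝ) : ℝ :=
  normConst q L J σ * normConst q L I τ / (normConst q I.toNat J σ * normConst q I.toNat I τ)
    * ((q : ℝ) ^ (((I : ℝ) - L) / 2)
      / qPoch (((q : ℝ) ^ 2) ^ L) ((q : ℝ) ^ 2)⁻¹ (half (L - I)))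

end GeneralisedMatrixElements

end QSU2

/-! Write p = q², t = q^τ, s = q^σ. Up to the constant C^{l,j}(σ) C^{l,i}(τ), the element a^l_{i,j}
is a bilinear form in the coaction coefficients of degree L = 2l, with dual q-Krawtchouk vectors
labelled by l - i and l - j in its two slots (`genElement_eq`, `krawElt`). The proof is a recursion
in the spin.

One more multiplication by the image of a quantum plane coordinate raises the degree of the coaction
by one, and a ₃φ₂ of order N + 1 is a combination of two of order N, or, weighted by Gaussian
binomials, of two degrees of a single one (`kraw_lower_order`, `kraw_lower_order_degree`,
`kraw_raise_order`). Together these give `krawForm_succ`: a form of degree L + 1 is a sum of two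
terms, each a linear element δ + iTβ - iUγ + TUα times a form of degree L. When the row label is 0
only one term survives. So a^i_{i,j} is proportional to a product of 2i linear elements, and
applying τ_λ factor by factor gives the stated products (`character_krawElt`).

Two linear elements with matched parameters multiply to q⁻¹(Q + scalar), where Q is `quadElt`, equal
to 2 D.ρ at (t, s); in the other order they give Q with shifted parameters and the same scalar
(`linElt_mul_linElt_left`, `linElt_mul_linElt_right`). Hence linear elements intertwine shifted
copies of Q, and a shifted Q passes through the whole product to become 2 D.ρ on its right
(`quadElt_mul_krawElt`).

For a positive row label, induct on l - i (`krawElt_eq_askeyWilson`). The recursion gives two terms.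
By induction each is a linear element times a product of linear elements times an Askey-Wilson
polynomial in D.ρ, with b or d replaced by bp or dp. The two leading linear elements combine to a
quadratic in D.ρ, proportional to 1 - 2bX + b² or 1 - 2dX + d², and the sum is the contiguous
relation `askeyWilson_contiguous`. This settles |j| ≤ i.

The other ranges follow by symmetry. The automorphism β ↦ -γ, γ ↦ -β exchanges (i, τ) with (j, σ).
The automorphism β ↦ -β, γ ↦ -γ, with the reversal symmetry of dual q-Krawtchouk polynomials
(`kraw_reverse`), reverses all of i, j, τ, σ.

The pairing statement is independent of this: evaluation at the t^l_{n,m} is an algebra homomorphism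
from functionals under convolution to matrices, so it suffices to compare it with t^l on the
generators (`pairing_matrixElement`). -/

namespace QSU2

/-! ## Rank one linear elements and the element `2 D.ρ` -/

section LinearElements

variable (q : QParam)

/-- The linear element `δ + i T β - i U γ + T U α`. -/
noncomputable def linElt (T U : ℂ) : FunAlg q :=
  FunAlg.gen q .de + (Complex.I * T) • FunAlg.gen q .be - (Complex.I * U) • FunAlg.gen q .ga
    + (T * U) • FunAlg.gen q .al

/-- The quadratic element which specialises to `2 D.ρ` at `t = q^τ`, `u = q^σ`. -/
noncomputable def quadElt (t u : ℂ) : FunAlg q :=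
  let a := FunAlg.gen q .al
  let b := FunAlg.gen q .be
  let c := FunAlg.gen q .ga
  let d := FunAlg.gen q .de
  (qc q)⁻¹ • (a * a) + qc q • (d * d) + c * c + b * b
    + (Complex.I * (u⁻¹ - u)) • (qc q • (d * c) + b * a)
    - (Complex.I * (t⁻¹ - t)) • (qc q • (d * b) + c * a)
    + ((u⁻¹ - u) * (t⁻¹ - t)) • (b * c)

variable {q}

/-- Only u⁻¹ - u enters. This identifies the quadratic elements attached to the two numerator
parameters of one Krawtchouk node, which give U and -U⁻¹ by `mul_krawArg_eq`. -/
theorem quadElt_neg_inv (t u : ℂ) : quadElt q t (-u⁻¹) = quadElt q t u := by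
  have : (-u⁻¹)⁻¹ - -u⁻¹ = u⁻¹ - u := by rw [inv_neg, inv_inv]; ring
  simp only [quadElt, this]

/-- This factorises Q up to a scalar: the parameters -(qt)⁻¹ and -(qu)⁻¹ are those for which the
quadratic terms are proportional to `quadElt` at (t, u), the remainder coming from the determinant
relations. -/
theorem linElt_mul_linElt_left {t u : ℂ} (ht : t ≠ 0) (hu : u ≠ 0) :
    linElt q (-(qc q * t)⁻¹) (-(qc q * u)⁻¹) * linElt q t u =
      (qc q)⁻¹ • (quadElt q t u + algebraMap ℂ _ (qc q * t * u + (qc q * t * u)⁻¹)) := by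
  have h0 := qc_ne_zero q
  obtain ⟨ab, ac, bd, cd, bc, ad, da⟩ := FunAlg.gen_rels q
  have ad' := sub_eq_iff_eq_add.mp ad
  have da' := sub_eq_iff_eq_add.mp da
  have cb := bc.symm
  have hI := Complex.I_sq
  -- The relations are oriented so that quadratic monomials end up in the order δ, β, γ, α, while αδ
  -- and δα are replaced by 1 plus a multiple of βγ. It then remains to compare coefficients.
  simp only [linElt, quadElt, Algebra.algebraMap_eq_smul_one, add_mul, mul_add, sub_mul, mul_sub,
    smul_mul_assoc, mul_smul_comm, ab, ac, bd, cd, cb, ad', da']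
  match_scalars <;> field_simp <;> ring_nf <;> simp only [hI] <;> ring

theorem linElt_mul_linElt_right {t u : ℂ} (ht : t ≠ 0) (hu : u ≠ 0) :
    linElt q t u * linElt q (-(qc q * t)⁻¹) (-(qc q * u)⁻¹) =
      (qc q)⁻¹ • (quadElt q (qc q * t) (qc q * u)
        + algebraMap ℂ _ (qc q * t * u + (qc q * t * u)⁻¹)) := by
  have h0 := qc_ne_zero q
  obtain ⟨ab, ac, bd, cd, bc, ad, da⟩ := FunAlg.gen_rels q
  have ad' := sub_eq_iff_eq_add.mp ad
  have da' := sub_eq_iff_eq_add.mp da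
  have cb := bc.symm
  have hI := Complex.I_sq
  simp only [linElt, quadElt, Algebra.algebraMap_eq_smul_one, add_mul, mul_add, sub_mul, mul_sub,
    smul_mul_assoc, mul_smul_comm, ab, ac, bd, cd, cb, ad', da']
  match_scalars <;> field_simp <;> ring_nf <;> simp only [hI] <;> ring

/-- With ℓ = `linElt q t u` and ℓ' its partner, this is ℓ(ℓ'ℓ) = (ℓℓ')ℓ: both inner products are
q⁻¹(Q + c) with the same scalar c, but with Q at (t, u) and at (qt, qu). -/
theorem quadElt_mul_linElt {t u : ℂ} (ht : t ≠ 0) (hu : u ≠ 0) :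
    quadElt q (qc q * t) (qc q * u) * linElt q t u = linElt q t u * quadElt q t u := by
  have h0 := qc_ne_zero q
  have h1 := linElt_mul_linElt_left (q := q) ht hu
  have h2 := linElt_mul_linElt_right (q := q) ht hu
  rw [eq_inv_smul_iff₀ h0] at h1 h2
  rw [← sub_eq_iff_eq_add] at h1 h2
  rw [← h1, ← h2, sub_mul, mul_sub, smul_mul_assoc, mul_smul_comm, mul_assoc,
    Algebra.commutes]

theorem qpow_neg (x : ℝ) : qpow q (-x) = (qpow q x)⁻¹ :=
  eq_inv_of_mul_eq_one_right (by rw [← qpow_add, add_neg_cancel, qpow_zero])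

theorem pairing_D : pairing q (.gen q .D) = (pairD q).toLinearMap := by
  unfold pairing pairingHom
  rw [EnvAlg.lift_gen]
  rfl

/-- Since ⟨D, ·⟩ is multiplicative, D acts by an algebra endomorphism, which only rescales the
generators. -/
theorem leftAction_D (ξ : FunAlg q) : leftAction q (.gen q .D) ξ =
    ((Algebra.TensorProduct.rid ℂ ℂ (FunAlg q)).toAlgHom.comp
      ((Algebra.TensorProduct.map (.id ℂ _) (pairD q)).comp (FunAlg.comulHom q))) ξ := by
  unfold leftAction
  rw [pairing_D]
  rfl

theorem leftAction_D_gen (g : AGen) : ((Algebra.TensorProduct.rid ℂ ℂ (FunAlg q)).toAlgHom.comp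
      ((Algebra.TensorProduct.map (.id ℂ _) (pairD q)).comp (FunAlg.comulHom q))) (.gen q g) =
    FunAlg.assign ((qpow q (1 / 2))⁻¹) (qpow q (1 / 2)) ((qpow q (1 / 2))⁻¹) (qpow q (1 / 2)) g
      • FunAlg.gen q g := by
  cases g <;> simp [FunAlg.comulHom, FunAlg.lift_gen, FunAlg.assign, pairD_gen, -one_div]

theorem shiftedRho_eq (τ σ : ℝ) :
    shiftedRho q τ σ = (1 / 2 : ℂ) • quadElt q (qpow q τ) (qpow q σ) := by
  have h0 := qc_ne_zero q
  have h1 := half_mul_half q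
  have h2 := qpow_ne_zero q (1 / 2)
  unfold shiftedRho
  rw [leftAction_D]
  simp only [rho, map_smul, map_add, map_sub, map_mul, leftAction_D_gen, FunAlg.assign, qpow_neg,
    quadElt, smul_mul_assoc, mul_smul_comm, ← h1]
  match_scalars <;> field_simp

end LinearElements

/-! ## The coaction on the quantum plane -/

section Coaction

variable {q : QParam}

theorem coactStep_zero (u v : FunAlg q) (f : ℕ → FunAlg q) : coactStep q u v f 0 = u * f 0 := rfl

theorem coactStep_succ (u v : FunAlg q) (f : ℕ → FunAlg q) (k : ℕ) :
    coactStep q u v f (k + 1) = qc q ^ (k + 1) • (u * f (k + 1)) + v * f k := rfl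

theorem coactStep_smul (u v : FunAlg q) (z : ℂ) (f : ℕ → FunAlg q) :
    coactStep q u v (z • f) = z • coactStep q u v f := by
  funext k
  cases k with
  | zero => simp [coactStep_zero]
  | succ k => simp [coactStep_succ, smul_comm z]

theorem coactStep_vanish {u v : FunAlg q} {f : ℕ → FunAlg q} {L : ℕ} (hf : ∀ k, L < k → f k = 0)
    (k : ℕ) (hk : L + 1 < k) : coactStep q u v f k = 0 := by
  cases k with
  | zero => omega
  | succ k => rw [coactStep_succ, hf _ (by omega), hf _ (by omega)]; simp

/-- The two steps of the coaction commute up to `q`, as `x` and `y` do. -/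
theorem coactStep_comm (f : ℕ → FunAlg q) :
    coactStep q (.gen q .al) (.gen q .ga) (coactStep q (.gen q .be) (.gen q .de) f) =
      qc q • coactStep q (.gen q .be) (.gen q .de)
        (coactStep q (.gen q .al) (.gen q .ga) f) := by
  have h0 := qc_ne_zero q
  obtain ⟨ab, ac, bd, cd, bc, ad, da⟩ := FunAlg.gen_rels q
  have ad' := sub_eq_iff_eq_add.mp ad
  have da' := sub_eq_iff_eq_add.mp da
  have cb := bc.symm
  funext k
  -- Two steps reach back two coefficients, so 0 and 1 are boundary cases.
  rcases k with _ | _ | k <;>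
  · simp only [Pi.smul_apply, coactStep_zero, coactStep_succ, mul_add, mul_smul_comm, ← mul_assoc,
      ab, cd, cb, ad', da', smul_mul_assoc, add_mul, one_mul]
    try match_scalars
    all_goals field_simp
    all_goals ring

/-- The coefficients of the coaction in degree `L`: the image of `y^m x^{L-m}` is
`∑_n y^n x^{L-n} ⊗ coactMat L n m`. -/
noncomputable def coactMat (q : QParam) (L n m : ℕ) : FunAlg q := coactCoeff q m (L - m) n

theorem coactCoeff_succ_left (b a : ℕ) : coactCoeff q (b + 1) a =
    coactStep q (.gen q .be) (.gen q .de) (coactCoeff q b a) :=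
  Function.iterate_succ_apply' ..

/-- The new factor x has to be moved past y^b, and x y^b = q^b y^b x. -/
theorem coactCoeff_succ_right (b a : ℕ) : qc q ^ b • coactCoeff q b (a + 1) =
    coactStep q (.gen q .al) (.gen q .ga) (coactCoeff q b a) := by
  induction b with
  | zero =>
    rw [pow_zero, one_smul]
    exact Function.iterate_succ_apply' ..
  | succ b ih =>
    rw [coactCoeff_succ_left, coactCoeff_succ_left, coactStep_comm, ← ih, coactStep_smul,
      smul_smul, pow_succ']

theorem coactCoeff_vanish (b a : ℕ) (k : ℕ) (hk : b + a < k) : coactCoeff q b a k = 0 := by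
  have h : ∀ a k, a < k → ((coactStep q (.gen q .al) (.gen q .ga))^[a] (Pi.single 0 1)) k = 0 := by
    intro a
    induction a with
    | zero => intro k hk; simp [hk.ne']
    | succ a ih =>
      rw [Function.iterate_succ_apply']
      exact coactStep_vanish ih
  induction b generalizing k with
  | zero => exact h a k (by omega)
  | succ b ih =>
    rw [coactCoeff_succ_left]
    exact coactStep_vanish (L := b + a) (fun k hk => ih k hk) k (by omega)

theorem coactMat_vanish {L n m : ℕ} (hm : m ≤ L) (hn : L < n) : coactMat q L n m = 0 :=
  coactCoeff_vanish _ _ _ (by omega)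

theorem coactMat_zero : coactMat q 0 0 0 = 1 := by simp [coactMat, coactCoeff]

theorem coactMat_succ_right (L n m : ℕ) : coactMat q (L + 1) n (m + 1) =
    coactStep q (.gen q .be) (.gen q .de) (fun k => coactMat q L k m) n := by
  rw [coactMat, Nat.add_sub_add_right, coactCoeff_succ_left]
  rfl

theorem coactMat_succ_left {L m : ℕ} (n : ℕ) (hm : m ≤ L) : qc q ^ m • coactMat q (L + 1) n m =
    coactStep q (.gen q .al) (.gen q .ga) (fun k => coactMat q L k m) n := by
  rw [coactMat, Nat.sub_add_comm hm, ← Pi.smul_apply, coactCoeff_succ_right]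
  rfl

/-- The characters at the coefficients of the coaction. -/
theorem character_coactMat (z : ℂˣ) {L m : ℕ} (n : ℕ) (hm : m ≤ L) :
    character q z (coactMat q L n m) = if n = m then (z : ℂ) ^ ((L : ℤ) - 2 * m) else 0 := by
  have hz : (z : ℂ) ≠ 0 := z.ne_zero
  have hs : ∀ (g g' : AGen) (f : ℕ → FunAlg q) (k : ℕ), character q z
      (coactStep q (.gen q g) (.gen q g') f (k + 1)) =
      qc q ^ (k + 1) * (FunAlg.assign (z : ℂ) 0 0 ((z⁻¹ : ℂˣ) : ℂ) g * character q z (f (k + 1)))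
        + FunAlg.assign (z : ℂ) 0 0 ((z⁻¹ : ℂˣ) : ℂ) g' * character q z (f k) := by
    intro g g' f k
    simp [coactStep_succ, character, FunAlg.lift_gen]
  have h0 : ∀ (g g' : AGen) (f : ℕ → FunAlg q), character q z
      (coactStep q (.gen q g) (.gen q g') f 0) =
      FunAlg.assign (z : ℂ) 0 0 ((z⁻¹ : ℂˣ) : ℂ) g * character q z (f 0) := by
    intro g g' f
    simp [coactStep_zero, character, FunAlg.lift_gen]
  induction L generalizing n m with
  | zero =>
    obtain rfl : m = 0 := by omega
    cases n with
    | zero => simp [coactMat_zero]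
    | succ n => rw [coactMat_vanish le_rfl (by omega)]; simp
  | succ L ih =>
    -- Column 0 contains no factor y, so it is lowered by the (α, γ) step; every other column is
    -- lowered by the (β, δ) step.
    rcases m with _ | m
    · have h := coactMat_succ_left (q := q) n (Nat.zero_le L)
      rw [pow_zero, one_smul] at h
      rw [h]
      cases n with
      | zero =>
        rw [h0, ih _ (Nat.zero_le L)]
        simp [FunAlg.assign, zpow_add₀ hz, mul_comm]
      | succ n =>
        rw [hs, ih _ (Nat.zero_le L), ih _ (Nat.zero_le L)]
        simp [FunAlg.assign]
    · rw [coactMat_succ_right]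
      cases n with
      | zero =>
        rw [h0, ih _ (by omega : m ≤ L)]
        simp [FunAlg.assign]
      | succ n =>
        rw [hs, ih _ (by omega : m ≤ L), ih _ (by omega : m ≤ L)]
        by_cases h : n = m
        · subst h
          simp only [FunAlg.assign, zero_mul, mul_zero, zero_add, if_true,
            Units.val_inv_eq_inv_val, ← zpow_neg_one (z : ℂ), ← zpow_add₀ hz]
          congr 1
          push_cast
          ring
        · simp [FunAlg.assign, h]

/-- The comultiplication at the coefficients of the coaction. -/
theorem comulHom_coactMat {L m : ℕ} (n : ℕ) (hm : m ≤ L) :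
    FunAlg.comulHom q (coactMat q L n m) =
      ∑ j ∈ Finset.range (L + 1), coactMat q L n j ⊗ₜ[ℂ] coactMat q L j m := by
  have hq := qc_ne_zero q
  -- Here (g, g') is a column of the generator matrix and (u, v) the same column in the second
  -- tensor factor, so that one argument serves both (α, γ) and (β, δ).
  have step : ∀ (g g' : AGen) (u v : FunAlg q) (L : ℕ) (f : ℕ → FunAlg q) (n : ℕ),
      FunAlg.comulHom q (.gen q g) = .gen q .al ⊗ₜ u + .gen q .be ⊗ₜ v →
      FunAlg.comulHom q (.gen q g') = .gen q .ga ⊗ₜ u + .gen q .de ⊗ₜ v →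
      (∀ k, L < k → f k = 0) →
      (∀ n, FunAlg.comulHom q (f n) = ∑ j ∈ Finset.range (L + 1), coactMat q L n j ⊗ₜ[ℂ] f j) →
      FunAlg.comulHom q (coactStep q (.gen q g) (.gen q g') f n) =
        ∑ j ∈ Finset.range (L + 2), coactMat q (L + 1) n j ⊗ₜ[ℂ] coactStep q u v f j := by
    intro g g' u v L f n hg hg' hv hf
    -- The factor q^{j+1} in the step on the right leg is the one that lowering column j + 1 through
    -- (α, γ) requires on the left leg.
    have e1 : ∀ n, ∑ j ∈ Finset.range (L + 2), coactMat q (L + 1) n j ⊗ₜ[ℂ] coactStep q u v f j =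
        ∑ j ∈ Finset.range (L + 1), ((coactStep q (.gen q .al) (.gen q .ga)
            (fun k => coactMat q L k j) n) ⊗ₜ[ℂ] (u * f j)
          + (coactStep q (.gen q .be) (.gen q .de)
            (fun k => coactMat q L k j) n) ⊗ₜ[ℂ] (v * f j)) := by
      intro n
      rw [Finset.sum_add_distrib, Finset.sum_range_succ', coactStep_zero]
      simp only [coactStep_succ, TensorProduct.tmul_add, Finset.sum_add_distrib,
        ← coactMat_succ_right]
      rw [add_right_comm]
      congr 1
      rw [Finset.sum_range_succ, hv (L + 1) (by omega), mul_zero, smul_zero,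
        TensorProduct.tmul_zero, add_zero, Finset.sum_range_succ']
      congr 1
      · refine Finset.sum_congr rfl fun j hj => ?_
        rw [← coactMat_succ_left n (by simp at hj; omega : j + 1 ≤ L), TensorProduct.tmul_smul,
          TensorProduct.smul_tmul']
      · rw [← coactMat_succ_left n (Nat.zero_le L), pow_zero, one_smul]
    rw [e1]
    cases n with
    | zero =>
      simp only [coactStep_zero, map_mul, hg, hf, Finset.mul_sum, add_mul,
        Algebra.TensorProduct.tmul_mul_tmul]
    | succ n =>
      simp only [coactStep_succ, map_add, map_smul, map_mul, hg, hg', hf, Finset.mul_sum, add_mul,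
        Algebra.TensorProduct.tmul_mul_tmul, Finset.smul_sum, ← Finset.sum_add_distrib,
        TensorProduct.add_tmul, ← TensorProduct.smul_tmul', smul_add]
      refine Finset.sum_congr rfl fun j _ => ?_
      abel
  induction L generalizing n m with
  | zero =>
    obtain rfl : m = 0 := by omega
    cases n with
    | zero => simp [coactMat_zero, Algebra.TensorProduct.one_def]
    | succ n => simp [coactMat_vanish (q := q) (le_refl 0) (Nat.succ_pos n)]
  | succ L ih =>
    rcases m with _ | m
    · have h := fun n => coactMat_succ_left (q := q) n (Nat.zero_le L)
      simp only [pow_zero, one_smul] at h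
      simp only [h _]
      exact step _ _ _ _ L _ n (by simp [FunAlg.comulHom, FunAlg.lift_gen, FunAlg.assign])
        (by simp [FunAlg.comulHom, FunAlg.lift_gen, FunAlg.assign])
        (fun k hk => coactMat_vanish (Nat.zero_le L) hk) (fun n => ih n (Nat.zero_le L))
    · simp only [coactMat_succ_right _ _ m]
      exact step _ _ _ _ L _ n (by simp [FunAlg.comulHom, FunAlg.lift_gen, FunAlg.assign])
        (by simp [FunAlg.comulHom, FunAlg.lift_gen, FunAlg.assign])
        (fun k hk => coactMat_vanish (by omega) hk) (fun n => ih n (by omega))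

end Coaction

/-! ## Gaussian binomial coefficients -/

section Binomial

variable {p : ℝ}

theorem one_sub_pow_succ_pos (h0 : 0 < p) (h1 : p < 1) (k : ℕ) : 0 < 1 - p ^ (k + 1) :=
  sub_pos.mpr (pow_lt_one₀ h0.le h1 (Nat.succ_ne_zero k))

theorem qPoch_self_pos (h0 : 0 < p) (h1 : p < 1) (k : ℕ) : 0 < qPoch p p k :=
  Finset.prod_pos fun i _ => by rw [← pow_succ']; exact one_sub_pow_succ_pos h0 h1 i

theorem qPoch_zero_right {R : Type*} [CommRing R] (a b : R) : qPoch a b 0 = 1 := by simp [qPoch]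

theorem qPoch_succ {R : Type*} [CommRing R] (a b : R) (k : ℕ) :
    qPoch a b (k + 1) = qPoch a b k * (1 - a * b ^ k) := Finset.prod_range_succ ..

theorem qPoch_succ_left {R : Type*} [CommRing R] (a b : R) (k : ℕ) :
    qPoch a b (k + 1) = (1 - a) * qPoch (a * b) b k := by
  rw [qPoch, Finset.prod_range_succ', mul_comm, pow_zero, mul_one, qPoch]
  simp only [pow_succ', mul_assoc]

theorem qBinom_zero_right (p : ℝ) (n : ℕ) : qBinom p n 0 = 1 := by simp [qBinom, qPoch]

theorem qBinom_succ_succ_mul (h0 : 0 < p) (h1 : p < 1) (n k : ℕ) :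
    (1 - p ^ (k + 1)) * qBinom p (n + 1) (k + 1) = (1 - p ^ (n + 1)) * qBinom p n k := by
  have h2 := (qPoch_self_pos h0 h1 k).ne'
  have h3 := (one_sub_pow_succ_pos h0 h1 k).ne'
  have e : p ^ (n + 1) * p⁻¹ = p ^ n := by field_simp; ring
  rw [qBinom, qBinom, qPoch_succ_left, e, qPoch_succ, ← pow_succ']
  field_simp

theorem qBinom_succ_mul (h0 : 0 < p) (n k : ℕ) :
    (1 - p ^ (n + 1) * p⁻¹ ^ k) * qBinom p (n + 1) k = (1 - p ^ (n + 1)) * qBinom p n k := by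
  have e : p ^ (n + 1) * p⁻¹ = p ^ n := by field_simp; ring
  have h := qPoch_succ (p ^ (n + 1)) p⁻¹ k
  rw [qPoch_succ_left, e] at h
  rw [qBinom, qBinom, ← mul_div_assoc, ← mul_div_assoc, h, mul_comm]

theorem qBinom_pascal (h0 : 0 < p) (h1 : p < 1) (n k : ℕ) :
    qBinom p (n + 1) (k + 1) = qBinom p n k + p ^ (k + 1) * qBinom p n (k + 1) := by
  have h2 := (one_sub_pow_succ_pos h0 h1 n).ne'
  have h3 : p⁻¹ ^ (k + 1) * p ^ (k + 1) = 1 := by rw [← mul_pow, inv_mul_cancel₀ h0.ne', one_pow]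
  apply mul_left_cancel₀ h2
  linear_combination qBinom_succ_succ_mul h0 h1 n k
    + p ^ (k + 1) * qBinom_succ_mul h0 n (k + 1)
    + (p ^ (n + 1) * qBinom p (n + 1) (k + 1)) * h3

theorem qBinom_pascal' (h0 : 0 < p) (h1 : p < 1) (n k : ℕ) :
    qBinom p (n + 1) (k + 1) = p ^ n * p⁻¹ ^ k * qBinom p n k + qBinom p n (k + 1) := by
  have h2 := (one_sub_pow_succ_pos h0 h1 n).ne'
  have h3 : p ^ n * p⁻¹ ^ k = p ^ (n + 1) * p⁻¹ ^ (k + 1) := by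
    rw [pow_succ, pow_succ]; field_simp
  have h4 : p⁻¹ ^ (k + 1) * p ^ (k + 1) = 1 := by rw [← mul_pow, inv_mul_cancel₀ h0.ne', one_pow]
  apply mul_left_cancel₀ h2
  rw [h3]
  linear_combination (p ^ (n + 1) * p⁻¹ ^ (k + 1)) * qBinom_succ_succ_mul h0 h1 n k
    + qBinom_succ_mul h0 n (k + 1)
    + (p ^ (n + 1) * qBinom p (n + 1) (k + 1)) * h4

theorem qBinom_eq_zero (h0 : 0 < p) {n k : ℕ} (h : n < k) : qBinom p n k = 0 := by
  rw [qBinom, qPoch, Finset.prod_eq_zero (Finset.mem_range.mpr h), zero_div]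
  rw [← mul_pow, mul_inv_cancel₀ h0.ne', one_pow, sub_self]

theorem qBinom_pos (h0 : 0 < p) (h1 : p < 1) {n k : ℕ} (h : k ≤ n) : 0 < qBinom p n k := by
  refine div_pos (Finset.prod_pos fun i hi => ?_) (qPoch_self_pos h0 h1 k)
  have hi' : i < k := Finset.mem_range.mp hi
  have : p ^ n * p⁻¹ ^ i = p ^ (n - i - 1 + 1) := by
    rw [show n - i - 1 + 1 = n - i by omega, pow_sub₀ _ h0.ne' (by omega), inv_pow]
  rw [this]
  exact one_sub_pow_succ_pos h0 h1 _

/-- The two Pascal rules are exchanged by k ↔ n - k, so one is applied to each side. -/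
theorem qBinom_symm (h0 : 0 < p) (h1 : p < 1) {n a b : ℕ} (h : a + b = n) :
    qBinom p n a = qBinom p n b := by
  induction n generalizing a b with
  | zero =>
    obtain ⟨rfl, rfl⟩ : a = 0 ∧ b = 0 := by omega
    rfl
  | succ n ih =>
    have hself : ∀ n, qBinom p n n = 1 := by
      intro n
      induction n with
      | zero => exact qBinom_zero_right p 0
      | succ n ih' => rw [qBinom_pascal h0 h1, ih', qBinom_eq_zero h0 (Nat.lt_succ_self n)]; ring
    rcases a with _ | a
    · obtain rfl : b = n + 1 := by omega
      rw [hself, qBinom_zero_right]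
    rcases b with _ | b
    · obtain rfl : a = n := by omega
      rw [hself, qBinom_zero_right]
    obtain rfl : n = a + 1 + b := by omega
    have e : p ^ (a + 1 + b) * p⁻¹ ^ b = p ^ (a + 1) := by
      rw [pow_add, mul_assoc, ← mul_pow, mul_inv_cancel₀ h0.ne', one_pow, mul_one]
    rw [qBinom_pascal h0 h1, qBinom_pascal' h0 h1, ih (a := a) (b := b + 1) (by omega),
      ih (a := a + 1) (b := b) (by omega), e]
    ring

end Binomial

/-! ## Automorphisms -/

section Automorphisms

variable {q : QParam}

theorem sq_pos_lt_one (q : QParam) : 0 < (q : ℝ) ^ 2 ∧ (q : ℝ) ^ 2 < 1 :=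
  ⟨pow_pos q.2.1 2, pow_lt_one₀ q.2.1.le q.2.2 two_ne_zero⟩

/-- β and γ commute and satisfy the same relations with α and δ, so the generator matrix may be
transposed; the signs cancel in βγ. -/
theorem swap_rels (q : QParam) :
    ARels q (FunAlg.gen q .al) (-FunAlg.gen q .ga) (-FunAlg.gen q .be) (FunAlg.gen q .de) := by
  obtain ⟨ab, ac, bd, cd, bc, ad, da⟩ := FunAlg.gen_rels q
  rw [bc] at ad da
  constructor <;> simp [*]

theorem sign_rels (q : QParam) :
    ARels q (FunAlg.gen q .al) (-FunAlg.gen q .be) (-FunAlg.gen q .ga) (FunAlg.gen q .de) := by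
  obtain ⟨ab, ac, bd, cd, bc, ad, da⟩ := FunAlg.gen_rels q
  rw [bc] at ad da
  constructor <;> simp [*]

/-- The automorphism with `β ↦ -γ` and `γ ↦ -β`. -/
noncomputable def swapHom (q : QParam) : FunAlg q →ₐ[ℂ] FunAlg q := FunAlg.lift (swap_rels q)

/-- The automorphism with `β ↦ -β` and `γ ↦ -γ`. -/
noncomputable def signHom (q : QParam) : FunAlg q →ₐ[ℂ] FunAlg q := FunAlg.lift (sign_rels q)

theorem swapHom_gen (g : AGen) : swapHom q (.gen q g) = FunAlg.assign (FunAlg.gen q .al)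
    (-FunAlg.gen q .ga) (-FunAlg.gen q .be) (FunAlg.gen q .de) g := FunAlg.lift_gen _ g

theorem signHom_gen (g : AGen) : signHom q (.gen q g) = FunAlg.assign (FunAlg.gen q .al)
    (-FunAlg.gen q .be) (-FunAlg.gen q .ga) (FunAlg.gen q .de) g := FunAlg.lift_gen _ g

theorem swapHom_swapHom (x : FunAlg q) : swapHom q (swapHom q x) = x := by
  have : (swapHom q).comp (swapHom q) = .id ℂ _ :=
    FunAlg.algHom_ext fun g => by cases g <;> simp [swapHom_gen, FunAlg.assign]
  exact congr($this x)

theorem character_swapHom (z : ℂˣ) (x : FunAlg q) :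
    character q z (swapHom q x) = character q z x := by
  have : (character q z).comp (swapHom q) = character q z :=
    FunAlg.algHom_ext fun g => by
      cases g <;> simp [swapHom_gen, character, FunAlg.lift_gen, FunAlg.assign]
  exact congr($this x)

theorem character_signHom (z : ℂˣ) (x : FunAlg q) :
    character q z (signHom q x) = character q z x := by
  have : (character q z).comp (signHom q) = character q z :=
    FunAlg.algHom_ext fun g => by
      cases g <;> simp [signHom_gen, character, FunAlg.lift_gen, FunAlg.assign]
  exact congr($this x)

theorem swapHom_linElt (T U : ℂ) : swapHom q (linElt q T U) = linElt q U T := by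
  simp only [linElt, map_add, map_sub, map_smul, swapHom_gen, FunAlg.assign]
  match_scalars <;> ring

theorem swapHom_quadElt (t u : ℂ) : swapHom q (quadElt q t u) = quadElt q u t := by
  simp only [quadElt, map_add, map_sub, map_smul, map_mul, swapHom_gen, FunAlg.assign, mul_neg,
    neg_mul, neg_neg, ← (FunAlg.gen_rels q).bc]
  match_scalars <;> ring

/-- Inverting both parameters changes the sign of u⁻¹ - u and t⁻¹ - t. This is undone by the sign on
the monomials containing exactly one of β, γ, and cancels in the βγ coefficient. -/
theorem signHom_quadElt (t u : ℂ) : signHom q (quadElt q t⁻¹ u⁻¹) = quadElt q t u := by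
  simp only [quadElt, map_add, map_sub, map_smul, map_mul, signHom_gen, FunAlg.assign, mul_neg,
    neg_mul, neg_neg, inv_inv]
  match_scalars <;> ring

theorem swapHom_shiftedRho (τ σ : ℝ) : swapHom q (shiftedRho q τ σ) = shiftedRho q σ τ := by
  rw [shiftedRho_eq, shiftedRho_eq, map_smul, swapHom_quadElt]

theorem signHom_shiftedRho (τ σ : ℝ) :
    signHom q (shiftedRho q (-τ) (-σ)) = shiftedRho q τ σ := by
  rw [shiftedRho_eq, shiftedRho_eq, map_smul, qpow_neg, qpow_neg, signHom_quadElt]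

/-- Every monomial of the (n, m) coefficient has degree congruent to n + m mod 2 in β and γ
together. -/
theorem signHom_coactMat {L m : ℕ} (n : ℕ) (hm : m ≤ L) :
    signHom q (coactMat q L n m) = (-1 : ℂ) ^ (n + m) • coactMat q L n m := by
  induction L generalizing n m with
  | zero =>
    obtain rfl : m = 0 := by omega
    cases n with
    | zero => simp [coactMat_zero]
    | succ n => simp [coactMat_vanish (q := q) (le_refl 0) (Nat.succ_pos n)]
  | succ L ih =>
    rcases m with _ | m
    · have h := coactMat_succ_left (q := q) n (Nat.zero_le L)
      rw [pow_zero, one_smul] at h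
      rw [h]
      cases n with
      | zero => simp [coactStep_zero, ih, signHom_gen, FunAlg.assign]
      | succ n =>
        simp only [coactStep_succ, ih, signHom_gen, FunAlg.assign, map_add, map_smul, map_mul,
          Nat.zero_le, mul_smul_comm, neg_mul]
        match_scalars <;> ring
    · rw [coactMat_succ_right]
      cases n with
      | zero =>
        simp only [coactStep_zero, ih 0 (by omega : m ≤ L), signHom_gen, FunAlg.assign, map_mul,
          mul_smul_comm, neg_mul]
        match_scalars
        ring
      | succ n =>
        simp only [coactStep_succ, ih _ (by omega : m ≤ L), signHom_gen, FunAlg.assign, map_add,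
          map_smul, map_mul, mul_smul_comm, neg_mul]
        match_scalars <;> ring

/-- The coefficients of the coaction, weighted by Gaussian binomial coefficients. -/
noncomputable def binomCoact (q : QParam) (L n m : ℕ) : FunAlg q :=
  ((qBinom ((q : ℝ) ^ 2) L m : ℝ) : ℂ) • coactMat q L n m

theorem binomCoact_vanish {L n m : ℕ} (h : L < m) : binomCoact q L n m = 0 := by
  rw [binomCoact, qBinom_eq_zero (sq_pos_lt_one q).1 h]; simp

theorem coactStep_binomCoact (L n m : ℕ) :
    ((qBinom ((q : ℝ) ^ 2) L m : ℝ) : ℂ) • (qc q ^ m • coactMat q (L + 1) n m) =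
      coactStep q (.gen q .al) (.gen q .ga) (fun k => binomCoact q L k m) n := by
  by_cases hm : m ≤ L
  · rw [coactMat_succ_left n hm]
    exact congr($((coactStep_smul _ _ _ _).symm) n)
  -- For m > L the truncated difference `L - m` gives `coactMat` a meaningless value, which the
  -- vanishing binomial removes.
  · rw [qBinom_eq_zero (sq_pos_lt_one q).1 (by omega)]
    simp only [binomCoact_vanish (q := q) (show L < m by omega)]
    cases n <;> simp [coactStep_zero, coactStep_succ]

theorem binomCoact_succ_zero (L n : ℕ) : binomCoact q (L + 1) n 0 =
    coactStep q (.gen q .al) (.gen q .ga) (fun k => binomCoact q L k 0) n := by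
  rw [← coactStep_binomCoact, binomCoact, qBinom_zero_right, qBinom_zero_right]
  simp

/-- Pascal's rule merges the two unweighted recursions. Written out in both indices, the result is
invariant under n ↔ m together with β ↔ γ, which is what the transposition symmetry needs. -/
theorem binomCoact_succ_succ (L n m : ℕ) : binomCoact q (L + 1) n (m + 1) =
    coactStep q (.gen q .be) (.gen q .de) (fun k => binomCoact q L k m) n
    + qc q ^ (m + 1) •
      coactStep q (.gen q .al) (.gen q .ga) (fun k => binomCoact q L k (m + 1)) n := by
  obtain ⟨h0, h1⟩ := sq_pos_lt_one q
  have e : coactStep q (.gen q .be) (.gen q .de) (fun k => binomCoact q L k m) n =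
      ((qBinom ((q : ℝ) ^ 2) L m : ℝ) : ℂ) • coactMat q (L + 1) n (m + 1) := by
    rw [coactMat_succ_right]
    exact congr($(coactStep_smul _ _ _ _) n)
  rw [e, ← coactStep_binomCoact, binomCoact, qBinom_pascal h0 h1, smul_smul, smul_smul, ← add_smul]
  congr 1
  rw [qc]
  push_cast
  ring

/-- The weighted coefficients of the coaction are symmetric up to the automorphism which swaps `β`
and `γ`. -/
theorem binomCoact_swap (L n m : ℕ) :
    binomCoact q L n m = (-1 : ℂ) ^ (n + m) • swapHom q (binomCoact q L m n) := by
  induction L generalizing n m with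
  | zero =>
    rcases m with _ | m
    · rcases n with _ | n
      · simp [binomCoact, coactMat_zero, qBinom_zero_right]
      · rw [binomCoact_vanish (Nat.succ_pos n), binomCoact,
          coactMat_vanish le_rfl (Nat.succ_pos n)]
        simp
    · rcases n with _ | n
      · rw [binomCoact_vanish (Nat.succ_pos m), binomCoact,
          coactMat_vanish le_rfl (Nat.succ_pos m)]
        simp
      · rw [binomCoact_vanish (Nat.succ_pos m), binomCoact_vanish (Nat.succ_pos n)]
        simp
  | succ L ih =>
    rcases m with _ | m <;> rcases n with _ | n <;>
    simp only [binomCoact_succ_zero, binomCoact_succ_succ, coactStep_zero, coactStep_succ, map_add,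
      map_smul, map_mul, swapHom_gen, FunAlg.assign]
    · conv_lhs => rw [ih 0 0]
      simp
    · rw [ih (n + 1) 0, ih n 0]
      simp only [mul_smul_comm, neg_mul]
      match_scalars <;> ring
    · rw [ih 0 m, ih 0 (m + 1)]
      simp only [mul_smul_comm, neg_mul]
      match_scalars <;> ring
    · rw [ih (n + 1) m, ih n m, ih (n + 1) (m + 1), ih n (m + 1)]
      simp only [mul_smul_comm, neg_mul]
      match_scalars <;> ring

end Automorphisms

/-! ## The matrix elements represent the matrix coefficients of the spin representations -/

section MatrixElements

variable {q : QParam}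

theorem qpow_zpow (q : QParam) (x : ℝ) (n : ℤ) : qpow q x ^ n = qpow q (x * n) := by
  rw [qpow, qpow, ← Complex.ofReal_zpow, ← Real.rpow_intCast, ← Real.rpow_mul (q_pos q).le]

theorem qpow_natCast (q : QParam) (n : ℕ) : qpow q n = qc q ^ n := by
  simp [qpow, qc]

/-- The ratio `√([L, m] / [L, n])` of Gaussian binomial coefficients. -/
noncomputable def binomRatio (q : QParam) (L n m : ℕ) : ℝ :=
  √(qBinom ((q : ℝ) ^ 2) L m / qBinom ((q : ℝ) ^ 2) L n)

theorem matrixElement_eq (L : ℕ) (n m : Fin (L + 1)) :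
    matrixElement q L n m = ((binomRatio q L n m : ℝ) : ℂ) • coactMat q L n m := rfl

theorem qBinom_sq_pos (q : QParam) {L : ℕ} (k : Fin (L + 1)) : 0 < qBinom ((q : ℝ) ^ 2) L k :=
  qBinom_pos (sq_pos_lt_one q).1 (sq_pos_lt_one q).2 (Nat.lt_succ_iff.mp k.2)

theorem binomRatio_self {L : ℕ} (k : Fin (L + 1)) : binomRatio q L k k = 1 := by
  rw [binomRatio, div_self (qBinom_sq_pos q k).ne', Real.sqrt_one]

theorem binomRatio_mul {L : ℕ} (n k m : Fin (L + 1)) :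
    binomRatio q L n k * binomRatio q L k m = binomRatio q L n m := by
  have h1 := qBinom_sq_pos q n
  have h2 := qBinom_sq_pos q k
  have h3 := qBinom_sq_pos q m
  rw [binomRatio, binomRatio, binomRatio, ← Real.sqrt_mul (div_pos h2 h1).le]
  congr 1
  field_simp

theorem signHom_matrixElement {L : ℕ} (n m : Fin (L + 1)) :
    signHom q (matrixElement q L n m) = (-1 : ℂ) ^ ((n : ℕ) + m) • matrixElement q L n m := by
  rw [matrixElement_eq, map_smul, signHom_coactMat _ (Nat.lt_succ_iff.mp m.2), smul_comm]

theorem character_matrixElement (z : ℂˣ) {L : ℕ} (n m : Fin (L + 1)) :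
    character q z (matrixElement q L n m) =
      if n = m then (z : ℂ) ^ ((L : ℤ) - 2 * (m : ℕ)) else 0 := by
  rw [matrixElement_eq, map_smul, character_coactMat z _ (Nat.lt_succ_iff.mp m.2)]
  by_cases h : n = m
  · subst h
    simp [binomRatio_self]
  · simp [h, Fin.val_inj]

/-- The square root ratios form a multiplicative cocycle, so the normalisation is a conjugation by a
diagonal matrix. -/
theorem comulHom_matrixElement {L : ℕ} (n m : Fin (L + 1)) :
    FunAlg.comulHom q (matrixElement q L n m) =
      ∑ k, matrixElement q L n k ⊗ₜ[ℂ] matrixElement q L k m := by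
  rw [matrixElement_eq, map_smul, comulHom_coactMat _ (Nat.lt_succ_iff.mp m.2),
    Finset.sum_range (n := L + 1), Finset.smul_sum]
  refine Finset.sum_congr rfl fun k _ => ?_
  rw [matrixElement_eq, matrixElement_eq, TensorProduct.smul_tmul_smul, ← Complex.ofReal_mul,
    binomRatio_mul]

theorem counitHom_eq : FunAlg.counitHom q = character q 1 :=
  FunAlg.algHom_ext fun g => by
    cases g <;> simp [FunAlg.counitHom, character, FunAlg.lift_gen, FunAlg.assign]

/-- The matrix of values of a functional at the matrix elements. -/
noncomputable def valueMatrix (q : QParam) (L : ℕ) :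
    Functional q →ₐ[ℂ] Matrix (Fin (L + 1)) (Fin (L + 1)) ℂ :=
  AlgHom.ofLinearMap
    { toFun := fun f => Matrix.of fun n m => f (matrixElement q L n m)
      map_add' := fun f g => rfl
      map_smul' := fun z f => rfl }
    (by
      ext n m
      change (1 : Functional q) (matrixElement q L n m) = _
      rw [one_conv_apply, counitHom_eq, character_matrixElement, Matrix.one_apply, Units.val_one,
        one_zpow])
    (by
      intro f g
      ext n m
      have hc : Coalgebra.comul (R := ℂ) (matrixElement q L n m)
          = FunAlg.comulHom q (matrixElement q L n m) := rfl
      change (f * g) (matrixElement q L n m) = _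
      simp only [Matrix.mul_apply, LinearMap.convMul_apply, hc, comulHom_matrixElement, map_sum, TensorProduct.map_tmul,
        LinearMap.mul'_apply]
      rfl)

theorem valueMatrix_apply (L : ℕ) (f : Functional q) (n m : Fin (L + 1)) :
    valueMatrix q L f n m = f (matrixElement q L n m) := rfl

theorem EnvAlg.algHom_ext {R : Type*} [Ring R] [Algebra ℂ R] {f g : EnvAlg q →ₐ[ℂ] R}
    (h : ∀ x, f (gen q x) = g (gen q x)) : f = g := by
  refine RingQuot.ringQuot_ext' ℂ f g ?_
  ext x
  exact h x

theorem pairA_coactMat {L m : ℕ} (n : ℕ) (hm : m ≤ L) :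
    pairA q (coactMat q L n m) = if n = m then qpow q ((L : ℝ) / 2 - m) else 0 := by
  rw [pairA, character_coactMat _ _ hm, Units.val_mk0, qpow_zpow]
  congr 2
  push_cast
  ring

theorem pairD_coactMat {L m : ℕ} (n : ℕ) (hm : m ≤ L) :
    pairD q (coactMat q L n m) = if n = m then qpow q (m - (L : ℝ) / 2) else 0 := by
  rw [pairD, character_coactMat _ _ hm, Units.val_inv_eq_inv_val, Units.val_mk0, inv_zpow',
    qpow_zpow]
  congr 2
  push_cast
  ring

theorem one_sub_qc_sq_ne_zero (q : QParam) : 1 - qc q ^ 2 ≠ 0 := by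
  have := (sq_pos_lt_one q).2
  unfold qc
  exact_mod_cast (sub_pos.mpr this).ne'

/-- The twisted Leibniz rule adds one term q^{2m} at each (β, δ) step, so the value is a q-power
times 1 + q² + ⋯ + q^{2(m-1)}. -/
theorem pairB_coactMat {L m : ℕ} (n : ℕ) (hm : m ≤ L) : pairB q (coactMat q L n m) =
    if n + 1 = m then qpow q ((1 - L) / 2) * (1 - qc q ^ (2 * m)) / (1 - qc q ^ 2) else 0 := by
  have h2 := one_sub_qc_sq_ne_zero q
  have hw : ∀ L : ℕ, (qpow q (1 / 2))⁻¹ * qpow q ((1 - L) / 2) = qpow q (-(L / 2)) := by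
    intro L
    rw [← neg_half_eq, ← qpow_add]
    congr 1
    ring
  induction L generalizing n m with
  | zero =>
    obtain rfl : m = 0 := by omega
    cases n with
    | zero => simp [coactMat_zero, pairB]
    | succ n => simp [coactMat_vanish (q := q) (le_refl 0) (Nat.succ_pos n)]
  | succ L ih =>
    rcases m with _ | m
    · have h := coactMat_succ_left (q := q) n (Nat.zero_le L)
      rw [pow_zero, one_smul] at h
      rw [h]
      cases n with
      | zero => simp [coactStep_zero, pairB_mul, pairB_gen, pairA_gen, FunAlg.assign, ih]
      | succ n => simp [coactStep_succ, pairB_mul, pairB_gen, pairA_gen, FunAlg.assign, ih]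
    · have hm' : m ≤ L := by omega
      have hD : ∀ m : ℕ, qc q ^ m * qpow q (m - (L : ℝ) / 2) = qc q ^ (2 * m) * qpow q (-(L / 2)) := by
        intro m
        rw [sub_eq_add_neg, qpow_add, qpow_natCast, ← mul_assoc, ← pow_add, two_mul]
      rw [coactMat_succ_right]
      cases n with
      | zero =>
        simp only [coactStep_zero, pairB_mul, pairB_gen, pairA_gen, FunAlg.assign,
          pairD_coactMat _ hm', zero_mul, zero_add, one_mul]
        by_cases h : 0 = m
        · subst h
          have := hD 0
          simp only [if_true]
          field_simp
          simp [sub_eq_add_neg]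
        · simp [h, Ne.symm h]
      | succ n =>
        simp only [coactStep_succ, pairB_mul, pairB_gen, pairA_gen, FunAlg.assign,
          pairD_coactMat _ hm', zero_mul, zero_add, one_mul, map_add, map_smul, smul_eq_mul,
          ih _ hm', add_left_inj, add_zero]
        by_cases h : n + 1 = m
        · subst h
          have hL := hw L
          simp only [if_true]
          rw [hD, mul_div_assoc, ← mul_assoc (qpow q (1 / 2))⁻¹, hL]
          have e : (1 - ((L + 1 : ℕ) : ℝ)) / 2 = -(L / 2) := by push_cast; ring
          rw [e]
          field_simp
          ring
        · simp [h]

theorem pairC_coactMat {L m : ℕ} (n : ℕ) (hm : m ≤ L) : pairC q (coactMat q L n m) =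
    if n = m + 1 then qpow q ((1 - L) / 2) * (1 - qc q ^ (2 * (L - m))) / (1 - qc q ^ 2)
      else 0 := by
  have h2 := one_sub_qc_sq_ne_zero q
  have hw : ∀ L : ℕ, (qpow q (1 / 2))⁻¹ * qpow q ((1 - L) / 2) = qpow q (-(L / 2)) := by
    intro L
    rw [← neg_half_eq, ← qpow_add]
    congr 1
    ring
  have e : ∀ L : ℕ, (1 - ((L + 1 : ℕ) : ℝ)) / 2 = -(L / 2) := by intro L; push_cast; ring
  induction L generalizing n m with
  | zero =>
    obtain rfl : m = 0 := by omega
    cases n with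
    | zero => simp [coactMat_zero, pairC]
    | succ n => simp [coactMat_vanish (q := q) (le_refl 0) (Nat.succ_pos n)]
  | succ L ih =>
    rcases m with _ | m
    · have h := coactMat_succ_left (q := q) n (Nat.zero_le L)
      rw [pow_zero, one_smul] at h
      rw [h]
      cases n with
      | zero => simp [coactStep_zero, pairC_mul, pairC_gen, pairA_gen, FunAlg.assign, ih]
      | succ n =>
        simp only [coactStep_succ, pairC_mul, pairC_gen, pairA_gen, FunAlg.assign,
          pairD_coactMat _ (Nat.zero_le L), ih _ (Nat.zero_le L), zero_mul, zero_add, one_mul,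
          map_add, map_smul, smul_eq_mul, add_zero, Nat.sub_zero]
        by_cases h : n = 0
        · subst h
          have hv : qpow q (1 / 2) * qpow q ((1 - L) / 2) = qc q * qpow q (-(L / 2)) := by
            rw [← hw, ← half_mul_half]
            have := qpow_ne_zero q (1 / 2)
            field_simp
          simp only [if_true, e, Nat.cast_zero, zero_sub]
          rw [mul_div_assoc, ← mul_assoc (qpow q (1 / 2)), hv]
          field_simp
          ring
        · simp [h]
    · have hm' : m ≤ L := by omega
      rw [coactMat_succ_right]
      cases n with
      | zero => simp [coactStep_zero, pairC_mul, pairC_gen, pairA_gen, FunAlg.assign]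
      | succ n =>
        simp only [coactStep_succ, pairC_mul, pairC_gen, pairA_gen, FunAlg.assign,
          pairD_coactMat _ hm', zero_mul, zero_add, map_add, map_smul, smul_eq_mul,
          ih _ hm', add_left_inj, add_zero, mul_zero, Nat.add_sub_add_right]
        by_cases h : n = m + 1
        · subst h
          simp only [if_true, e]
          rw [mul_div_assoc, ← mul_assoc (qpow q (1 / 2))⁻¹, hw, mul_div_assoc]
        · simp [h]

/-- A power of q is taken out of each difference under the root; their product is q^{-1-L},
independent of k, and leaves the root as a square. -/
theorem ladder_eq {L k : ℕ} (hk : k ≤ L) : ladder q (L / 2) (k - L / 2) =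
    (q : ℝ) ^ ((1 - L : ℝ) / 2) * √((1 - ((q : ℝ) ^ 2) ^ (k + 1)) * (1 - ((q : ℝ) ^ 2) ^ (L - k)))
      / (1 - (q : ℝ) ^ 2) := by
  have h0 := q_pos q
  obtain ⟨hp0, hp1⟩ := sq_pos_lt_one q
  have hne : 1 - (q : ℝ) ^ 2 ≠ 0 := (sub_pos.mpr hp1).ne'
  have e1 : (q : ℝ) ^ (-((L : ℝ) / 2) + (k - L / 2)) - (q : ℝ) ^ ((L : ℝ) / 2 - (k - L / 2))
      = (q : ℝ) ^ ((k : ℝ) - L) * (1 - ((q : ℝ) ^ 2) ^ (L - k)) := by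
    rw [mul_sub, mul_one, ← pow_mul, ← Real.rpow_natCast (q : ℝ) (2 * (L - k)), ← Real.rpow_add h0]
    push_cast [Nat.cast_sub hk]
    congr 2 <;> ring
  have e2 : (q : ℝ) ^ (-((L : ℝ) / 2) - (k - L / 2) - 1) - (q : ℝ) ^ ((L : ℝ) / 2 + (k - L / 2) + 1)
      = (q : ℝ) ^ (-(k : ℝ) - 1) * (1 - ((q : ℝ) ^ 2) ^ (k + 1)) := by
    rw [mul_sub, mul_one, ← pow_mul, ← Real.rpow_natCast (q : ℝ) (2 * (k + 1)), ← Real.rpow_add h0]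
    push_cast
    congr 2 <;> ring
  have e3 : (q : ℝ) ^ ((k : ℝ) - L) * (q : ℝ) ^ (-(k : ℝ) - 1) = ((q : ℝ) ^ ((-1 - L : ℝ) / 2)) ^ 2 := by
    rw [← Real.rpow_natCast, ← Real.rpow_mul h0.le, ← Real.rpow_add h0]
    congr 1
    push_cast
    ring
  have e4 : (q : ℝ) ^ ((1 - L : ℝ) / 2) = (q : ℝ) ^ ((-1 - L : ℝ) / 2) * q := by
    conv_rhs => rw [← Real.rpow_one (q : ℝ), ← Real.rpow_mul h0.le, one_mul, ← Real.rpow_add h0]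
    congr 1
    ring
  rw [ladder, e1, e2]
  rw [show (q : ℝ) ^ ((k : ℝ) - L) * (1 - ((q : ℝ) ^ 2) ^ (L - k)) *
      ((q : ℝ) ^ (-(k : ℝ) - 1) * (1 - ((q : ℝ) ^ 2) ^ (k + 1))) =
      ((q : ℝ) ^ ((k : ℝ) - L) * (q : ℝ) ^ (-(k : ℝ) - 1)) *
        ((1 - ((q : ℝ) ^ 2) ^ (k + 1)) * (1 - ((q : ℝ) ^ 2) ^ (L - k))) by ring, e3,
    Real.sqrt_mul (sq_nonneg _), Real.sqrt_sq (Real.rpow_pos_of_pos h0 _).le, e4]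
  have : (q : ℝ)⁻¹ - q = (1 - (q : ℝ) ^ 2) / q := by field_simp
  rw [this]
  field_simp

/-- From [L, k+1](1 - p^{k+1}) = [L, k](1 - p^{L-k}), the orthonormal rescaling turns the asymmetric
coefficients of B and C on monomials into one common square root. -/
theorem binomRatio_succ {L k : ℕ} (hk : k < L) :
    binomRatio q L k (k + 1) * (1 - ((q : ℝ) ^ 2) ^ (k + 1)) =
        √((1 - ((q : ℝ) ^ 2) ^ (k + 1)) * (1 - ((q : ℝ) ^ 2) ^ (L - k))) ∧
      binomRatio q L (k + 1) k * (1 - ((q : ℝ) ^ 2) ^ (L - k)) =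
        √((1 - ((q : ℝ) ^ 2) ^ (k + 1)) * (1 - ((q : ℝ) ^ 2) ^ (L - k))) := by
  obtain ⟨hp0, hp1⟩ := sq_pos_lt_one q
  obtain ⟨d, rfl⟩ : ∃ d, L = k + d + 1 := ⟨L - k - 1, by omega⟩
  have ha : 0 < 1 - ((q : ℝ) ^ 2) ^ (k + 1) := one_sub_pow_succ_pos hp0 hp1 k
  have hb : 0 < 1 - ((q : ℝ) ^ 2) ^ (d + 1) := one_sub_pow_succ_pos hp0 hp1 d
  have hc := one_sub_pow_succ_pos hp0 hp1 (k + d)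
  have h1 := qBinom_pos hp0 hp1 (show k ≤ k + d + 1 by omega)
  have h2 := qBinom_pos hp0 hp1 (show k + 1 ≤ k + d + 1 by omega)
  have e : ((q : ℝ) ^ 2) ^ (k + d + 1) * ((q : ℝ) ^ 2)⁻¹ ^ k = ((q : ℝ) ^ 2) ^ (d + 1) := by
    rw [show k + d + 1 = d + 1 + k by ring, pow_add _ (d + 1), mul_assoc, ← mul_pow,
      mul_inv_cancel₀ hp0.ne', one_pow, mul_one]
  have h3 := qBinom_succ_mul hp0 (k + d) k
  rw [e, ← qBinom_succ_succ_mul hp0 hp1] at h3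
  rw [show k + d + 1 - k = d + 1 by omega]
  rw [binomRatio, binomRatio]
  have key : ∀ x y a b : ℝ, 0 < x → 0 < y → 0 < a → 0 < b → b * x = a * y →
      √(y / x) * a = √(a * b) := by
    intro x y a b hx hy ha hb h
    have : y / x = b / a := by rw [div_eq_div_iff hx.ne' ha.ne']; linarith
    rw [this, ← Real.sqrt_sq ha.le, ← Real.sqrt_mul (by positivity), Real.sqrt_sq ha.le]
    congr 1
    field_simp
  exact ⟨key _ _ _ _ h1 h2 ha hb h3, (key _ _ _ _ h2 h1 hb ha h3.symm).trans
    (by rw [mul_comm])⟩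

/-- The matrix elements represent the matrix coefficients of the spin representations. -/
theorem pairing_matrixElement (L : ℕ) (X : EnvAlg q) (n m : Fin (L + 1)) :
    pairing q X (matrixElement q L n m) = spinRep q L X n m := by
  -- Both sides are algebra homomorphisms out of the enveloping algebra, so only the four generators
  -- have to be compared.
  have h : (valueMatrix q L).comp (pairingHom q) = spinRep q L := by
    refine EnvAlg.algHom_ext fun g => ?_
    ext n m
    have hn := Nat.lt_succ_iff.mp n.2
    have hm := Nat.lt_succ_iff.mp m.2
    rw [AlgHom.comp_apply, valueMatrix_apply, pairingHom, EnvAlg.lift_gen, spinRep,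
      EnvAlg.lift_gen]
    cases g
    · change pairA q (matrixElement q L n m) = spinA q L n m
      rw [matrixElement_eq, map_smul, pairA_coactMat _ hm, spinA, Matrix.diagonal_apply]
      by_cases h : n = m
      · subst h
        simp [binomRatio_self, weight]
      · simp [h, Fin.val_inj]
    · change pairB q (matrixElement q L n m) = spinB q L n m
      rw [matrixElement_eq, map_smul, pairB_coactMat _ hm, spinB, Matrix.of_apply]
      by_cases h : (n : ℕ) + 1 = m
      · rw [if_pos h, if_pos h, weight, ← h,
          show (((n : ℕ) + 1 : ℕ) : ℝ) - (L : ℝ) / 2 - 1 = (n : ℝ) - L / 2 by push_cast; ring,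
          ladder_eq hn, ← (binomRatio_succ (show (n : ℕ) < L by omega)).1]
        simp only [qpow, qc, smul_eq_mul]
        push_cast
        rw [← pow_mul]
        ring
      · rw [if_neg h, if_neg h, smul_zero]
    · change pairC q (matrixElement q L n m) = spinC q L n m
      rw [matrixElement_eq, map_smul, pairC_coactMat _ hm, spinC, Matrix.of_apply]
      by_cases h : (n : ℕ) = m + 1
      · rw [if_pos h, if_pos h, weight, h, ladder_eq hm,
          ← (binomRatio_succ (show (m : ℕ) < L by omega)).2]
        simp only [qpow, qc, smul_eq_mul]
        push_cast
        rw [← pow_mul]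
        ring
      · rw [if_neg h, if_neg h, smul_zero]
    · change pairD q (matrixElement q L n m) = spinD q L n m
      rw [matrixElement_eq, map_smul, pairD_coactMat _ hm, spinD, Matrix.diagonal_apply]
      by_cases h : n = m
      · subst h
        simp [binomRatio_self, weight]
      · simp [h, Fin.val_inj]
  exact congr($h X n m)

theorem pairing_genElement (L : ℕ) (I J : ℤ) (τ σ : ℝ) (X : EnvAlg q) :
    pairing q X (genElement q L I J τ σ) = genFunctional q L I J τ σ X := by
  simp only [genElement, genFunctional, map_sum, map_smul, pairing_matrixElement, smul_eq_mul,
    EuclideanSpace.inner_eq_star_dotProduct, dotProduct, Matrix.mulVec, Finset.sum_mul]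
  refine Finset.sum_congr rfl fun n _ => Finset.sum_congr rfl fun m _ => ?_
  simp
  ring

end MatrixElements

/-! ## Recurrence relations for dual `q`-Krawtchouk polynomials -/

section Krawtchouk

variable {K : Type*} [Field K]

/-- The terminating series `₃φ₂ (p^{-r}, u, v; p^{-N}, 0; p, p)`. -/
def kraw (p u v : K) (N r : ℕ) : K :=
  ∑ k ∈ Finset.range (r + 1), qPoch (p⁻¹ ^ r) p k * (qPoch u p k * qPoch v p k
    / (qPoch (p⁻¹ ^ N) p k * qPoch p p k)) * p ^ k

theorem kraw_comm (p u v : K) (N r : ℕ) : kraw p u v N r = kraw p v u N r := by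
  simp only [kraw, mul_comm (qPoch u p _)]

theorem kraw_zero (p u v : K) (N : ℕ) : kraw p u v N 0 = 1 := by
  simp [kraw, qPoch_zero_right]

theorem kraw_one_left (p v : K) (N r : ℕ) : kraw p 1 v N r = 1 := by
  rw [kraw, Finset.sum_range_succ', Finset.sum_eq_zero]
  · simp [qPoch_zero_right]
  · intro k _
    have h : qPoch (1 : K) p (k + 1) = 0 := by rw [qPoch_succ_left, sub_self, zero_mul]
    simp [h]

variable {p : K}

theorem qPoch_inv_pow_eq_zero (hp : p ≠ 0) {r k : ℕ} (h : r < k) : qPoch (p⁻¹ ^ r) p k = 0 := by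
  refine Finset.prod_eq_zero (Finset.mem_range.mpr h) ?_
  rw [← mul_pow, inv_mul_cancel₀ hp, one_pow, sub_self]

theorem one_sub_inv_pow_mul_pow_ne_zero (hp : p ≠ 0) (h1 : ∀ k, p ^ (k + 1) ≠ 1) {N k : ℕ}
    (h : k < N) : 1 - p⁻¹ ^ N * p ^ k ≠ 0 := by
  intro e
  obtain ⟨d, rfl⟩ : ∃ d, N = k + (d + 1) := ⟨N - k - 1, by omega⟩
  apply h1 d
  rw [inv_pow, sub_eq_zero, eq_comm, inv_mul_eq_one₀ (pow_ne_zero _ hp), pow_add] at e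
  exact mul_left_cancel₀ (pow_ne_zero k hp) (by rw [e, mul_one])

theorem one_sub_inv_pow_succ_ne_zero (hp : p ≠ 0) (h1 : ∀ k, p ^ (k + 1) ≠ 1) (N : ℕ) :
    1 - p⁻¹ ^ (N + 1) ≠ 0 := by
  simpa using one_sub_inv_pow_mul_pow_ne_zero hp h1 (Nat.succ_pos N)

theorem qPoch_inv_pow_ne_zero (hp : p ≠ 0) (h1 : ∀ k, p ^ (k + 1) ≠ 1) {N k : ℕ} (h : k ≤ N) :
    qPoch (p⁻¹ ^ N) p k ≠ 0 :=
  Finset.prod_ne_zero_iff.mpr fun i hi =>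
    one_sub_inv_pow_mul_pow_ne_zero hp h1 (by have := Finset.mem_range.mp hi; omega)

theorem qPoch_self_ne_zero (h1 : ∀ k, p ^ (k + 1) ≠ 1) (k : ℕ) : qPoch p p k ≠ 0 :=
  Finset.prod_ne_zero_iff.mpr fun i _ => by
    rw [← pow_succ', sub_ne_zero]
    exact (h1 i).symm

theorem one_sub_mul_qPoch (a b : K) (k : ℕ) :
    (1 - a) * qPoch (b * a) b k = qPoch a b k * (1 - a * b ^ k) := by
  rw [← qPoch_succ, qPoch_succ_left, mul_comm a]

/-- The connection coefficient in the recurrence relations which lower the order. -/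
def krawConn (p u v : K) (N : ℕ) : K :=
  (1 - v) * (u - p⁻¹ ^ N) / ((1 - p⁻¹ ^ N) * (u - v))

/-- Shifting v to pv and lowering the order multiplies the k-th term by a rational function of p^k.
The recurrences below then become identities between such functions. -/
theorem krawConn_mul_term {u v : K} {N k : ℕ} (hp : p ≠ 0) (h1 : ∀ k, p ^ (k + 1) ≠ 1)
    (huv : u ≠ v) (hk : k ≤ N) :
    krawConn p u v (N + 1) * (qPoch u p k * qPoch (p * v) p k
        / (qPoch (p⁻¹ ^ N) p k * qPoch p p k)) =
      qPoch u p k * qPoch v p k / (qPoch (p⁻¹ ^ (N + 1)) p k * qPoch p p k)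
        * ((u - p⁻¹ ^ (N + 1)) * (1 - v * p ^ k) / ((u - v) * (1 - p⁻¹ ^ (N + 1) * p ^ k))) := by
  have h2 := one_sub_inv_pow_succ_ne_zero hp h1 N
  have h3 := sub_ne_zero.mpr huv
  have h4 := one_sub_inv_pow_mul_pow_ne_zero hp h1 (Nat.lt_succ_of_le hk)
  have h5 := qPoch_inv_pow_ne_zero hp h1 (hk.trans N.le_succ)
  have h6 := qPoch_inv_pow_ne_zero hp h1 hk
  have h7 := qPoch_self_ne_zero h1 k
  have e1 := one_sub_mul_qPoch v p k
  have e2 := one_sub_mul_qPoch (p⁻¹ ^ (N + 1)) p k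
  have e3 : p * p⁻¹ ^ (N + 1) = p⁻¹ ^ N := by rw [pow_succ']; field_simp
  rw [e3] at e2
  rw [krawConn]
  rw [div_mul_div_comm, div_mul_div_comm, div_eq_div_iff
    (mul_ne_zero (mul_ne_zero h2 h3) (mul_ne_zero h6 h7))
    (mul_ne_zero (mul_ne_zero h5 h7) (mul_ne_zero h3 h4))]
  generalize p⁻¹ ^ (N + 1) = g at *
  generalize p⁻¹ ^ N = g' at *
  linear_combination ((u - g) * qPoch u p k * qPoch g p k * qPoch p p k * (u - v)
    * (1 - g * p ^ k)) * e1 - (qPoch u p k * qPoch v p k * (u - g) * (1 - v * p ^ k) * (u - v)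
    * qPoch p p k) * e2

/-- The identity holds term by term: with g = p^{-(N+1)} and P = p^k, it reduces to (u - g)(1 - vP)
- (v - g)(1 - uP) = (u - v)(1 - gP). -/
theorem kraw_lower_order {u v : K} {N r : ℕ} (hp : p ≠ 0) (h1 : ∀ k, p ^ (k + 1) ≠ 1)
    (huv : u ≠ v) (hr : r ≤ N) :
    kraw p u v (N + 1) r = krawConn p u v (N + 1) * kraw p u (p * v) N r
      + krawConn p v u (N + 1) * kraw p (p * u) v N r := by
  rw [kraw_comm p (p * u)]
  simp only [kraw, Finset.mul_sum, ← Finset.sum_add_distrib]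
  refine Finset.sum_congr rfl fun k hk => ?_
  have hk' : k ≤ N := by have := Finset.mem_range.mp hk; omega
  have h3 := sub_ne_zero.mpr huv
  have h4 : 1 - p⁻¹ ^ (N + 1) * p ^ k ≠ 0 :=
    one_sub_inv_pow_mul_pow_ne_zero hp h1 (Nat.lt_succ_of_le hk')
  have e1 := krawConn_mul_term hp h1 huv hk'
  have e2 := krawConn_mul_term hp h1 huv.symm hk'
  rw [mul_comm (qPoch v p k)] at e2
  have e3 : (u - p⁻¹ ^ (N + 1)) * (1 - v * p ^ k) / ((u - v) * (1 - p⁻¹ ^ (N + 1) * p ^ k))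
      + (v - p⁻¹ ^ (N + 1)) * (1 - u * p ^ k) / ((v - u) * (1 - p⁻¹ ^ (N + 1) * p ^ k)) = 1 := by
    rw [show v - u = -(u - v) by ring]
    generalize p⁻¹ ^ (N + 1) = g at *
    field_simp
    ring
  rw [mul_comm (qPoch v p k) (qPoch u p k)] at e2
  linear_combination (-(qPoch (p⁻¹ ^ r) p k * p ^ k)) * (e1 + e2)
    - (qPoch (p⁻¹ ^ r) p k * p ^ k * (qPoch u p k * qPoch v p k /
      (qPoch (p⁻¹ ^ (N + 1)) p k * qPoch p p k))) * e3

/-- Here the degree changes too, so the comparison is term by term only after a summation by parts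
that rewrites the series in the factors (p^{-r}; p)_k. -/
theorem kraw_lower_order_degree {u v : K} {N r : ℕ} (hp : p ≠ 0) (h1 : ∀ k, p ^ (k + 1) ≠ 1)
    (huv : u ≠ v) (hr : r ≤ N) :
    kraw p u v (N + 1) (r + 1) = u * krawConn p u v (N + 1) * kraw p u (p * v) N r
      + v * krawConn p v u (N + 1) * kraw p (p * u) v N r := by
  set t : ℕ → K := fun k => qPoch u p k * qPoch v p k /
      (qPoch (p⁻¹ ^ (N + 1)) p k * qPoch p p k) with ht
  -- The telescoping identity behind the summation by parts.
  have hφ : ∀ k, qPoch (p⁻¹ ^ (r + 1)) p (k + 1) * p ^ (k + 1) =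
      qPoch (p⁻¹ ^ r) p (k + 1) - (1 - p ^ (k + 1)) * qPoch (p⁻¹ ^ r) p k := by
    intro k
    have e : p⁻¹ ^ (r + 1) * p = p⁻¹ ^ r := by rw [pow_succ]; field_simp
    rw [qPoch_succ_left, e, qPoch_succ]
    rw [pow_succ, pow_succ]
    field_simp
    ring
  have hs : kraw p u v (N + 1) (r + 1) =
      ∑ k ∈ Finset.range (r + 1), qPoch (p⁻¹ ^ r) p k * (t k - (1 - p ^ (k + 1)) * t (k + 1)) := by
    rw [kraw, Finset.sum_range_succ']
    have e1 : ∀ k, qPoch (p⁻¹ ^ (r + 1)) p (k + 1) * t (k + 1) * p ^ (k + 1) =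
        qPoch (p⁻¹ ^ r) p (k + 1) * t (k + 1)
          - (1 - p ^ (k + 1)) * qPoch (p⁻¹ ^ r) p k * t (k + 1) := by
      intro k
      linear_combination t (k + 1) * hφ k
    rw [Finset.sum_congr rfl fun k _ => e1 k, Finset.sum_sub_distrib, sub_add_eq_add_sub]
    have e2 : qPoch (p⁻¹ ^ (r + 1)) p 0 * t 0 * p ^ 0 = qPoch (p⁻¹ ^ r) p 0 * t 0 := by
      simp [qPoch_zero_right]
    rw [e2, ← Finset.sum_range_succ' (fun k => qPoch (p⁻¹ ^ r) p k * t k), Finset.sum_range_succ,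
      qPoch_inv_pow_eq_zero hp (Nat.lt_succ_self r), zero_mul, add_zero, ← Finset.sum_sub_distrib]
    refine Finset.sum_congr rfl fun k _ => ?_
    ring
  rw [hs, kraw_comm p (p * u)]
  simp only [kraw, Finset.mul_sum, ← Finset.sum_add_distrib]
  refine Finset.sum_congr rfl fun k hk => ?_
  have hk' : k ≤ N := by have := Finset.mem_range.mp hk; omega
  have h3 := sub_ne_zero.mpr huv
  have h4 : 1 - p⁻¹ ^ (N + 1) * p ^ k ≠ 0 :=
    one_sub_inv_pow_mul_pow_ne_zero hp h1 (Nat.lt_succ_of_le hk')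
  have h5 := qPoch_inv_pow_ne_zero hp h1 (hk'.trans N.le_succ)
  have h7 := qPoch_self_ne_zero h1 k
  have h8 : 1 - p ^ (k + 1) ≠ 0 := sub_ne_zero.mpr (h1 k).symm
  have e1 := krawConn_mul_term hp h1 huv hk'
  have e2 := krawConn_mul_term hp h1 huv.symm hk'
  rw [mul_comm (qPoch v p k) (qPoch u p k)] at e2
  have e3 : (1 - p ^ (k + 1)) * t (k + 1) = t k *
      ((1 - u * p ^ k) * (1 - v * p ^ k) / (1 - p⁻¹ ^ (N + 1) * p ^ k)) := by
    simp only [ht, qPoch_succ]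
    rw [← pow_succ' p k]
    field_simp
  have e4 : u * ((u - p⁻¹ ^ (N + 1)) * (1 - v * p ^ k) / ((u - v) * (1 - p⁻¹ ^ (N + 1) * p ^ k)))
      * p ^ k + v * ((v - p⁻¹ ^ (N + 1)) * (1 - u * p ^ k) /
        ((v - u) * (1 - p⁻¹ ^ (N + 1) * p ^ k))) * p ^ k
      = 1 - (1 - u * p ^ k) * (1 - v * p ^ k) / (1 - p⁻¹ ^ (N + 1) * p ^ k) := by
    rw [show v - u = -(u - v) by ring]
    generalize p⁻¹ ^ (N + 1) = g at *
    field_simp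
    ring
  linear_combination (-(qPoch (p⁻¹ ^ r) p k)) * e3 - (u * qPoch (p⁻¹ ^ r) p k * p ^ k) * e1
    - (v * qPoch (p⁻¹ ^ r) p k * p ^ k) * e2 - (qPoch (p⁻¹ ^ r) p k * t k) * e4

/-- Both sides are expanded in (p^{-(r+1)}; p)_k and coefficients are compared. The comparison holds
for arbitrary u and v except at the top coefficient, which occurs for r = N; `huv` makes it hold
there as well, and it is satisfied at the nodes. -/
theorem kraw_raise_order {u v : K} {N r : ℕ} (hp : p ≠ 0) (h1 : ∀ k, p ^ (k + 1) ≠ 1)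
    (hr : r ≤ N)
    (huv : qPoch u p (N + 1) * qPoch (p * v) p N * (p⁻¹ ^ (N + 1) - v) = 0) :
    (1 - p ^ (N + 1)) * kraw p u v (N + 1) (r + 1) =
      (1 - p ^ (N + 1) * p⁻¹ ^ (r + 1)) * kraw p u (p * v) N (r + 1)
        + u * p ^ (N + 1) * (p⁻¹ ^ (r + 1) - 1) * kraw p u (p * v) N r := by
  set φ : ℕ → K := fun k => qPoch (p⁻¹ ^ (r + 1)) p k with hφ
  set m : ℕ → K := fun k => qPoch u p k * qPoch v p k /
      (qPoch (p⁻¹ ^ (N + 1)) p k * qPoch p p k) * p ^ k with hm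
  set m' : ℕ → K := fun k => qPoch u p k * qPoch (p * v) p k /
      (qPoch (p⁻¹ ^ N) p k * qPoch p p k) * p ^ k with hm'
  have hm0 : m 0 = 1 := by simp [hm, qPoch_zero_right]
  have hm0' : m' 0 = 1 := by simp [hm', qPoch_zero_right]
  have hK : kraw p u v (N + 1) (r + 1) =
      ∑ j ∈ Finset.range (r + 1), φ (j + 1) * m (j + 1) + φ 0 := by
    rw [kraw, Finset.sum_range_succ']
    simp only [mul_assoc, hφ, hm]
    simp [qPoch_zero_right]
  -- The prefactor is absorbed by (1 - p^{N-r}) φ_k = p^{N+1-k} φ_{k+1} + (1 - p^{N+1-k}) φ_k.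
  have hK1 : (1 - p ^ (N + 1) * p⁻¹ ^ (r + 1)) * kraw p u (p * v) N (r + 1) =
      ∑ j ∈ Finset.range (r + 1), φ (j + 1) * (m' j * (p ^ (N + 1) * p⁻¹ ^ j)
        + m' (j + 1) * (1 - p ^ (N + 1) * p⁻¹ ^ (j + 1))) + (1 - p ^ (N + 1)) * φ 0 := by
    have e : ∀ k, (1 - p ^ (N + 1) * p⁻¹ ^ (r + 1)) * (φ k * m' k) =
        φ (k + 1) * (m' k * (p ^ (N + 1) * p⁻¹ ^ k))
          + φ k * (m' k * (1 - p ^ (N + 1) * p⁻¹ ^ k)) := by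
      intro k
      have e0 : p⁻¹ ^ k * p ^ k = 1 := by rw [← mul_pow, inv_mul_cancel₀ hp, one_pow]
      have e1 : φ (k + 1) = φ k * (1 - p⁻¹ ^ (r + 1) * p ^ k) := qPoch_succ _ _ _
      linear_combination (-(m' k * (p ^ (N + 1) * p⁻¹ ^ k))) * e1
        + (φ k * m' k * p ^ (N + 1) * p⁻¹ ^ (r + 1)) * e0
    rw [kraw]
    simp only [mul_assoc _ (_ / _), Finset.mul_sum]
    rw [Finset.sum_congr rfl fun k _ => e k, Finset.sum_add_distrib, Finset.sum_range_succ,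
      show φ (r + 1 + 1) = 0 from qPoch_inv_pow_eq_zero hp (Nat.lt_succ_self _), zero_mul, add_zero,
      Finset.sum_range_succ' (fun k => φ k * (m' k * (1 - p ^ (N + 1) * p⁻¹ ^ k))), ← add_assoc,
      ← Finset.sum_add_distrib]
    simp only [mul_add, hm0']
    ring
  have hK2 : (p⁻¹ ^ (r + 1) - 1) * kraw p u (p * v) N r =
      ∑ j ∈ Finset.range (r + 1), φ (j + 1) * (-m' j) := by
    have e : p⁻¹ ^ (r + 1) * p = p⁻¹ ^ r := by rw [pow_succ]; field_simp
    rw [kraw, Finset.mul_sum]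
    refine Finset.sum_congr rfl fun j _ => ?_
    simp only [hφ, hm', qPoch_succ_left, e]
    ring
  rw [hK1, mul_assoc _ _ (kraw p u (p * v) N r), hK2, hK, Finset.mul_sum, mul_add, Finset.mul_sum,
    add_right_comm, ← Finset.sum_add_distrib]
  congr 1
  refine Finset.sum_congr rfl fun j hj => ?_
  have hj' : j ≤ N := by have := Finset.mem_range.mp hj; omega
  suffices h : (1 - p ^ (N + 1)) * m (j + 1) = m' j * (p ^ (N + 1) * p⁻¹ ^ j)
      + m' (j + 1) * (1 - p ^ (N + 1) * p⁻¹ ^ (j + 1)) - u * p ^ (N + 1) * m' j by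
    linear_combination φ (j + 1) * h
  have h2 := one_sub_inv_pow_succ_ne_zero hp h1 N
  have h6 := qPoch_inv_pow_ne_zero hp h1 hj'
  have h7 := qPoch_self_ne_zero h1 j
  have h8 : 1 - p ^ (j + 1) ≠ 0 := sub_ne_zero.mpr (h1 j).symm
  have e3 : p⁻¹ ^ (N + 1) * p = p⁻¹ ^ N := by rw [pow_succ]; field_simp
  have hm1 : m (j + 1) = m' j * ((1 - u * p ^ j) * (1 - v) * p /
      ((1 - p⁻¹ ^ (N + 1)) * (1 - p ^ (j + 1)))) := by
    simp only [hm, hm']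
    rw [qPoch_succ u, qPoch_succ_left v, qPoch_succ_left (p⁻¹ ^ (N + 1)), e3, qPoch_succ p p j,
      ← pow_succ' p j, mul_comm v p, pow_succ p j]
    generalize p⁻¹ ^ (N + 1) = g at *
    field_simp
  have hg : p ^ (N + 1) * p⁻¹ ^ (N + 1) = 1 := by rw [← mul_pow, mul_inv_cancel₀ hp, one_pow]
  have hpj : p ^ (j + 1) * p⁻¹ ^ (j + 1) = 1 := by rw [← mul_pow, mul_inv_cancel₀ hp, one_pow]
  have hpj' : p⁻¹ ^ j = p * p⁻¹ ^ (j + 1) := by rw [pow_succ']; field_simp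
  have hG : p ^ (N + 1) ≠ 0 := pow_ne_zero _ hp
  have hg' : p⁻¹ ^ (N + 1) = (p ^ (N + 1))⁻¹ := by rw [inv_pow]
  have hPj : p⁻¹ ^ (j + 1) = (p ^ (j + 1))⁻¹ := by rw [inv_pow]
  have hPj0 : p ^ (j + 1) ≠ 0 := pow_ne_zero _ hp
  have hG1 : 1 - p ^ (N + 1) ≠ 0 := sub_ne_zero.mpr (h1 N).symm
  by_cases hjN : j = N
  · subst hjN
    -- This product is the defect of the top coefficient; its numerator is a multiple of the
    -- expression in `huv`.
    have e4 : m' j * (1 - u * p ^ j) * (p⁻¹ ^ (j + 1) - v) = 0 := by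
      simp only [hm']
      rw [qPoch_succ] at huv
      rw [div_mul_eq_mul_div, div_mul_eq_mul_div, div_mul_eq_mul_div, div_eq_zero_iff]
      left
      linear_combination p ^ j * huv
    -- The denominator (p^{-N}; p)_{N+1} vanishes, so the quotient takes the default value 0.
    have e5 : m' (j + 1) = 0 := by
      simp only [hm', qPoch_inv_pow_eq_zero hp (Nat.lt_succ_self j)]
      simp
    rw [hm1, e5, hpj', hg']
    rw [hg'] at e4 h2
    have e6 : p ^ (j + 1) = p ^ j * p := pow_succ _ _
    have aux : ∀ M X g G : K, 1 - g ≠ 0 → 1 - G ≠ 0 →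
        (1 - G) * (M * (X * (1 - v) * p / ((1 - g) * (1 - G)))) - M * p * X =
          M * X * (g - v) * (p / (1 - g)) := by
      intro M X g G hg hG
      field_simp
      ring
    have := aux (m' j) (1 - u * p ^ j) _ _ h2 hG1
    rw [e4, zero_mul, sub_eq_zero] at this
    have eG : p ^ (j + 1) * (p * (p ^ (j + 1))⁻¹) = p := by field_simp
    linear_combination this - m' j * eG + u * m' j * e6
  · have h4 := one_sub_inv_pow_mul_pow_ne_zero hp h1 (show j < N by omega)
    have hm2 : m' (j + 1) = m' j * ((1 - u * p ^ j) * (1 - v * p ^ (j + 1)) * p /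
        ((1 - p⁻¹ ^ N * p ^ j) * (1 - p ^ (j + 1)))) := by
      simp only [hm']
      rw [qPoch_succ u, qPoch_succ (p * v), qPoch_succ (p⁻¹ ^ N), qPoch_succ p p j,
        ← pow_succ' p j, pow_succ p j]
      field_simp
    have e7 : p⁻¹ ^ N * p ^ j = (p ^ (N + 1))⁻¹ * p ^ (j + 1) := by
      rw [← hg', ← e3, pow_succ p j]; ring
    have e8 : p ^ (j + 1) = p ^ j * p := pow_succ _ _
    rw [hm1, hm2, hpj', e7, hg', hPj]
    rw [e7] at h4
    rw [hg'] at h2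
    have h9 : p ^ (N + 1) - p ^ (j + 1) ≠ 0 := by
      intro h
      apply h4
      rw [← sub_eq_zero.mp h, inv_mul_cancel₀ hG, sub_self]
    generalize m' j = M
    generalize p ^ (N + 1) = G at h2 h4 h9 hG hG1 ⊢
    rw [e8] at h4 h8 h9 ⊢
    have hpj0 : p ^ j ≠ 0 := pow_ne_zero _ hp
    generalize p ^ j = P at h4 h8 h9 hpj0 ⊢
    have h10 : 1 - G⁻¹ = -((1 - G) / G) := by field_simp; ring
    have h11 : 1 - G⁻¹ * (P * p) = (G - P * p) / G := by field_simp
    rw [h10, h11]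
    field_simp
    ring

/-- The symmetry of dual `q`-Krawtchouk polynomials under the reversal of the spectrum. -/
theorem kraw_reverse (hp : p ≠ 0) (h1 : ∀ k, p ^ (k + 1) ≠ 1) {c : K} (hc : c ≠ 0) {N r : ℕ}
    (hr : r ≤ N) (u v : K) (huv : ∀ i j, p ^ i * u ≠ p ^ j * v) (h : u * v = c * p⁻¹ ^ N) :
    c ^ r * kraw p (v / c) (u / c) N r = kraw p u v N r := by
  induction N generalizing r u v with
  | zero =>
    obtain rfl : r = 0 := by omega
    simp [kraw_zero]
  | succ N ih =>
    have hne : u ≠ v := by simpa using huv 0 0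
    have hne' : v / c ≠ u / c := fun e => hne ((div_left_inj' hc).mp e).symm
    have hu : u ≠ 0 := by
      rintro rfl
      rw [zero_mul, eq_comm, mul_eq_zero] at h
      exact h.elim hc (pow_ne_zero _ (inv_ne_zero hp))
    have hv : v ≠ 0 := by
      rintro rfl
      rw [mul_zero, eq_comm, mul_eq_zero] at h
      exact h.elim hc (pow_ne_zero _ (inv_ne_zero hp))
    have h2 := one_sub_inv_pow_succ_ne_zero hp h1 N
    -- Replacing (u, v) by (v/c, u/c) does not change the connection coefficients, since p^{-(N+1)}
    -- = uv/c; both sides of the symmetry thus obey the same recurrence in the order.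
    have conn : ∀ u v : K, u ≠ 0 → v ≠ 0 → u ≠ v → u * v = c * p⁻¹ ^ (N + 1) →
        krawConn p (v / c) (u / c) (N + 1) = krawConn p v u (N + 1) := by
      intro u v hu hv hne h
      have hs : v - u ≠ 0 := sub_ne_zero.mpr hne.symm
      have hg : p⁻¹ ^ (N + 1) = u * v / c := by rw [h]; field_simp
      rw [krawConn, krawConn]
      rw [hg] at h2 ⊢
      rw [div_eq_div_iff (mul_ne_zero h2 (by rw [← sub_div]; exact div_ne_zero hs hc))
        (mul_ne_zero h2 hs)]
      field_simp
    have hgp : p⁻¹ ^ (N + 1) * p = p⁻¹ ^ N := by rw [pow_succ]; field_simp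
    -- Passing from v to pv while lowering the order preserves the constraint uv = c p^{-N}. The
    -- hypothesis on all p^i u ≠ p^j v keeps the shifted parameters distinct.
    have i1 : ∀ {r}, r ≤ N → c ^ r * kraw p (p * v / c) (u / c) N r = kraw p u (p * v) N r := by
      intro r hr
      refine ih hr u (p * v) (fun i j => ?_) (by rw [← hgp]; linear_combination p * h)
      rw [← mul_assoc, ← pow_succ]
      exact huv i (j + 1)
    have i2 : ∀ {r}, r ≤ N → c ^ r * kraw p (v / c) (p * u / c) N r = kraw p (p * u) v N r := by
      intro r hr
      refine ih hr (p * u) v (fun i j => ?_) (by rw [← hgp]; linear_combination p * h)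
      rw [← mul_assoc, ← pow_succ]
      exact huv (i + 1) j
    -- The order-lowering recurrence does not reach r = N + 1; the degree-lowering one does, and its
    -- extra factor u or v accounts for the additional power of c.
    by_cases hrN : r ≤ N
    · rw [kraw_lower_order hp h1 hne' hrN, kraw_lower_order hp h1 hne hrN, conn u v hu hv hne h,
        conn v u hv hu hne.symm (by rw [mul_comm, h]), ← i1 hrN, ← i2 hrN, mul_div_assoc,
        mul_div_assoc]
      ring
    · obtain rfl : r = N + 1 := by omega
      rw [kraw_lower_order_degree hp h1 hne' le_rfl, kraw_lower_order_degree hp h1 hne le_rfl,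
        conn u v hu hv hne h, conn v u hv hu hne.symm (by rw [mul_comm, h]), ← i1 le_rfl,
        ← i2 le_rfl, mul_div_assoc, mul_div_assoc]
      rw [pow_succ]
      field_simp
      ring

end Krawtchouk

/-! ## A contiguous relation for Askey-Wilson polynomials -/

section AskeyWilson

open Polynomial

/-- The polynomial `(a e^{iθ}, a e^{-iθ}; p)_k` in `x = cos θ`. -/
noncomputable def awBasis (a p : ℂ) (k : ℕ) : ℂ[X] :=
  ∏ i ∈ Finset.range k, (1 - C (2 * a * p ^ i) * X + C (a ^ 2 * p ^ (2 * i)))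

/-- The coefficients of an Askey-Wilson polynomial, without the factor `(p^{-n}; p)_k`. -/
noncomputable def awCoeff (n : ℕ) (a b c d p : ℂ) (k : ℕ) : ℂ :=
  (a ^ n)⁻¹ * (qPoch (a * b) p n * qPoch (a * c) p n * qPoch (a * d) p n)
    * (qPoch (a * b * c * d * p ^ ((n : ℤ) - 1)) p k
      / (qPoch (a * b) p k * qPoch (a * c) p k * qPoch (a * d) p k * qPoch p p k) * p ^ k)

theorem askeyWilson_eq_sum (n : ℕ) (a b c d p : ℂ) : askeyWilson n a b c d p =
    ∑ k ∈ Finset.range (n + 1),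
      C (qPoch (p⁻¹ ^ n) p k * awCoeff n a b c d p k) * awBasis a p k := by
  rw [askeyWilson, Finset.mul_sum]
  refine Finset.sum_congr rfl fun k _ => ?_
  rw [← mul_assoc, ← C_mul, awBasis]
  congr 2
  rw [awCoeff, zpow_neg, zpow_natCast, inv_pow]
  ring

/-- The quadratic factor is a constant plus a multiple of 1 - 2ap^k X + a²p^{2k}, the factor that
extends the k-th basis element to the next. -/
theorem linear_mul_awBasis {a p : ℂ} (ha : a ≠ 0) (hp : p ≠ 0) (b : ℂ) (k : ℕ) :
    (1 - C (2 * b) * X + C (b ^ 2)) * awBasis a p k =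
      C ((1 - b / (a * p ^ k)) * (1 - a * b * p ^ k)) * awBasis a p k
        + C (b / (a * p ^ k)) * awBasis a p (k + 1) := by
  have hpk := pow_ne_zero k hp
  rw [awBasis, awBasis, Finset.prod_range_succ]
  have e1 : (1 - b / (a * p ^ k)) * (1 - a * b * p ^ k) + b / (a * p ^ k)
      * (1 + a ^ 2 * p ^ (2 * k)) = 1 + b ^ 2 := by
    rw [pow_mul']
    field_simp
    ring
  have e2 : b / (a * p ^ k) * (2 * a * p ^ k) = 2 * b := by field_simp
  have e1' := congr(C $e1)
  have e2' := congr(C $e2)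
  simp only [C_add, C_mul, C_1] at e1' e2' ⊢
  generalize (∏ i ∈ Finset.range k, (1 - C 2 * C a * C (p ^ i) * X + C (a ^ 2) * C (p ^ (2 * i)))
    : ℂ[X]) = R
  linear_combination (-R) * e1' + R * X * e2'

/-- The coefficient comparison at basis index j + 1 in the contiguous relation, with Q = p^n, P =
p^j, s the common coefficient and φ = (p^{-n}; p)_j. -/
theorem contiguous_term {a b c d p Q P : ℂ} (ha : a ≠ 0) (hp : p ≠ 0) (hQ : Q ≠ 0) (hP : P ≠ 0)
    (g1 : 1 - a * b * P ≠ 0) (g2 : 1 - a * c * P ≠ 0) (g3 : 1 - a * d * P ≠ 0)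
    (g4 : 1 - P * p ≠ 0) (s φ : ℂ) :
    (d - b) * ((1 - (Q * p)⁻¹) * φ * ((1 - a * c * Q) / a * (s * ((1 - a * b * c * d * Q * P) * p /
        ((1 - a * b * P) * (1 - a * c * P) * (1 - a * d * P) * (1 - P * p)))))) =
      φ * (1 - Q⁻¹ * P) * (s * ((1 - a * b * c * d * Q * P) * p /
        ((1 - a * b * P) * (1 - a * c * P) * (1 - a * d * P) * (1 - P * p)))) *
        ((1 - c * d * Q) * (1 - b / (a * (P * p))) - (1 - b * c * Q) * (1 - d / (a * (P * p)))) +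
      φ * s * ((1 - c * d * Q) * (b / (a * P) / (1 - a * b * P))
        - (1 - b * c * Q) * (d / (a * P) / (1 - a * d * P))) := by
  have e : (1 - a * b * P) * (1 - a * c * P) * (1 - a * d * P) * (1 - P * p) ≠ 0 :=
    mul_ne_zero (mul_ne_zero (mul_ne_zero g1 g2) g3) g4
  have e1 : ∀ x y, x / y / (1 - a * b * P) = x / y * ((1 - a * c * P) * (1 - a * d * P)
      * (1 - P * p)) / ((1 - a * b * P) * (1 - a * c * P) * (1 - a * d * P) * (1 - P * p)) := by
    intro x y
    rw [div_eq_div_iff g1 e]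
    ring
  have e2 : ∀ x y, x / y / (1 - a * d * P) = x / y * ((1 - a * b * P) * (1 - a * c * P)
      * (1 - P * p)) / ((1 - a * b * P) * (1 - a * c * P) * (1 - a * d * P) * (1 - P * p)) := by
    intro x y
    rw [div_eq_div_iff g3 e]
    ring
  rw [e1, e2]
  generalize hD : (1 - a * b * P) * (1 - a * c * P) * (1 - a * d * P) * (1 - P * p) = D at e ⊢
  clear e1 e2 hD g1 g2 g3 g4
  field_simp
  ring

set_option maxHeartbeats 1000000 in
/-- A contiguous relation which lowers the degree of an Askey-Wilson polynomial and shifts one of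
two parameters. -/
theorem askeyWilson_contiguous (n : ℕ) {a b c d p : ℂ} (ha : a ≠ 0) (hp : p ≠ 0)
    (h1 : ∀ k, p ^ (k + 1) ≠ 1) (hab : ∀ k, a * b * p ^ k ≠ 1) (hac : ∀ k, a * c * p ^ k ≠ 1)
    (had : ∀ k, a * d * p ^ k ≠ 1) :
    C (d - b) * askeyWilson (n + 1) a b c d p =
      C ((1 - a * d * p ^ n) * (1 - c * d * p ^ n)) * ((1 - C (2 * b) * X + C (b ^ 2))
        * askeyWilson n a (b * p) c d p)
      - C ((1 - a * b * p ^ n) * (1 - b * c * p ^ n)) * ((1 - C (2 * d) * X + C (d ^ 2))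
        * askeyWilson n a b c (d * p) p) := by
  have nz : ∀ x : ℂ, (∀ k, x * p ^ k ≠ 1) → ∀ k, qPoch x p k ≠ 0 := fun x h k =>
    Finset.prod_ne_zero_iff.mpr fun i _ => sub_ne_zero.mpr (h i).symm
  have hp' := qPoch_self_ne_zero h1
  -- As a is not shifted, the three polynomials share one basis, and their k-th coefficients are
  -- elementary multiples of the same S k (`hF`, `hB`, `hD`).
  set S : ℕ → ℂ := fun k => (a ^ n)⁻¹ * (qPoch (a * b) p (n + 1) * qPoch (a * c) p n
    * qPoch (a * d) p (n + 1)) * (qPoch (a * b * c * d * p ^ n) p k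
      / (qPoch (a * b) p k * qPoch (a * c) p k * qPoch (a * d) p k * qPoch p p k) * p ^ k) with hS
  set T : ℕ → ℂ := fun k => qPoch (p⁻¹ ^ n) p k * S k with hT
  have hF : ∀ k, awCoeff (n + 1) a b c d p k = (1 - a * c * p ^ n) / a * S k := by
    intro k
    have e : ((n + 1 : ℕ) : ℤ) - 1 = n := by push_cast; ring
    simp only [awCoeff, hS, e, zpow_natCast, qPoch_succ (a * c) p n, pow_succ a n]
    field_simp
  have hN : p ^ n = p * p ^ ((n : ℤ) - 1) := by
    rw [← zpow_one_add₀ hp, ← zpow_natCast]; congr 1; ring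
  have hB : ∀ k, (1 - a * d * p ^ n) * awCoeff n a (b * p) c d p k * (1 - a * b * p ^ k) = S k := by
    intro k
    have e1 := one_sub_mul_qPoch (a * b) p k
    have e2 := qPoch_succ_left (a * b) p n
    have e3 : a * (b * p) = p * (a * b) := by ring
    have e4 : a * (b * p) * c * d * p ^ ((n : ℤ) - 1) = a * b * c * d * p ^ n := by rw [hN]; ring
    have h5 : 1 - a * b ≠ 0 := sub_ne_zero.mpr (by simpa using (hab 0).symm)
    have h6 : 1 - a * b * p ^ k ≠ 0 := sub_ne_zero.mpr (hab k).symm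
    have e5 : qPoch (p * (a * b)) p k = qPoch (a * b) p k * (1 - a * b * p ^ k) / (1 - a * b) := by
      rw [eq_div_iff h5, ← e1, mul_comm]
    have h7 := nz _ hab k
    rw [awCoeff, e4, e3, e5, hS]
    simp only
    rw [e2, mul_comm (a * b) p, qPoch_succ (a * d)]
    field_simp
  have hD : ∀ k, (1 - a * b * p ^ n) * awCoeff n a b c (d * p) p k * (1 - a * d * p ^ k) = S k := by
    intro k
    have e1 := one_sub_mul_qPoch (a * d) p k
    have e2 := qPoch_succ_left (a * d) p n
    have e3 : a * (d * p) = p * (a * d) := by ring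
    have e4 : a * b * c * (d * p) * p ^ ((n : ℤ) - 1) = a * b * c * d * p ^ n := by rw [hN]; ring
    have h5 : 1 - a * d ≠ 0 := sub_ne_zero.mpr (by simpa using (had 0).symm)
    have h6 : 1 - a * d * p ^ k ≠ 0 := sub_ne_zero.mpr (had k).symm
    have e5 : qPoch (p * (a * d)) p k = qPoch (a * d) p k * (1 - a * d * p ^ k) / (1 - a * d) := by
      rw [eq_div_iff h5, ← e1, mul_comm]
    have h7 := nz _ had k
    rw [awCoeff, e4, e3, e5, hS]
    simp only
    rw [e2, mul_comm (a * d) p, qPoch_succ (a * b)]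
    field_simp
  have expand : ∀ (x y : ℂ) (w : ℕ → ℂ), (∀ k, x * w k * (1 - a * y * p ^ k) = S k) →
      ∀ z : ℂ, (∀ k, a * y * p ^ k ≠ 1) → C (x * z) * ((1 - C (2 * y) * X + C (y ^ 2)) *
        ∑ k ∈ Finset.range (n + 1), C (qPoch (p⁻¹ ^ n) p k * w k) * awBasis a p k) =
      ∑ k ∈ Finset.range (n + 1), (C (T k * (z * (1 - y / (a * p ^ k)))) * awBasis a p k
        + C (T k * (z * (y / (a * p ^ k) / (1 - a * y * p ^ k)))) * awBasis a p (k + 1)) := by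
    intro x y w hw z hy
    rw [Finset.mul_sum, Finset.mul_sum]
    refine Finset.sum_congr rfl fun k _ => ?_
    have h := linear_mul_awBasis ha hp y k
    have h6 : 1 - a * y * p ^ k ≠ 0 := sub_ne_zero.mpr (hy k).symm
    have e1 : x * z * (qPoch (p⁻¹ ^ n) p k * w k) * ((1 - y / (a * p ^ k)) * (1 - a * y * p ^ k))
        = T k * (z * (1 - y / (a * p ^ k))) := by
      simp only [hT, ← hw k]
      ring
    have e2 : x * z * (qPoch (p⁻¹ ^ n) p k * w k) * (y / (a * p ^ k))
        = T k * (z * (y / (a * p ^ k) / (1 - a * y * p ^ k))) := by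
      have e3 := div_mul_cancel₀ (y / (a * p ^ k)) h6
      simp only [hT, ← hw k]
      linear_combination (-(x * z * (qPoch (p⁻¹ ^ n) p k * w k))) * e3
    rw [← e1, ← e2]
    simp only [C_mul] at h ⊢
    linear_combination (C x * C z * (C (qPoch (p⁻¹ ^ n) p k) * C (w k))) * h
  rw [askeyWilson_eq_sum, askeyWilson_eq_sum, askeyWilson_eq_sum,
    expand _ b _ hB _ hab, expand _ d _ hD _ had, ← Finset.sum_sub_distrib]
  have hT0 : T (n + 1) = 0 := by
    simp only [hT, qPoch_inv_pow_eq_zero hp (Nat.lt_succ_self n), zero_mul]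
  set U : ℕ → ℂ := fun k => T k * ((1 - c * d * p ^ n) * (1 - b / (a * p ^ k))
    - (1 - b * c * p ^ n) * (1 - d / (a * p ^ k))) with hU
  set V : ℕ → ℂ := fun k => T k * ((1 - c * d * p ^ n) * (b / (a * p ^ k) / (1 - a * b * p ^ k))
    - (1 - b * c * p ^ n) * (d / (a * p ^ k) / (1 - a * d * p ^ k))) with hV
  -- The sum is regrouped by basis element; no top term is lost because (p^{-n}; p)_{n+1} = 0.
  have e1 : ∑ k ∈ Finset.range (n + 1), (C (U k) * awBasis a p k + C (V k) * awBasis a p (k + 1)) =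
      ∑ k ∈ Finset.range (n + 1), C (U (k + 1) + V k) * awBasis a p (k + 1)
        + C (U 0) * awBasis a p 0 := by
    have hU0 : U (n + 1) = 0 := by simp only [hU, hT0, zero_mul]
    have := Finset.sum_range_succ (fun k => C (U k) * awBasis a p k) (n + 1)
    rw [hU0, C_0, zero_mul, add_zero, Finset.sum_range_succ'] at this
    rw [Finset.sum_add_distrib, ← this, add_right_comm, ← Finset.sum_add_distrib]
    simp only [C_add, add_mul]
  trans ∑ k ∈ Finset.range (n + 1), (C (U k) * awBasis a p k + C (V k) * awBasis a p (k + 1))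
  swap
  · refine Finset.sum_congr rfl fun k _ => ?_
    simp only [hU, hV, mul_sub (T k), C_sub]
    ring
  rw [e1, Finset.sum_range_succ', mul_add, Finset.mul_sum]
  congr 1
  · refine Finset.sum_congr rfl fun j _ => ?_
    rw [← mul_assoc, ← C_mul]
    congr 2
    have g1 : 1 - a * b * p ^ j ≠ 0 := sub_ne_zero.mpr (hab j).symm
    have g2 : 1 - a * c * p ^ j ≠ 0 := sub_ne_zero.mpr (hac j).symm
    have g3 : 1 - a * d * p ^ j ≠ 0 := sub_ne_zero.mpr (had j).symm
    have g4 : 1 - p ^ (j + 1) ≠ 0 := sub_ne_zero.mpr (h1 j).symm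
    have n1 := nz _ hab j
    have n2 := nz _ hac j
    have n3 := nz _ had j
    have n4 := hp' j
    have hS1 : S (j + 1) = S j * ((1 - a * b * c * d * p ^ n * p ^ j) * p /
        ((1 - a * b * p ^ j) * (1 - a * c * p ^ j) * (1 - a * d * p ^ j) * (1 - p ^ (j + 1)))) := by
      simp only [hS, qPoch_succ _ p j]
      rw [← pow_succ' p j, pow_succ p j]
      field_simp
    have e2 : qPoch (p⁻¹ ^ (n + 1)) p (j + 1) = (1 - p⁻¹ ^ (n + 1)) * qPoch (p⁻¹ ^ n) p j := by
      rw [qPoch_succ_left]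
      congr 2
      rw [pow_succ]
      field_simp
    simp only [hF, hU, hV, hT, e2, qPoch_succ (p⁻¹ ^ n), hS1]
    rw [inv_pow, inv_pow, pow_succ p n, pow_succ p j]
    rw [pow_succ p j] at g4
    exact contiguous_term ha hp (pow_ne_zero n hp) (pow_ne_zero j hp) g1 g2 g3 g4 _ _
  · rw [← mul_assoc, ← C_mul]
    congr 2
    simp only [hF, hU, hT, qPoch_zero_right, pow_zero]
    field_simp
    ring

end AskeyWilson

/-! ## Bilinear forms in the matrix elements -/

section BilinearForms

variable {q : QParam}

theorem sum_smul_coactStep (u v : FunAlg q) {h : ℕ → FunAlg q} {L : ℕ} (hL : h (L + 1) = 0)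
    (f : ℕ → ℂ) : ∑ r ∈ Finset.range (L + 2), f r • coactStep q u v h (L + 1 - r) =
      u * ∑ r ∈ Finset.range (L + 1), (qc q ^ (L - r) * f (r + 1)) • h (L - r)
        + v * ∑ r ∈ Finset.range (L + 1), f r • h (L - r) := by
  have e1 : ∀ r ∈ Finset.range (L + 1), f r • coactStep q u v h (L + 1 - r) =
      f r • (qc q ^ (L + 1 - r) • (u * h (L + 1 - r))) + f r • (v * h (L - r)) := by
    intro r hr
    have hr' := Finset.mem_range.mp hr
    rw [show L + 1 - r = L - r + 1 by omega, coactStep_succ, smul_add]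
  have e2 : f (L + 1) • coactStep q u v h (L + 1 - (L + 1)) =
      f (L + 1) • (qc q ^ (L + 1 - (L + 1)) • (u * h (L + 1 - (L + 1)))) := by
    rw [Nat.sub_self, coactStep_zero, pow_zero, one_smul]
  rw [Finset.sum_range_succ, Finset.sum_congr rfl e1, Finset.sum_add_distrib, e2,
    add_right_comm, ← Finset.sum_range_succ
      (fun r => f r • (qc q ^ (L + 1 - r) • (u * h (L + 1 - r)))), Finset.sum_range_succ',
    Nat.sub_zero, hL]
  simp only [Finset.mul_sum, mul_zero, smul_zero, add_zero, Nat.add_sub_add_right, mul_smul_comm,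
    smul_smul, mul_comm (f _)]

/-- The combination `∑_{r,s} f(r) g(s) t_{L-r,L-s}` of the coefficients of the coaction in
degree `L`. -/
noncomputable def coactForm (q : QParam) (L : ℕ) (f g : ℕ → ℂ) : FunAlg q :=
  ∑ s ∈ Finset.range (L + 1), g s • ∑ r ∈ Finset.range (L + 1), f r • coactMat q L (L - r) (L - s)

theorem coactForm_add_left (L : ℕ) (a b : ℂ) (f f' g : ℕ → ℂ) :
    coactForm q L (a • f + b • f') g = a • coactForm q L f g + b • coactForm q L f' g := by
  simp only [coactForm, Finset.smul_sum, ← Finset.sum_add_distrib, Pi.add_apply, Pi.smul_apply,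
    smul_eq_mul, smul_smul, ← add_smul]
  refine Finset.sum_congr rfl fun s _ => Finset.sum_congr rfl fun r _ => ?_
  congr 1
  ring

theorem coactForm_congr {L : ℕ} {f f' g g' : ℕ → ℂ} (hf : ∀ r ≤ L, f r = f' r)
    (hg : ∀ r ≤ L, g r = g' r) : coactForm q L f g = coactForm q L f' g' := by
  refine Finset.sum_congr rfl fun s hs => ?_
  rw [hg s (Finset.mem_range_succ_iff.mp hs)]
  congr 1
  refine Finset.sum_congr rfl fun r hr => ?_
  rw [hf r (Finset.mem_range_succ_iff.mp hr)]

/-- The part g' of g is lowered by the (β, δ) recursion and the shifted part by the (α, γ)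
recursion, whose cost q^{L-s} is supplied by the coefficient. Both produce the same lower forms, so
the generators combine into β + κα and δ + κγ. -/
theorem coactForm_succ {L : ℕ} {f g g' : ℕ → ℂ} {κ : ℂ} (h0 : g 0 = g' 0)
    (hs : ∀ s ≤ L, g (s + 1) = g' (s + 1) + κ * qc q ^ (L - s) * g' s) (hL : g' (L + 1) = 0) :
    coactForm q (L + 1) f g =
      (.gen q .be + κ • .gen q .al) * coactForm q L (fun r => qc q ^ (L - r) * f (r + 1)) g'
      + (.gen q .de + κ • .gen q .ga) * coactForm q L f g' := by
  have hcol1 : ∀ s ∈ Finset.range (L + 1), ∑ r ∈ Finset.range (L + 2),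
      f r • coactMat q (L + 1) (L + 1 - r) (L + 1 - s) =
      .gen q .be * ∑ r ∈ Finset.range (L + 1), (qc q ^ (L - r) * f (r + 1)) •
          coactMat q L (L - r) (L - s)
        + .gen q .de * ∑ r ∈ Finset.range (L + 1), f r • coactMat q L (L - r) (L - s) := by
    intro s hs
    have hs' := Finset.mem_range.mp hs
    rw [show L + 1 - s = L - s + 1 by omega]
    simp only [coactMat_succ_right]
    exact sum_smul_coactStep (h := fun k => coactMat q L k (L - s)) _ _
      (coactMat_vanish (Nat.sub_le L s) (Nat.lt_succ_self L)) f
  have hcol2 : ∀ s ∈ Finset.range (L + 1), (qc q ^ (L - s)) • ∑ r ∈ Finset.range (L + 2),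
      f r • coactMat q (L + 1) (L + 1 - r) (L - s) =
      .gen q .al * ∑ r ∈ Finset.range (L + 1), (qc q ^ (L - r) * f (r + 1)) •
          coactMat q L (L - r) (L - s)
        + .gen q .ga * ∑ r ∈ Finset.range (L + 1), f r • coactMat q L (L - r) (L - s) := by
    intro s hs
    rw [Finset.smul_sum]
    simp only [smul_comm (qc q ^ (L - s)), coactMat_succ_left _ (Nat.sub_le L s)]
    exact sum_smul_coactStep (h := fun k => coactMat q L k (L - s)) _ _
      (coactMat_vanish (Nat.sub_le L s) (Nat.lt_succ_self L)) f
  have hsplit : ∀ X : ℕ → FunAlg q, ∑ s ∈ Finset.range (L + 2), g s • X s =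
      ∑ s ∈ Finset.range (L + 1), g' s • X s
        + ∑ s ∈ Finset.range (L + 1), (κ * qc q ^ (L - s) * g' s) • X (s + 1) := by
    intro X
    rw [Finset.sum_range_succ', h0, Finset.sum_congr rfl fun s hs' => by
      rw [hs s (Finset.mem_range_succ_iff.mp hs'), add_smul], Finset.sum_add_distrib,
      add_right_comm, ← Finset.sum_range_succ' (fun s => g' s • X s), Finset.sum_range_succ, hL,
      zero_smul, add_zero]
  rw [coactForm, hsplit, Finset.sum_congr rfl fun s hs => by rw [hcol1 s hs]]
  have e2 : ∀ s ∈ Finset.range (L + 1), (κ * qc q ^ (L - s) * g' s) • ∑ r ∈ Finset.range (L + 1 + 1),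
      f r • coactMat q (L + 1) (L + 1 - r) (L + 1 - (s + 1)) =
      (κ * g' s) • (.gen q .al * ∑ r ∈ Finset.range (L + 1), (qc q ^ (L - r) * f (r + 1)) •
          coactMat q L (L - r) (L - s)
        + .gen q .ga * ∑ r ∈ Finset.range (L + 1), f r • coactMat q L (L - r) (L - s)) := by
    intro s hs
    rw [← hcol2 s hs, smul_smul, Nat.add_sub_add_right]
    congr 1
    ring
  rw [Finset.sum_congr rfl e2]
  simp only [coactForm, smul_add, Finset.sum_add_distrib, add_mul, smul_mul_assoc, mul_smul,
    ← Finset.smul_sum]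
  simp only [← mul_smul_comm, ← Finset.mul_sum]
  abel

/-- The vectors built from dual `q`-Krawtchouk polynomials. -/
noncomputable def krawVec (q : QParam) (L : ℕ) (c u v : ℂ) (r : ℕ) : ℂ :=
  c ^ r * qc q ^ (r.choose 2) * kraw (qc q ^ 2) u v L r

/-- The Gaussian binomial coefficient with base `q²`, as a complex number. -/
noncomputable def gaussBinom (q : QParam) (L k : ℕ) : ℂ := ((qBinom ((q : ℝ) ^ 2) L k : ℝ) : ℂ)

/-- The combinations of matrix elements given by two vectors of dual `q`-Krawtchouk polynomials. -/
noncomputable def krawForm (q : QParam) (L : ℕ) (t u v s u' v' : ℂ) : FunAlg q :=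
  coactForm q L (krawVec q L (Complex.I * t) u v)
    (fun k => gaussBinom q L k * krawVec q L (-Complex.I * s) u' v' k)

theorem krawForm_comm_left (L : ℕ) (t u v s u' v' : ℂ) :
    krawForm q L t u v s u' v' = krawForm q L t v u s u' v' := by
  unfold krawForm krawVec
  simp only [kraw_comm _ u v]

theorem krawForm_comm_right (L : ℕ) (t u v s u' v' : ℂ) :
    krawForm q L t u v s u' v' = krawForm q L t u v s v' u' := by
  unfold krawForm krawVec
  simp only [kraw_comm _ u' v']

theorem krawForm_one (L : ℕ) (t v w s u' v' : ℂ) :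
    krawForm q L t 1 v s u' v' = krawForm q L t 1 w s u' v' := by
  unfold krawForm krawVec
  simp only [kraw_one_left]

theorem qc_sq_pow_ne_one (q : QParam) (k : ℕ) : (qc q ^ 2) ^ (k + 1) ≠ 1 := by
  have := one_sub_pow_succ_pos (sq_pos_lt_one q).1 (sq_pos_lt_one q).2 k
  unfold qc
  exact_mod_cast (by linarith : ((q : ℝ) ^ 2) ^ (k + 1) < 1).ne

theorem qc_sq_ne_zero (q : QParam) : qc q ^ 2 ≠ 0 := pow_ne_zero 2 (qc_ne_zero q)

/-- In `kraw_raise_order` the factors 1 - p^m are absorbed into Gaussian binomials, so that the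
weighted vector has exactly the shape required by `coactForm_succ`. -/
theorem gaussBinom_mul_kraw {L r : ℕ} (hr : r ≤ L) {u v : ℂ}
    (huv : qPoch u (qc q ^ 2) (L + 1) * qPoch (qc q ^ 2 * v) (qc q ^ 2) L
      * ((qc q ^ 2)⁻¹ ^ (L + 1) - v) = 0) :
    gaussBinom q (L + 1) (r + 1) * kraw (qc q ^ 2) u v (L + 1) (r + 1) =
      gaussBinom q L (r + 1) * kraw (qc q ^ 2) u (qc q ^ 2 * v) L (r + 1)
      + u * (qc q ^ 2) ^ (L - r) * (gaussBinom q L r * kraw (qc q ^ 2) u (qc q ^ 2 * v) L r) := by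
  have hp := qc_sq_ne_zero q
  have h1 := qc_sq_pow_ne_one q
  have e1 := kraw_raise_order hp h1 hr huv
  obtain ⟨h0', h1'⟩ := sq_pos_lt_one q
  have e2 : (1 - (qc q ^ 2) ^ (L + 1) * (qc q ^ 2)⁻¹ ^ (r + 1)) * gaussBinom q (L + 1) (r + 1) =
      (1 - (qc q ^ 2) ^ (L + 1)) * gaussBinom q L (r + 1) := by
    have := qBinom_succ_mul h0' L (r + 1)
    unfold gaussBinom qc
    exact_mod_cast this
  have e3 : (1 - (qc q ^ 2) ^ (r + 1)) * gaussBinom q (L + 1) (r + 1) =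
      (1 - (qc q ^ 2) ^ (L + 1)) * gaussBinom q L r := by
    have := qBinom_succ_succ_mul h0' h1' L r
    unfold gaussBinom qc
    exact_mod_cast this
  have e4 : (qc q ^ 2) ^ (L + 1) = (qc q ^ 2) ^ (L - r) * (qc q ^ 2) ^ (r + 1) := by
    rw [← pow_add]; congr 1; omega
  have e5 : (qc q ^ 2) ^ (r + 1) * (qc q ^ 2)⁻¹ ^ (r + 1) = 1 := by
    rw [← mul_pow, mul_inv_cancel₀ hp, one_pow]
  apply mul_left_cancel₀ (sub_ne_zero.mpr (h1 L).symm)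
  generalize (qc q ^ 2)⁻¹ ^ (r + 1) = Pi at *
  generalize (qc q ^ 2) ^ (r + 1) = P at *
  generalize (qc q ^ 2) ^ (L - r) = M at *
  generalize (qc q ^ 2) ^ (L + 1) = N at *
  linear_combination gaussBinom q (L + 1) (r + 1) * e1
    + kraw (qc q ^ 2) u (qc q ^ 2 * v) L (r + 1) * e2
    + u * M * kraw (qc q ^ 2) u (qc q ^ 2 * v) L r * e3
    + (u * gaussBinom q (L + 1) (r + 1) * kraw (qc q ^ 2) u (qc q ^ 2 * v) L r * (Pi - 1)) * e4
    + (u * gaussBinom q (L + 1) (r + 1) * kraw (qc q ^ 2) u (qc q ^ 2 * v) L r * M) * e5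

/-- The row vector splits by the two lowering recurrences, whose coefficients differ by a factor
proportional to u or v. The column vector has the form needed by `coactForm_succ` with κ = -iU, U =
s q^L u'. In each summand, (δ + κγ) + iT(β + κα) is the linear element with parameters T and U. -/
theorem krawForm_succ {L : ℕ} {t u v s u' v' : ℂ} (huv : u ≠ v)
    (huv' : qPoch u' (qc q ^ 2) (L + 1) * qPoch (qc q ^ 2 * v') (qc q ^ 2) L
      * ((qc q ^ 2)⁻¹ ^ (L + 1) - v') = 0) :
    krawForm q (L + 1) t u v s u' v' =
      krawConn (qc q ^ 2) u v (L + 1) • (linElt q (t * qc q ^ L * u) (s * qc q ^ L * u')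
        * krawForm q L t u (qc q ^ 2 * v) s u' (qc q ^ 2 * v'))
      + krawConn (qc q ^ 2) v u (L + 1) • (linElt q (t * qc q ^ L * v) (s * qc q ^ L * u')
        * krawForm q L t (qc q ^ 2 * u) v s u' (qc q ^ 2 * v')) := by
  have hp := qc_sq_ne_zero q
  have h1 := qc_sq_pow_ne_one q
  set A := krawConn (qc q ^ 2) u v (L + 1) with hA
  set B := krawConn (qc q ^ 2) v u (L + 1) with hB
  have hf1 : ∀ r ≤ L, krawVec q (L + 1) (Complex.I * t) u v r =
      (A • krawVec q L (Complex.I * t) u (qc q ^ 2 * v)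
        + B • krawVec q L (Complex.I * t) (qc q ^ 2 * u) v) r := by
    intro r hr
    simp only [krawVec, kraw_lower_order hp h1 huv hr, Pi.add_apply, Pi.smul_apply, smul_eq_mul]
    ring
  have hf2 : ∀ r ≤ L, qc q ^ (L - r) * krawVec q (L + 1) (Complex.I * t) u v (r + 1) =
      ((A * (Complex.I * (t * qc q ^ L * u))) • krawVec q L (Complex.I * t) u (qc q ^ 2 * v)
        + (B * (Complex.I * (t * qc q ^ L * v)))
          • krawVec q L (Complex.I * t) (qc q ^ 2 * u) v) r := by
    intro r hr
    have e : qc q ^ L = qc q ^ (L - r) * qc q ^ r := by rw [← pow_add]; congr 1; omega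
    simp only [krawVec, kraw_lower_order_degree hp h1 huv hr, Pi.add_apply, Pi.smul_apply,
      smul_eq_mul, Nat.choose_succ_succ r 1, Nat.choose_one_right, pow_add, e]
    ring
  have hg : ∀ r ≤ L, gaussBinom q (L + 1) (r + 1) *
        krawVec q (L + 1) (-Complex.I * s) u' v' (r + 1) =
      gaussBinom q L (r + 1) * krawVec q L (-Complex.I * s) u' (qc q ^ 2 * v') (r + 1)
        + -(Complex.I * (s * qc q ^ L * u')) * qc q ^ (L - r) *
          (gaussBinom q L r * krawVec q L (-Complex.I * s) u' (qc q ^ 2 * v') r) := by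
    intro r hr
    have e : qc q ^ L = qc q ^ (L - r) * qc q ^ r := by rw [← pow_add]; congr 1; omega
    have e2 : (qc q ^ 2) ^ (L - r) = qc q ^ (L - r) * qc q ^ (L - r) := by
      rw [← pow_mul, mul_comm 2, mul_two, pow_add]
    have e3 := gaussBinom_mul_kraw hr huv'
    simp only [krawVec, Nat.choose_succ_succ r 1, Nat.choose_one_right, pow_add, e] at e3 ⊢
    rw [e2] at e3
    linear_combination ((-Complex.I * s) ^ r * (-Complex.I * s) ^ 1 * (qc q ^ r * qc q ^ r.choose 2))
      * e3
  rw [krawForm, coactForm_succ (κ := -(Complex.I * (s * qc q ^ L * u')))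
    (g' := fun k => gaussBinom q L k * krawVec q L (-Complex.I * s) u' (qc q ^ 2 * v') k) _ hg _,
    coactForm_congr hf1 fun _ _ => rfl, coactForm_congr hf2 fun _ _ => rfl, coactForm_add_left,
    coactForm_add_left]
  · have hI2 : Complex.I ^ 2 = -1 := Complex.I_sq
    simp only [krawForm, linElt, mul_add, add_mul, sub_mul, smul_add, smul_sub, mul_smul_comm,
      smul_mul_assoc, smul_smul]
    match_scalars <;> first | ring1 | (ring_nf; rw [hI2]; ring1)
  · simp [krawVec, kraw_zero, gaussBinom, qBinom_zero_right]
  · simp [gaussBinom, qBinom_eq_zero (sq_pos_lt_one q).1 (Nat.lt_succ_self L)]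

/-- The weighted coaction is symmetric under transposition by `binomCoact_swap`, the weights under k
↦ L - k, and the resulting sign (-1)^{r+k} exchanges the factors i and -i of the two vectors. -/
theorem swapHom_krawForm (L : ℕ) (t u v s u' v' : ℂ) :
    swapHom q (krawForm q L t u v s u' v') = krawForm q L s u' v' t u v := by
  simp only [krawForm, coactForm, map_sum, map_smul, Finset.smul_sum]
  rw [Finset.sum_comm]
  refine Finset.sum_congr rfl fun r hr => Finset.sum_congr rfl fun k hk => ?_
  obtain ⟨h0, h1⟩ := sq_pos_lt_one q
  have hr' := Finset.mem_range_succ_iff.mp hr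
  have hk' := Finset.mem_range_succ_iff.mp hk
  have e := congr(swapHom q $(binomCoact_swap (q := q) L (L - r) (L - k)))
  rw [map_smul, swapHom_swapHom, binomCoact, binomCoact, map_smul,
    qBinom_symm h0 h1 (Nat.sub_add_cancel hk'), qBinom_symm h0 h1 (Nat.sub_add_cancel hr')] at e
  change gaussBinom q L k • _ = _ • gaussBinom q L r • _ at e
  have e2 : (-1 : ℂ) ^ (L - r + (L - k)) = (-1) ^ r * (-1) ^ k := by
    rw [← pow_add]
    exact neg_one_pow_congr (by rw [Nat.even_add, Nat.even_add, Nat.even_sub hr', Nat.even_sub hk']; tauto)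
  rw [e2] at e
  have e3 : ∀ (c : ℂ) (r : ℕ), (-Complex.I * c) ^ r = (-1) ^ r * (Complex.I * c) ^ r := by
    intro c r
    rw [← mul_pow]; congr 1; ring
  have e4 : ((-1 : ℂ) ^ k) * (-1) ^ k = 1 := by rw [← mul_pow]; norm_num
  calc _ = (krawVec q L (-Complex.I * s) u' v' k * krawVec q L (Complex.I * t) u v r) •
        (gaussBinom q L k • swapHom q (coactMat q L (L - r) (L - k))) := by
        simp only [smul_smul]; congr 1; ring
    _ = _ := by
        rw [e]
        simp only [smul_smul, krawVec, e3]
        congr 1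
        linear_combination (gaussBinom q L r * ((Complex.I * t) ^ r * (Complex.I * s) ^ k * (-1) ^ r
          * kraw (qc q ^ 2) u v L r * kraw (qc q ^ 2) u' v' L k * qc q ^ r.choose 2
          * qc q ^ k.choose 2)) * e4

end BilinearForms

/-! ## Generalised matrix elements in terms of Askey-Wilson polynomials -/

section MainRecursion

open Polynomial

variable {q : QParam}

/-- The third numerator parameter of the dual `q`-Krawtchouk polynomial of order `N` at `x`. -/
noncomputable def krawArg (q : QParam) (t : ℂ) (N x : ℕ) : ℂ :=
  -((t ^ 2)⁻¹ * (qc q ^ 2)⁻¹ ^ N * (qc q ^ 2) ^ x)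

/-- The generalised matrix elements, up to normalisation, with doubled spin `N` and with rows
and columns labelled by `x` and `y`. -/
noncomputable def krawElt (q : QParam) (N x y : ℕ) (t s : ℂ) : FunAlg q :=
  krawForm q N t ((qc q ^ 2)⁻¹ ^ x) (krawArg q t N x) s ((qc q ^ 2)⁻¹ ^ y) (krawArg q s N y)

theorem mul_inv_pow_succ (x : ℕ) :
    qc q ^ 2 * (qc q ^ 2)⁻¹ ^ (x + 1) = (qc q ^ 2)⁻¹ ^ x := by
  rw [pow_succ' (qc q ^ 2)⁻¹, ← mul_assoc, mul_inv_cancel₀ (qc_sq_ne_zero q), one_mul]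

theorem mul_krawArg (t : ℂ) (N x : ℕ) :
    qc q ^ 2 * krawArg q t (N + 1) x = krawArg q t N x := by
  rw [krawArg, krawArg, ← mul_inv_pow_succ N]
  ring

theorem krawArg_succ_succ (t : ℂ) (N x : ℕ) :
    krawArg q t (N + 1) (x + 1) = krawArg q t N x := by
  rw [krawArg, krawArg, ← mul_inv_pow_succ N, pow_succ (qc q ^ 2) x]
  ring

theorem swapHom_krawElt (N x y : ℕ) (t s : ℂ) :
    swapHom q (krawElt q N x y t s) = krawElt q N y x s t := swapHom_krawForm ..

theorem krawElt_zero (t s : ℂ) : krawElt q 0 0 0 t s = 1 := by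
  simp [krawElt, krawForm, coactForm, krawVec, kraw_zero, gaussBinom, qBinom_zero_right,
    coactMat_zero]

theorem krawForm_one_succ {L : ℕ} {t v s u' v' : ℂ}
    (huv' : qPoch u' (qc q ^ 2) (L + 1) * qPoch (qc q ^ 2 * v') (qc q ^ 2) L
      * ((qc q ^ 2)⁻¹ ^ (L + 1) - v') = 0) :
    krawForm q (L + 1) t 1 v s u' v' = linElt q (t * qc q ^ L) (s * qc q ^ L * u')
        * krawForm q L t 1 v s u' (qc q ^ 2 * v') := by
  have h := one_sub_inv_pow_succ_ne_zero (qc_sq_ne_zero q) (qc_sq_pow_ne_one q) L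
  -- With u = 1 the series is constant and v is irrelevant; taking v = 0 ensures u ≠ v and makes the
  -- connection coefficients 1 and 0.
  rw [krawForm_one _ _ v 0, krawForm_one _ _ v 0, krawForm_succ one_ne_zero huv']
  have e1 : krawConn (qc q ^ 2) 1 0 (L + 1) = 1 := by
    rw [krawConn, sub_zero, one_mul, mul_one, div_self h]
  have e2 : krawConn (qc q ^ 2) 0 1 (L + 1) = 0 := by simp [krawConn]
  rw [e1, e2, zero_smul, add_zero, one_smul, mul_one, mul_zero]

/-- The condition of `kraw_raise_order` holds at a node whichever of the two arguments carries the
negative power of p. Which one does decides whether the label is kept or lowered by one along with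
the order. -/
theorem raise_condition_left {L y : ℕ} (hy : y ≤ L) (v : ℂ) :
    qPoch ((qc q ^ 2)⁻¹ ^ y) (qc q ^ 2) (L + 1) * qPoch (qc q ^ 2 * v) (qc q ^ 2) L
      * ((qc q ^ 2)⁻¹ ^ (L + 1) - v) = 0 := by
  rw [qPoch_inv_pow_eq_zero (qc_sq_ne_zero q) (Nat.lt_succ_of_le hy), zero_mul, zero_mul]

theorem raise_condition_right {L y : ℕ} (hy : y ≤ L) (u : ℂ) :
    qPoch u (qc q ^ 2) (L + 1) * qPoch (qc q ^ 2 * (qc q ^ 2)⁻¹ ^ (y + 1)) (qc q ^ 2) L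
      * ((qc q ^ 2)⁻¹ ^ (L + 1) - (qc q ^ 2)⁻¹ ^ (y + 1)) = 0 := by
  rcases hy.eq_or_lt with rfl | hy
  · rw [sub_self, mul_zero]
  · rw [mul_inv_pow_succ, qPoch_inv_pow_eq_zero (qc_sq_ne_zero q) hy, mul_zero, zero_mul]

theorem krawElt_succ_left {L y : ℕ} (hy : y ≤ L) (t s : ℂ) : krawElt q (L + 1) 0 y t s =
    linElt q (t * qc q ^ L) (s * qc q ^ L * (qc q ^ 2)⁻¹ ^ y) * krawElt q L 0 y t s := by
  rw [krawElt, pow_zero, krawForm_one_succ (raise_condition_left hy _), mul_krawArg, krawElt,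
    pow_zero, krawForm_one]

theorem krawElt_succ_right {L y : ℕ} (hy : y ≤ L) (t s : ℂ) : krawElt q (L + 1) 0 (y + 1) t s =
    linElt q (t * qc q ^ L) (s * qc q ^ L * krawArg q s L y) * krawElt q L 0 y t s := by
  rw [krawElt, pow_zero, krawForm_comm_right, krawForm_one_succ (raise_condition_right hy _),
    mul_inv_pow_succ, krawArg_succ_succ, krawElt, pow_zero, krawForm_comm_right, krawForm_one]

/-- After the swap, the y-vector is split by the lowering recurrences while the x-vector is lowered
with p^{-(x+1)} in the shifted slot. Hence both terms have row label x, and the column label is y +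
1 or y. -/
theorem krawElt_succ_succ {L x y : ℕ} (hx : x ≤ L) {t s : ℂ}
    (hs : (qc q ^ 2)⁻¹ ^ (y + 1) ≠ krawArg q s L y) :
    krawElt q (L + 1) (x + 1) (y + 1) t s =
      krawConn (qc q ^ 2) ((qc q ^ 2)⁻¹ ^ (y + 1)) (krawArg q s L y) (L + 1) •
        (linElt q (t * qc q ^ L * krawArg q t L x) (s * qc q ^ L * (qc q ^ 2)⁻¹ ^ (y + 1))
          * krawElt q L x (y + 1) t s)
      + krawConn (qc q ^ 2) (krawArg q s L y) ((qc q ^ 2)⁻¹ ^ (y + 1)) (L + 1) •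
        (linElt q (t * qc q ^ L * krawArg q t L x) (s * qc q ^ L * krawArg q s L y)
          * krawElt q L x y t s) := by
  rw [← swapHom_krawElt, krawElt, krawArg_succ_succ, krawArg_succ_succ, krawForm_comm_right,
    krawForm_succ hs (raise_condition_right hx _), mul_inv_pow_succ, mul_inv_pow_succ, map_add,
    map_smul, map_smul, map_mul, map_mul, swapHom_linElt, swapHom_linElt, swapHom_krawForm,
    swapHom_krawForm, krawForm_comm_left, krawForm_comm_left _ _ (krawArg q t L x)]
  have e : qc q ^ 2 * krawArg q s L y = krawArg q s L (y + 1) := by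
    rw [krawArg, krawArg]; ring
  rw [e]
  rfl

theorem mul_krawArg_eq {s : ℂ} (hs : s ≠ 0) (L y : ℕ) : s * qc q ^ L * krawArg q s L y =
    -(s * qc q ^ L * (qc q ^ 2)⁻¹ ^ y)⁻¹ := by
  have h0 := qc_ne_zero q
  rw [krawArg, inv_pow, inv_pow, ← pow_mul, ← pow_mul, mul_comm 2, pow_mul]
  field_simp

/-- The element is a product of linear elements, and `quadElt_mul_linElt` moves Q past one factor at
a time, each multiplying both parameters by q, up to u ↦ -u⁻¹. -/
theorem quadElt_mul_krawElt {M Y : ℕ} (hY : Y ≤ M) {t s : ℂ} (ht : t ≠ 0) (hs : s ≠ 0) :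
    quadElt q (t * qc q ^ M) (s * qc q ^ M * (qc q ^ 2)⁻¹ ^ Y) * krawElt q M 0 Y t s =
      krawElt q M 0 Y t s * quadElt q t s := by
  have h0 := qc_ne_zero q
  induction M generalizing Y with
  | zero =>
    obtain rfl : Y = 0 := by omega
    simp [krawElt_zero]
  | succ M ih =>
    by_cases hY' : Y ≤ M
    · rw [krawElt_succ_left hY', mul_assoc (linElt q _ _), ← ih hY', ← mul_assoc, ← mul_assoc,
        ← quadElt_mul_linElt (by positivity) (by positivity)]
      congr 3 <;> ring
    -- The leading factor now uses the other node argument, so its second parameter is a negative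
    -- inverse; invariance of Q under u ↦ -u⁻¹ restores the pattern.
    · obtain rfl : Y = M + 1 := by omega
      have hu : s * qc q ^ M * (qc q ^ 2)⁻¹ ^ M ≠ 0 := by positivity
      rw [krawElt_succ_right le_rfl, mul_assoc (linElt q _ _), ← ih le_rfl,
        ← mul_assoc, ← mul_assoc,
        mul_krawArg_eq hs, ← quadElt_neg_inv _ (s * qc q ^ M * (qc q ^ 2)⁻¹ ^ M),
        ← quadElt_mul_linElt (by positivity) (neg_ne_zero.mpr (inv_ne_zero hu)),
        ← quadElt_neg_inv _ (s * qc q ^ (M + 1) * (qc q ^ 2)⁻¹ ^ (M + 1))]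
      congr 3
      · ring
      · rw [pow_succ, pow_succ]
        field_simp

theorem character_linElt (z : ℂˣ) (T U : ℂ) :
    character q z (linElt q T U) = (z : ℂ)⁻¹ * (1 + (z : ℂ) ^ 2 * (T * U)) := by
  have hz : (z : ℂ) ≠ 0 := z.ne_zero
  simp only [linElt, map_add, map_sub, map_smul, character, FunAlg.lift_gen, FunAlg.assign,
    smul_eq_mul, Units.val_inv_eq_inv_val]
  field_simp
  ring

/-- The element is built from Y factors with TU = -(t/s)p^r and then k factors with TU = ts p^r;
each contributes z⁻¹(1 + z² TU). -/
theorem character_krawElt (z : ℂˣ) (Y k : ℕ) {t s : ℂ} (ht : t ≠ 0) (hs : s ≠ 0) :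
    character q z (krawElt q (Y + k) 0 Y t s) = (z : ℂ) ^ (-((Y + k : ℕ) : ℤ))
      * qPoch ((z : ℂ) ^ 2 * (t / s)) (qc q ^ 2) Y
      * qPoch (-(z : ℂ) ^ 2 * (t * s)) (qc q ^ 2) k := by
  have hz : (z : ℂ) ≠ 0 := z.ne_zero
  have h0 := qc_ne_zero q
  induction k with
  | succ k ih =>
    rw [← add_assoc, krawElt_succ_left (Nat.le_add_right Y k), map_mul, ih, character_linElt,
      qPoch_succ _ _ k]
    have e : t * qc q ^ (Y + k) * (s * qc q ^ (Y + k) * (qc q ^ 2)⁻¹ ^ Y) =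
        t * s * (qc q ^ 2) ^ k := by
      rw [inv_pow, ← pow_mul, ← pow_mul]
      field_simp
      ring
    rw [e]
    push_cast
    rw [show (-((Y : ℤ) + k + 1)) = -(Y + k) + -1 by ring, zpow_add₀ hz, zpow_neg_one]
    ring
  | zero =>
    rw [qPoch_zero_right, mul_one, add_zero]
    induction Y with
    | zero => simp [krawElt_zero, qPoch_zero_right]
    | succ Y ih =>
      rw [krawElt_succ_right le_rfl, map_mul, ih, character_linElt, mul_krawArg_eq hs, qPoch_succ]
      have e : t * qc q ^ Y * -(s * qc q ^ Y * (qc q ^ 2)⁻¹ ^ Y)⁻¹ =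
          -(t / s * (qc q ^ 2) ^ Y) := by
        rw [inv_pow]
        field_simp
      rw [e]
      push_cast
      rw [show (-((Y : ℤ) + 1)) = -Y + -1 by ring, zpow_add₀ hz, zpow_neg_one]
      ring

/-- The choice of u makes the scalar in the factorisation -b - b⁻¹. Once Q has passed to the right,
the factor is Q - b - b⁻¹, and 1 - 2bX + b² = -b(2X - b - b⁻¹). -/
theorem linElt_mul_linElt_mul_krawElt {Y k : ℕ} {t s u b : ℂ} (ht : t ≠ 0) (hs : s ≠ 0)
    (hb : b ≠ 0) (hu : u = -(qc q * (t * qc q ^ (Y + k)))⁻¹ * b)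
    (hΩ : quadElt q (t * qc q ^ (Y + k)) u =
      quadElt q (t * qc q ^ (Y + k)) (s * qc q ^ (Y + k) * (qc q ^ 2)⁻¹ ^ Y)) (P : ℂ[X]) :
    linElt q (-(qc q * (t * qc q ^ (Y + k)))⁻¹) (-(qc q * u)⁻¹) *
      (linElt q (t * qc q ^ (Y + k)) u * (krawElt q (Y + k) 0 Y t s *
        aeval ((1 / 2 : ℂ) • quadElt q t s) P)) =
    (-((qc q)⁻¹ * b⁻¹)) • (krawElt q (Y + k) 0 Y t s *
        aeval ((1 / 2 : ℂ) • quadElt q t s) ((1 - C (2 * b) * X + C (b ^ 2)) * P)) := by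
  have h0 := qc_ne_zero q
  have ht' : t * qc q ^ (Y + k) ≠ 0 := mul_ne_zero ht (pow_ne_zero _ h0)
  have hu' : u ≠ 0 := by
    rw [hu]; exact mul_ne_zero (neg_ne_zero.mpr (inv_ne_zero (mul_ne_zero h0 ht'))) hb
  have e1 : qc q * (t * qc q ^ (Y + k)) * u = -b := by
    rw [hu]; field_simp
  have e2 : (1 - C (2 * b) * X + C (b ^ 2)) * P =
      (C (-b) * (C 2 * X + C (-b + (-b)⁻¹))) * P := by
    congr 1
    rw [mul_add, ← mul_assoc, ← C_mul, ← C_mul, show -b * (-b + (-b)⁻¹) = b ^ 2 + 1 by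
      field_simp; ring, show -b * 2 = -(2 * b) by ring, C_neg, C_add, C_1]
    ring
  have e3 : aeval ((1 / 2 : ℂ) • quadElt q t s) (C 2 * X + C (-b + (-b)⁻¹)) =
      quadElt q t s + algebraMap ℂ _ (-b + (-b)⁻¹) := by
    rw [map_add, map_mul, aeval_C, aeval_C, aeval_X, mul_smul_comm, ← Algebra.smul_def, smul_smul]
    norm_num
  rw [← mul_assoc, linElt_mul_linElt_left ht' hu', e1, hΩ, ← mul_assoc, smul_mul_assoc, add_mul,
    quadElt_mul_krawElt (Nat.le_add_right Y k) ht hs, Algebra.commutes, ← mul_add, ← e3, e2,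
    map_mul, map_mul, aeval_C, ← Algebra.smul_def, smul_mul_assoc, smul_mul_assoc, mul_smul_comm,
    smul_smul, mul_assoc]
  congr 1
  field_simp

/-- At the nodes the denominator of both connection coefficients is proportional to s²p^k + p^Y, the
quantity that appears as d - b in the contiguous relation. -/
theorem krawConn_node {x Y k : ℕ} {s : ℂ} (hs0 : s ≠ 0)
    (hs : ∀ a b : ℕ, s ^ 2 * (qc q ^ 2) ^ a + (qc q ^ 2) ^ b ≠ 0) :
    (1 - (qc q ^ 2) ^ (Y + k + 2 * x + 1 + 1)) * krawConn (qc q ^ 2)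
        ((qc q ^ 2)⁻¹ ^ (Y + x + 1)) (krawArg q s (Y + k + 2 * x + 1) (Y + x))
          (Y + k + 2 * x + 1 + 1) * (s ^ 2 * (qc q ^ 2) ^ k + (qc q ^ 2) ^ Y) =
      (qc q ^ 2) ^ Y * ((1 + s ^ 2 * (qc q ^ 2) ^ (k + x + 1)) * (1 - (qc q ^ 2) ^ (k + x + 1))) ∧
    (1 - (qc q ^ 2) ^ (Y + k + 2 * x + 1 + 1)) * krawConn (qc q ^ 2)
        (krawArg q s (Y + k + 2 * x + 1) (Y + x)) ((qc q ^ 2)⁻¹ ^ (Y + x + 1))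
          (Y + k + 2 * x + 1 + 1) * (s ^ 2 * (qc q ^ 2) ^ k + (qc q ^ 2) ^ Y) =
      (qc q ^ 2) ^ k * ((1 - (qc q ^ 2) ^ (Y + x + 1)) * (s ^ 2 + (qc q ^ 2) ^ (Y + x + 1))) := by
  have hp := qc_sq_ne_zero q
  have hN : 1 - (qc q ^ 2) ^ (Y + k + 2 * x + 1 + 1) ≠ 0 :=
    sub_ne_zero.mpr (qc_sq_pow_ne_one q _).symm
  have hN' := one_sub_inv_pow_succ_ne_zero hp (qc_sq_pow_ne_one q) (Y + k + 2 * x + 1)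
  have h := hs k Y
  have hv : krawArg q s (Y + k + 2 * x + 1) (Y + x) = -(s ^ 2 * (qc q ^ 2) ^ (k + x + 1))⁻¹ := by
    rw [krawArg]
    simp only [inv_pow, pow_add, two_mul]
    field_simp
  have hd : (qc q ^ 2)⁻¹ ^ (Y + x + 1) - -(s ^ 2 * (qc q ^ 2) ^ (k + x + 1))⁻¹ =
      (s ^ 2 * (qc q ^ 2) ^ k + (qc q ^ 2) ^ Y) /
        (s ^ 2 * (qc q ^ 2) ^ (Y + k + x + 1)) := by
    simp only [inv_pow, pow_add, pow_one] at *
    field_simp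
    ring
  have hd' : 1 - (qc q ^ 2)⁻¹ ^ (Y + k + 2 * x + 1 + 1) =
      -((1 - (qc q ^ 2) ^ (Y + k + 2 * x + 1 + 1)) / (qc q ^ 2) ^ (Y + k + 2 * x + 1 + 1)) := by
    rw [inv_pow]
    field_simp
    ring
  constructor
  · rw [krawConn, hv, hd, hd', inv_pow, inv_pow]
    clear hv hd hd' hN'
    generalize 1 - (qc q ^ 2) ^ (Y + k + 2 * x + 1 + 1) = D at *
    generalize qc q ^ 2 = p at *
    simp only [pow_add, two_mul, pow_one] at *
    field_simp
    ring
  · rw [krawConn, hv, ← neg_sub ((qc q ^ 2)⁻¹ ^ (Y + x + 1)) (-_), hd, hd', inv_pow, inv_pow]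
    clear hv hd hd' hN'
    generalize 1 - (qc q ^ 2) ^ (Y + k + 2 * x + 1 + 1) = D at *
    generalize qc q ^ 2 = p at *
    simp only [pow_add, two_mul, pow_one] at *
    field_simp
    ring

theorem krawElt_eq_askeyWilson (x Y k : ℕ) {t s : ℂ} (ht0 : t ≠ 0) (hs0 : s ≠ 0)
    (ht : ∀ a b : ℕ, t ^ 2 * (qc q ^ 2) ^ a + (qc q ^ 2) ^ b ≠ 0)
    (hs : ∀ a b : ℕ, s ^ 2 * (qc q ^ 2) ^ a + (qc q ^ 2) ^ b ≠ 0) :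
    krawElt q (Y + k + 2 * x) x (Y + x) t s =
      ((qc q ^ x)⁻¹ / qPoch ((qc q ^ 2) ^ (Y + k + 2 * x)) (qc q ^ 2)⁻¹ x) •
        (krawElt q (Y + k) 0 Y t s * aeval ((1 / 2 : ℂ) • quadElt q t s)
          (askeyWilson x (qc q * (s / t)) (qc q * ((qc q ^ 2) ^ Y * (t / s)))
            (-(qc q / (t * s))) (-(qc q * ((qc q ^ 2) ^ k * (t * s)))) (qc q ^ 2))) := by
  have h0 := qc_ne_zero q
  have hp := qc_sq_ne_zero q
  have h1 := qc_sq_pow_ne_one q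
  induction x generalizing Y k with
  | zero => simp [askeyWilson, qPoch_zero_right]
  | succ x ih =>
    -- The two elements in `krawElt_succ_succ` are the cases (Y + 1, k) and (Y, k + 1). Their base
    -- elements are both a linear element times the base element of (Y, k), and their polynomials
    -- have b, respectively d, multiplied by p.
    have ih1 := ih (Y + 1) k
    have ih2 := ih Y (k + 1)
    rw [show Y + 1 + k + 2 * x = Y + k + 2 * x + 1 by ring, show Y + 1 + x = Y + x + 1 by ring,
      show Y + 1 + k = Y + k + 1 by ring, krawElt_succ_right (Nat.le_add_right Y k)] at ih1
    rw [show Y + (k + 1) + 2 * x = Y + k + 2 * x + 1 by ring,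
      show Y + (k + 1) = Y + k + 1 by ring, krawElt_succ_left (Nat.le_add_right Y k)] at ih2
    have hW := hs k Y
    -- This and the next two identities show that the outer linear elements from the recursion are
    -- the exact partners of the inner ones from the induction hypotheses.
    have hT : t * qc q ^ (Y + k + 2 * x + 1) * krawArg q t (Y + k + 2 * x + 1) x =
        -(qc q * (t * qc q ^ (Y + k)))⁻¹ := by
      rw [mul_krawArg_eq ht0, inv_pow]
      congr 2
      rw [← pow_mul, pow_succ, pow_add _ (Y + k)]
      field_simp
    have hU1 : s * qc q ^ (Y + k + 2 * x + 1) * (qc q ^ 2)⁻¹ ^ (Y + x + 1) =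
        -(qc q * (s * qc q ^ (Y + k) * krawArg q s (Y + k) Y))⁻¹ := by
      rw [mul_krawArg_eq hs0, inv_pow, inv_pow]
      simp only [pow_add, pow_mul, pow_one]
      field_simp
    have hU2 : s * qc q ^ (Y + k + 2 * x + 1) * krawArg q s (Y + k + 2 * x + 1) (Y + x) =
        -(qc q * (s * qc q ^ (Y + k) * (qc q ^ 2)⁻¹ ^ Y))⁻¹ := by
      rw [mul_krawArg_eq hs0, inv_pow, inv_pow]
      simp only [pow_add, pow_mul, pow_one]
      field_simp
    have hne : (qc q ^ 2)⁻¹ ^ (Y + x + 1) ≠ krawArg q s (Y + k + 2 * x + 1) (Y + x) := by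
      intro e
      apply hW
      rw [krawArg, inv_pow, inv_pow] at e
      simp only [pow_add, two_mul, pow_one] at e
      field_simp at e
      linear_combination e
    set b : ℂ := qc q * ((qc q ^ 2) ^ Y * (t / s)) with hb
    set d : ℂ := -(qc q * ((qc q ^ 2) ^ k * (t * s))) with hd
    have hb0 : b ≠ 0 := by positivity
    have hd0 : d ≠ 0 := neg_ne_zero.mpr (by positivity)
    have hb1 : qc q * ((qc q ^ 2) ^ (Y + 1) * (t / s)) = b * qc q ^ 2 := by rw [hb]; ring
    have hd1 : -(qc q * ((qc q ^ 2) ^ (k + 1) * (t * s))) = d * qc q ^ 2 := by rw [hd]; ring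
    have hW' : d - b = -(qc q * (t / s)) * (s ^ 2 * (qc q ^ 2) ^ k + (qc q ^ 2) ^ Y) := by
      rw [hd, hb]; field_simp; ring
    have hdb : d - b ≠ 0 := by
      rw [hW']; exact mul_ne_zero (neg_ne_zero.mpr (by positivity)) hW
    have key1 := linElt_mul_linElt_mul_krawElt (k := k) (u := s * qc q ^ (Y + k) * krawArg q s (Y + k) Y)
      ht0 hs0 hb0 (by
        rw [mul_krawArg_eq hs0, hb, inv_pow, pow_add]; field_simp)
      (by rw [mul_krawArg_eq hs0, quadElt_neg_inv])
    have key2 := linElt_mul_linElt_mul_krawElt (k := k) (u := s * qc q ^ (Y + k) * (qc q ^ 2)⁻¹ ^ Y)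
      ht0 hs0 hd0 (by
        rw [hd, inv_pow]; simp only [pow_add, ← pow_mul]; field_simp; ring) rfl
    rw [hb1] at ih1
    rw [hd1] at ih2
    -- The denominators (ab, ac, ad; p)_j do not vanish: ab is a positive power of p, and the other
    -- two cases are excluded by the hypotheses on t² and s².
    have hab : ∀ j, qc q * (s / t) * b * (qc q ^ 2) ^ j ≠ 1 := by
      intro j
      have e : qc q * (s / t) * b * (qc q ^ 2) ^ j = (qc q ^ 2) ^ (Y + j + 1) := by
        rw [hb]; field_simp; ring
      rw [e]
      exact h1 _
    have hac : ∀ j, qc q * (s / t) * -(qc q / (t * s)) * (qc q ^ 2) ^ j ≠ 1 := by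
      intro j e
      apply ht 0 (j + 1)
      field_simp at e
      linear_combination -e
    have had : ∀ j, qc q * (s / t) * d * (qc q ^ 2) ^ j ≠ 1 := by
      intro j e
      apply hs (k + j + 1) 0
      rw [hd] at e
      field_simp at e
      linear_combination -e
    have hAW := askeyWilson_contiguous x (c := -(qc q / (t * s)))
      (by positivity : qc q * (s / t) ≠ 0) hp h1 hab hac had
    obtain ⟨n1, n2⟩ := krawConn_node (x := x) (Y := Y) (k := k) hs0 hs
    rw [show Y + k + 2 * (x + 1) = Y + k + 2 * x + 1 + 1 by ring, ← add_assoc,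
      krawElt_succ_succ (by omega) hne, ih1, ih2, hT, hU1, hU2]
    simp only [mul_smul_comm, mul_assoc (linElt q _ _)]
    rw [key1, key2]
    have hG := congr(krawElt q (Y + k) 0 Y t s * aeval ((1 / 2 : ℂ) • quadElt q t s) $hAW)
    rw [map_sub (aeval _), map_mul (aeval _) (C _), map_mul (aeval _) (C _),
      map_mul (aeval _) (C _), aeval_C, aeval_C, aeval_C, ← Algebra.smul_def, ← Algebra.smul_def, ← Algebra.smul_def, mul_sub,
      mul_smul_comm, mul_smul_comm, mul_smul_comm] at hG
    have hN : 1 - (qc q ^ 2) ^ (Y + k + 2 * x + 1 + 1) ≠ 0 := sub_ne_zero.mpr (h1 _).symm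
    have e1 : (qc q ^ 2) ^ (Y + k + 2 * x + 1 + 1) * (qc q ^ 2)⁻¹ =
        (qc q ^ 2) ^ (Y + k + 2 * x + 1) := by
      rw [pow_succ _ (Y + k + 2 * x + 1), mul_assoc, mul_inv_cancel₀ hp, mul_one]
    rw [qPoch_succ_left, e1]
    set c1 := (qc q ^ x)⁻¹ / qPoch ((qc q ^ 2) ^ (Y + k + 2 * x + 1)) (qc q ^ 2)⁻¹ x with hc1
    have e2 : (qc q ^ (x + 1))⁻¹ / ((1 - (qc q ^ 2) ^ (Y + k + 2 * x + 1 + 1)) *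
        qPoch ((qc q ^ 2) ^ (Y + k + 2 * x + 1)) (qc q ^ 2)⁻¹ x) =
        (c1 * (qc q)⁻¹ / ((1 - (qc q ^ 2) ^ (Y + k + 2 * x + 1 + 1)) * (d - b))) * (d - b) := by
      rw [hc1, pow_succ, mul_inv]
      field_simp
    have a1 : (1 - qc q * (s / t) * d * (qc q ^ 2) ^ x) * (1 - -(qc q / (t * s)) * d *
        (qc q ^ 2) ^ x) = (1 + s ^ 2 * (qc q ^ 2) ^ (k + x + 1)) * (1 - (qc q ^ 2) ^ (k + x + 1)) := by
      rw [hd]; field_simp; ring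
    have a2 : (1 - qc q * (s / t) * b * (qc q ^ 2) ^ x) * (1 - b * -(qc q / (t * s)) *
        (qc q ^ 2) ^ x) = (s ^ 2)⁻¹ * ((1 - (qc q ^ 2) ^ (Y + x + 1)) *
          (s ^ 2 + (qc q ^ 2) ^ (Y + x + 1))) := by
      rw [hb]; field_simp; ring
    rw [e2, mul_smul, hG, a1, a2, smul_sub]
    simp only [smul_smul]
    rw [sub_eq_add_neg ((_ : ℂ) • (_ : FunAlg q)), ← neg_smul, hW']
    clear hG key1 key2 ih1 ih2 hAW hU1 hU2 hT
    generalize 1 - (qc q ^ 2) ^ (Y + k + 2 * x + 1 + 1) = D at *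
    generalize krawConn (qc q ^ 2) ((qc q ^ 2)⁻¹ ^ (Y + x + 1))
      (krawArg q s (Y + k + 2 * x + 1) (Y + x)) (Y + k + 2 * x + 1 + 1) = A at *
    generalize krawConn (qc q ^ 2) (krawArg q s (Y + k + 2 * x + 1) (Y + x))
      ((qc q ^ 2)⁻¹ ^ (Y + x + 1)) (Y + k + 2 * x + 1 + 1) = B at *
    congr 2
    · rw [mul_comm _ (_ * (1 - _)), ← div_eq_iff (pow_ne_zero Y hp)] at n1
      rw [hb, ← n1]
      field_simp
    · rw [mul_comm _ (_ * (s ^ 2 + _)), ← div_eq_iff (pow_ne_zero k hp)] at n2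
      have hW2 : (qc q ^ 2) ^ k * s ^ 2 + (qc q ^ 2) ^ Y ≠ 0 := by rwa [mul_comm]
      rw [hd, ← n2]
      field_simp

end MainRecursion

/-! ## Generalised matrix elements and their symmetries -/

section Interface

open Polynomial

variable {q : QParam}

theorem ofReal_qPoch (a b : ℝ) (k : ℕ) : ((qPoch a b k : ℝ) : ℂ) = qPoch (a : ℂ) (b : ℂ) k := by
  simp [qPoch]

theorem qPoch_zero_left {R : Type*} [CommRing R] (b : R) (k : ℕ) : qPoch 0 b k = 1 := by
  simp [qPoch]

theorem sq_rpow (q : QParam) (x : ℝ) : ((q : ℝ) ^ 2) ^ x = (q : ℝ) ^ (2 * x) := by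
  rw [← Real.rpow_natCast, ← Real.rpow_mul (q_pos q).le]
  norm_num

theorem sq_rpow_neg_natCast (q : QParam) (n : ℕ) :
    ((q : ℝ) ^ 2) ^ (-(n : ℝ)) = ((q : ℝ) ^ 2)⁻¹ ^ n := by
  rw [Real.rpow_neg (sq_pos_lt_one q).1.le, Real.rpow_natCast, inv_pow]

theorem ofReal_dualKrawtchouk (σ : ℝ) (L r x : ℕ) :
    ((dualKrawtchouk ((q : ℝ) ^ 2) σ L r x : ℝ) : ℂ) =
      kraw (qc q ^ 2) ((qc q ^ 2)⁻¹ ^ x) (krawArg q (qpow q σ) L x) L r := by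
  have e : -((q : ℝ) ^ 2) ^ ((x : ℝ) - L - σ) =
      -((((q : ℝ) ^ σ) ^ 2)⁻¹ * ((q : ℝ) ^ 2)⁻¹ ^ L * ((q : ℝ) ^ 2) ^ x) := by
    have h0 := (sq_pos_lt_one q).1
    rw [Real.rpow_sub h0, Real.rpow_sub h0, sq_rpow q σ, mul_comm 2 σ, Real.rpow_mul (q_pos q).le,
      Real.rpow_natCast, Real.rpow_natCast, Real.rpow_two, inv_pow]
    field_simp
  rw [dualKrawtchouk, kraw, Complex.ofReal_sum]
  refine Finset.sum_congr rfl fun k _ => ?_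
  rw [e, sq_rpow_neg_natCast, sq_rpow_neg_natCast, sq_rpow_neg_natCast]
  simp only [Complex.ofReal_mul, Complex.ofReal_div, ofReal_qPoch,
    qPoch_zero_left, mul_one]
  simp only [Complex.ofReal_pow, Complex.ofReal_inv, Complex.ofReal_neg, Complex.ofReal_mul,
    krawArg, qpow, qc]
  ring

theorem krawVec_mul (L : ℕ) (a c u v : ℂ) (r : ℕ) :
    krawVec q L (a * c) u v r = a ^ r * krawVec q L c u v r := by
  rw [krawVec, krawVec, mul_pow]
  ring

theorem ofReal_eigenCoord (L : ℕ) (J : ℤ) (σ : ℝ) (r : ℕ) :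
    ((normConst q L J σ * (q : ℝ) ^ (σ * r) * (q : ℝ) ^ ((r : ℝ) * ((r : ℝ) - 1) / 2)
      * √(qBinom ((q : ℝ) ^ 2) L r)
      * dualKrawtchouk ((q : ℝ) ^ 2) σ L r (half (L - J)) : ℝ) : ℂ) =
    (normConst q L J σ : ℂ) * (√(qBinom ((q : ℝ) ^ 2) L r) : ℝ) *
      krawVec q L (qpow q σ) ((qc q ^ 2)⁻¹ ^ half (L - J))
        (krawArg q (qpow q σ) L (half (L - J))) r := by
  have e : (q : ℝ) ^ ((r : ℝ) * ((r : ℝ) - 1) / 2) = (q : ℝ) ^ (r.choose 2) := by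
    rw [← Nat.cast_choose_two, Real.rpow_natCast]
  rw [e, Real.rpow_mul (q_pos q).le, Real.rpow_natCast, krawVec]
  simp only [Complex.ofReal_mul, ofReal_dualKrawtchouk, Complex.ofReal_pow]
  rw [qpow, qc]
  ring

theorem eigenCoord_eq (L : ℕ) (J : ℤ) (σ : ℝ) (r : ℕ) : eigenCoord q L J σ r =
    (normConst q L J σ : ℂ) * (√(qBinom ((q : ℝ) ^ 2) L r) : ℝ) *
      krawVec q L (-Complex.I * qpow q σ) ((qc q ^ 2)⁻¹ ^ half (L - J))
        (krawArg q (qpow q σ) L (half (L - J))) r := by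
  rw [eigenCoord, ofReal_eigenCoord, krawVec_mul, zpow_neg, zpow_natCast, ← inv_pow, Complex.inv_I]
  ring

theorem conj_eigenCoord (L : ℕ) (J : ℤ) (σ : ℝ) (r : ℕ) :
    (starRingEnd ℂ) (eigenCoord q L J σ r) =
    (normConst q L J σ : ℂ) * (√(qBinom ((q : ℝ) ^ 2) L r) : ℝ) *
      krawVec q L (Complex.I * qpow q σ) ((qc q ^ 2)⁻¹ ^ half (L - J))
        (krawArg q (qpow q σ) L (half (L - J))) r := by
  rw [eigenCoord, map_mul, Complex.conj_ofReal, ofReal_eigenCoord, krawVec_mul, zpow_neg,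
    zpow_natCast, ← inv_pow, Complex.inv_I, map_pow, map_neg, Complex.conj_I, neg_neg]
  ring

/-- The norms √[L, k] √[L, r] of the two vectors and the ratio √([L, k]/[L, r]) in the matrix
element multiply to [L, k], the column weight of `krawForm`; both indices are reflected by n = L -
r. -/
theorem genElement_eq (L : ℕ) (I J : ℤ) (τ σ : ℝ) : genElement q L I J τ σ =
    ((normConst q L J σ : ℂ) * normConst q L I τ) •
      krawElt q L (half (L - I)) (half (L - J)) (qpow q τ) (qpow q σ) := by
  obtain ⟨h0, h1⟩ := sq_pos_lt_one q
  set F : ℕ → ℕ → FunAlg q := fun n m => (eigenCoord q L J σ (L - m) *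
    (starRingEnd ℂ) (eigenCoord q L I τ (L - n))) • (binomRatio q L n m : ℂ) • coactMat q L n m
    with hF
  have e1 : genElement q L I J τ σ =
      ∑ n ∈ Finset.range (L + 1), ∑ m ∈ Finset.range (L + 1), F n m := by
    rw [Finset.sum_range]
    simp only [Finset.sum_range (n := L + 1)]
    rfl
  rw [e1, Finset.sum_comm, ← Finset.sum_range_reflect, krawElt, krawForm, coactForm,
    Finset.smul_sum]
  refine Finset.sum_congr rfl fun k hk => ?_
  rw [← Finset.sum_range_reflect, Finset.smul_sum, Finset.smul_sum]
  refine Finset.sum_congr rfl fun r hr => ?_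
  have hr' := Finset.mem_range_succ_iff.mp hr
  have hk' := Finset.mem_range_succ_iff.mp hk
  rw [hF]
  simp only [Nat.add_sub_cancel, Nat.sub_sub_self hr', Nat.sub_sub_self hk', conj_eigenCoord,
    smul_smul]
  rw [eigenCoord_eq]
  congr 1
  have hb1 := qBinom_pos h0 h1 hr'
  have hb2 := qBinom_pos h0 h1 hk'
  have e2 : √(qBinom ((q : ℝ) ^ 2) L k) * √(qBinom ((q : ℝ) ^ 2) L r) *
      binomRatio q L (L - r) (L - k) = qBinom ((q : ℝ) ^ 2) L k := by
    rw [binomRatio, qBinom_symm h0 h1 (Nat.sub_add_cancel hr'),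
      qBinom_symm h0 h1 (Nat.sub_add_cancel hk'), ← Real.sqrt_mul hb2.le,
      ← Real.sqrt_mul (mul_pos hb2 hb1).le]
    rw [show qBinom ((q : ℝ) ^ 2) L k * qBinom ((q : ℝ) ^ 2) L r *
      (qBinom ((q : ℝ) ^ 2) L k / qBinom ((q : ℝ) ^ 2) L r) = qBinom ((q : ℝ) ^ 2) L k ^ 2 by
        field_simp, Real.sqrt_sq hb2.le]
  have e3 : gaussBinom q L k = ((√(qBinom ((q : ℝ) ^ 2) L k) : ℝ) : ℂ) *
      ((√(qBinom ((q : ℝ) ^ 2) L r) : ℝ) : ℂ) * ((binomRatio q L (L - r) (L - k) : ℝ) : ℂ) := by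
    rw [gaussBinom]
    exact_mod_cast e2.symm
  rw [e3]
  ring

theorem swapHom_genElement (L : ℕ) (I J : ℤ) (τ σ : ℝ) :
    swapHom q (genElement q L I J τ σ) = genElement q L J I σ τ := by
  rw [genElement_eq, genElement_eq, map_smul, swapHom_krawElt, mul_comm]

theorem one_add_rpow_pos (q : QParam) (x : ℝ) : 0 < 1 + (q : ℝ) ^ x :=
  add_pos one_pos (Real.rpow_pos_of_pos (q_pos q) x)

theorem qPoch_neg_rpow_pos (q : QParam) (x : ℝ) (k : ℕ) :
    0 < qPoch (-(q : ℝ) ^ x) ((q : ℝ) ^ 2) k :=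
  Finset.prod_pos fun i _ => by
    have := mul_pos (Real.rpow_pos_of_pos (q_pos q) x) (pow_pos (sq_pos_lt_one q).1 i)
    linarith

theorem normConst_pos (L : ℕ) (J : ℤ) (σ : ℝ) (hJ : -(L : ℤ) ≤ J) : 0 < normConst q L J σ := by
  have h : half (L - J) ≤ L := by unfold half; omega
  have h1 := Real.rpow_pos_of_pos (q_pos q) (((L : ℝ) + J) / 2)
  have h2 := qBinom_pos (sq_pos_lt_one q).1 (sq_pos_lt_one q).2 h
  have h3 := one_add_rpow_pos q (-2 * (J : ℝ) - 2 * σ)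
  have h4 := one_add_rpow_pos q (-2 * σ)
  have h5 := qPoch_neg_rpow_pos q (2 - 2 * σ) (half (L - J))
  have h6 := qPoch_neg_rpow_pos q (2 + 2 * σ) (half (L + J))
  unfold normConst
  positivity

/-- The two shifted factorials are exchanged and the binomial is symmetric. The change in the power
of q is compensated by the square root of (1 + q^{-4j-2σ})/(1 + q^{-2σ}). -/
theorem normConst_neg {L : ℕ} {J : ℤ} (hJ : |J| ≤ (L : ℤ)) (hLJ : Even ((L : ℤ) - J)) (σ : ℝ) :
    normConst q L (-J) (-σ) = normConst q L J σ := by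
  obtain ⟨h0, h1⟩ := sq_pos_lt_one q
  have hq := q_pos q
  rw [abs_le] at hJ
  obtain ⟨j, hj⟩ := hLJ
  have hb : qBinom ((q : ℝ) ^ 2) L (half (L + J)) = qBinom ((q : ℝ) ^ 2) L (half (L - J)) :=
    qBinom_symm h0 h1 (by unfold half; omega)
  have hw : (q : ℝ) ^ (((L : ℝ) - J) / 2) *
      √((1 + (q : ℝ) ^ (2 * (J : ℝ) + 2 * σ)) / (1 + (q : ℝ) ^ (2 * σ))) =
      (q : ℝ) ^ (((L : ℝ) + J) / 2) *
        √((1 + (q : ℝ) ^ (-2 * (J : ℝ) - 2 * σ)) / (1 + (q : ℝ) ^ (-2 * σ))) := by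
    have e1 : (1 + (q : ℝ) ^ (2 * (J : ℝ) + 2 * σ)) / (1 + (q : ℝ) ^ (2 * σ)) =
        ((q : ℝ) ^ (J : ℝ)) ^ 2 *
          ((1 + (q : ℝ) ^ (-2 * (J : ℝ) - 2 * σ)) / (1 + (q : ℝ) ^ (-2 * σ))) := by
      have a1 := one_add_rpow_pos q (2 * σ)
      have a2 := one_add_rpow_pos q (-2 * σ)
      have e2 : (q : ℝ) ^ (-2 * (J : ℝ) - 2 * σ) = (((q : ℝ) ^ (J : ℝ)) ^ 2)⁻¹ * ((q : ℝ) ^ (2 * σ))⁻¹ := by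
        rw [← Real.rpow_natCast, ← Real.rpow_mul hq.le, ← Real.rpow_neg hq.le, ← Real.rpow_neg hq.le,
          ← Real.rpow_add hq]
        congr 1
        push_cast
        ring
      have e3 : (q : ℝ) ^ (2 * (J : ℝ) + 2 * σ) = ((q : ℝ) ^ (J : ℝ)) ^ 2 * (q : ℝ) ^ (2 * σ) := by
        rw [← Real.rpow_natCast, ← Real.rpow_mul hq.le, ← Real.rpow_add hq]
        congr 1
        push_cast
        ring
      have e4 : (q : ℝ) ^ (-2 * σ) = ((q : ℝ) ^ (2 * σ))⁻¹ := by
        rw [← Real.rpow_neg hq.le]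
        congr 1
        ring
      rw [e4] at a2
      rw [e2, e3, e4]
      have b1 := Real.rpow_pos_of_pos hq (J : ℝ)
      have b2 := Real.rpow_pos_of_pos hq (2 * σ)
      field_simp
      ring
    rw [e1, Real.sqrt_mul (sq_nonneg _), Real.sqrt_sq (Real.rpow_pos_of_pos hq _).le, ← mul_assoc,
      ← Real.rpow_add hq]
    congr 2
    ring
  unfold normConst
  rw [sub_neg_eq_add, ← sub_eq_add_neg, hb, show (2 : ℝ) - 2 * -σ = 2 + 2 * σ by ring,
    show (2 : ℝ) + 2 * -σ = 2 - 2 * σ by ring, show (-2 : ℝ) * -σ = 2 * σ by ring, Int.cast_neg,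
    show (-2 : ℝ) * -(J : ℝ) - 2 * -σ = 2 * J + 2 * σ by ring, ← sub_eq_add_neg,
    mul_comm (qPoch (-(q : ℝ) ^ (2 + 2 * σ)) _ _)]
  linear_combination (√(qBinom ((q : ℝ) ^ 2) L (half (L - J))) *
    (√(qPoch (-(q : ℝ) ^ (2 - 2 * σ)) ((q : ℝ) ^ 2) (half (L - J))
        * qPoch (-(q : ℝ) ^ (2 + 2 * σ)) ((q : ℝ) ^ 2) (half (L + J))))⁻¹) * hw

theorem qpow_sq_mul_add_ne_zero (σ : ℝ) (a b : ℕ) :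
    qpow q σ ^ 2 * (qc q ^ 2) ^ a + (qc q ^ 2) ^ b ≠ 0 := by
  have h : 0 < ((q : ℝ) ^ σ) ^ 2 * ((q : ℝ) ^ 2) ^ a + ((q : ℝ) ^ 2) ^ b := by
    have := q_pos q
    positivity
  unfold qpow qc
  exact_mod_cast h.ne'

/-- `kraw_reverse` with c = -q^{-2σ}: division by c turns the parameters at x for σ into those at L
- x for -σ, and c^r yields the sign and the change of q^{σr}. -/
theorem krawVec_neg {L x r : ℕ} (hx : x ≤ L) (hr : r ≤ L) (σ : ℝ) :
    krawVec q L (qpow q (-σ)) ((qc q ^ 2)⁻¹ ^ (L - x)) (krawArg q (qpow q (-σ)) L (L - x)) r =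
      (-1) ^ r * krawVec q L (qpow q σ) ((qc q ^ 2)⁻¹ ^ x) (krawArg q (qpow q σ) L x) r := by
  have hs := qpow_ne_zero q σ
  have hp := qc_sq_ne_zero q
  have hne := qpow_sq_mul_add_ne_zero (q := q) σ
  have hxL : (qc q ^ 2) ^ L = (qc q ^ 2) ^ (L - x) * (qc q ^ 2) ^ x := by
    rw [← pow_add, Nat.sub_add_cancel hx]
  have e := kraw_reverse hp (qc_sq_pow_ne_one q) (c := -(qpow q σ ^ 2)⁻¹)
    (neg_ne_zero.mpr (inv_ne_zero (pow_ne_zero 2 hs))) hr ((qc q ^ 2)⁻¹ ^ x)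
    (krawArg q (qpow q σ) L x) (fun i j h => by
      rw [krawArg, inv_pow, inv_pow] at h
      field_simp at h
      apply hne (i + L) (j + 2 * x)
      rw [pow_add, pow_add, pow_mul']
      linear_combination h)
    (by rw [krawArg, inv_pow, inv_pow]; field_simp)
  rw [show krawArg q (qpow q σ) L x / -(qpow q σ ^ 2)⁻¹ = (qc q ^ 2)⁻¹ ^ (L - x) by
      rw [krawArg, inv_pow, inv_pow, hxL]; field_simp,
    show (qc q ^ 2)⁻¹ ^ x / -(qpow q σ ^ 2)⁻¹ = krawArg q (qpow q (-σ)) L (L - x) by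
      rw [krawArg, inv_pow, inv_pow, hxL, qpow_neg]; field_simp] at e
  have h1 : (-1 : ℂ) ^ r * (-1) ^ r = 1 := by rw [← mul_pow]; norm_num
  have hsr := pow_ne_zero r hs
  have h2 : (-(qpow q σ ^ 2)⁻¹) ^ r = (-1) ^ r * ((qpow q σ ^ r)⁻¹ * (qpow q σ ^ r)⁻¹) := by
    rw [neg_pow, ← inv_pow, ← inv_pow, ← mul_pow (qpow q σ)⁻¹, ← pow_two]
  rw [krawVec, krawVec, ← e, h2]
  generalize kraw (_ : ℂ) _ _ _ _ = z
  rw [qpow_neg, inv_pow]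
  field_simp
  linear_combination (-(qc q ^ r.choose 2 * z)) * h1

theorem eigenCoord_neg {L r : ℕ} {J : ℤ} (hJ : |J| ≤ (L : ℤ)) (hLJ : Even ((L : ℤ) - J))
    (hr : r ≤ L) (σ : ℝ) : eigenCoord q L (-J) (-σ) r = (-1) ^ r * eigenCoord q L J σ r := by
  have hx : half (L - -J) = L - half (L - J) := by
    rw [abs_le] at hJ
    obtain ⟨j, hj⟩ := hLJ
    unfold half
    omega
  have hx' : half (L - J) ≤ L := by
    rw [abs_le] at hJ
    unfold half
    omega
  rw [eigenCoord_eq, eigenCoord_eq, normConst_neg hJ hLJ, hx, krawVec_mul, krawVec_mul,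
    krawVec_neg hx' hr]
  ring

/-- The two vectors contribute (-1)^{L-m} and (-1)^{L-n}, the automorphism contributes (-1)^{n+m},
and the total exponent is 2L. -/
theorem signHom_genElement {L : ℕ} {I J : ℤ} (hI : |I| ≤ (L : ℤ)) (hJ : |J| ≤ (L : ℤ))
    (hLI : Even ((L : ℤ) - I)) (hLJ : Even ((L : ℤ) - J)) (τ σ : ℝ) :
    signHom q (genElement q L (-I) (-J) (-τ) (-σ)) = genElement q L I J τ σ := by
  simp only [genElement, map_sum, map_smul, signHom_matrixElement]
  refine Finset.sum_congr rfl fun n _ => Finset.sum_congr rfl fun m _ => ?_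
  have hn := Nat.lt_succ_iff.mp n.2
  have hm := Nat.lt_succ_iff.mp m.2
  have e1 : eigenVector q L (-J) (-σ) m = (-1) ^ (L - (m : ℕ)) * eigenVector q L J σ m :=
    eigenCoord_neg hJ hLJ (Nat.sub_le _ _) σ
  have e2 : eigenVector q L (-I) (-τ) n = (-1) ^ (L - (n : ℕ)) * eigenVector q L I τ n :=
    eigenCoord_neg hI hLI (Nat.sub_le _ _) τ
  have e3 : (-1 : ℂ) ^ (L - (m : ℕ)) * (-1) ^ (L - (n : ℕ)) * (-1) ^ ((n : ℕ) + m) = 1 := by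
    rw [← pow_add, ← pow_add]
    exact Even.neg_one_pow ⟨L, by omega⟩
  rw [e1, e2, smul_smul, map_mul, map_pow, map_neg, map_one]
  congr 1
  linear_combination (eigenVector q L J σ m * (starRingEnd ℂ) (eigenVector q L I τ n)) * e3

end Interface

/-! ### The four ranges of (i, j) -/

section MainCase

open Polynomial

variable {q : QParam}

theorem sq_rpow_half_add (q : QParam) (n : ℕ) :
    ((q : ℝ) ^ 2) ^ ((1 : ℝ) / 2 + n) = q * ((q : ℝ) ^ 2) ^ n := by
  rw [Real.rpow_add (sq_pos_lt_one q).1, Real.rpow_natCast, sq_rpow]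
  norm_num

theorem askeyWilsonJacobi_eq (x Y k : ℕ) (τ σ : ℝ) :
    askeyWilsonJacobi x Y k ((q : ℝ) ^ τ) ((q : ℝ) ^ σ) ((q : ℝ) ^ 2) =
      askeyWilson x (qc q * (qpow q σ / qpow q τ))
        (qc q * ((qc q ^ 2) ^ Y * (qpow q τ / qpow q σ)))
        (-(qc q / (qpow q τ * qpow q σ)))
        (-(qc q * ((qc q ^ 2) ^ k * (qpow q τ * qpow q σ)))) (qc q ^ 2) := by
  have e0 : ((q : ℝ) ^ 2) ^ ((1 : ℝ) / 2) = q := by simpa using sq_rpow_half_add q 0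
  rw [askeyWilsonJacobi, sq_rpow_half_add, sq_rpow_half_add, e0]
  unfold qpow qc
  push_cast
  congr 1 <;> ring

/-- The generalised matrix elements in the range `|j| ≤ i`. -/
theorem genElement_of_abs_le {L : ℕ} {I J : ℤ} (hIL : I ≤ L) (hJI : -I ≤ J) (hJI' : J ≤ I)
    (hIJ : Even (I - J)) (hLI : Even ((L : ℤ) - I)) (τ σ : ℝ) :
    genElement q L I J τ σ =
        (ratioConst q L I J τ σ : ℂ) • (genElement q I.toNat I J τ σ *
          aeval (shiftedRho q τ σ)
            (askeyWilsonJacobi (half (L - I)) (((I : ℝ) - J) / 2) (((I : ℝ) + J) / 2)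
              ((q : ℝ) ^ τ) ((q : ℝ) ^ σ) ((q : ℝ) ^ 2))) ∧
      ∀ z : ℂˣ, character q z (genElement q I.toNat I J τ σ) =
        (normConst q I.toNat J σ : ℂ) * (normConst q I.toNat I τ : ℂ) * (z : ℂ) ^ (-I) *
          qPoch ((z : ℂ) ^ 2 * qpow q (τ - σ)) (qc q ^ 2) (half (I - J)) *
          qPoch (-(z : ℂ) ^ 2 * qpow q (τ + σ)) (qc q ^ 2) (half (I + J)) := by
  -- The natural parameters of the recursion are Y = i - j, k = i + j and x = l - i, so I = Y + k, J
  -- = k - Y and L = Y + k + 2x.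
  obtain ⟨Y', hY⟩ := hIJ
  obtain ⟨x', hx⟩ := hLI
  obtain ⟨Y, rfl⟩ := Int.eq_ofNat_of_zero_le (show 0 ≤ Y' by omega)
  obtain ⟨x, rfl⟩ := Int.eq_ofNat_of_zero_le (show 0 ≤ x' by omega)
  obtain ⟨k, hk⟩ := Int.eq_ofNat_of_zero_le (show 0 ≤ I - Y by omega)
  obtain rfl : I = ((Y + k : ℕ) : ℤ) := by omega
  obtain rfl : J = (k : ℤ) - Y := by omega
  obtain rfl : L = Y + k + 2 * x := by omega
  have a1 : half (((Y + k + 2 * x : ℕ) : ℤ) - ((Y + k : ℕ) : ℤ)) = x := by unfold half; omega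
  have a2 : half (((Y + k + 2 * x : ℕ) : ℤ) - ((k : ℤ) - Y)) = Y + x := by unfold half; omega
  have a3 : half (((Y + k : ℕ) : ℤ) - ((Y + k : ℕ) : ℤ)) = 0 := by unfold half; omega
  have a4 : half (((Y + k : ℕ) : ℤ) - ((k : ℤ) - Y)) = Y := by unfold half; omega
  have a5 : half (((Y + k : ℕ) : ℤ) + ((k : ℤ) - Y)) = k := by unfold half; omega
  have ht := qpow_ne_zero q τ
  have hs := qpow_ne_zero q σ
  have hgen : genElement q (Y + k) ((Y + k : ℕ) : ℤ) (k - Y) τ σ =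
      ((normConst q (Y + k) (k - Y) σ : ℂ) * normConst q (Y + k) ((Y + k : ℕ) : ℤ) τ) •
        krawElt q (Y + k) 0 Y (qpow q τ) (qpow q σ) := by
    rw [genElement_eq, a3, a4]
  rw [Int.toNat_natCast, hgen, a4, a5]
  constructor
  · have b1 : ((((Y + k : ℕ) : ℤ) : ℝ) - (((k : ℤ) - Y : ℤ) : ℝ)) / 2 = Y := by push_cast; ring
    have b2 : ((((Y + k : ℕ) : ℤ) : ℝ) + (((k : ℤ) - Y : ℤ) : ℝ)) / 2 = k := by push_cast; ring
    rw [genElement_eq, a1, a2, b1, b2, askeyWilsonJacobi_eq,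
      krawElt_eq_askeyWilson x Y k ht hs (qpow_sq_mul_add_ne_zero τ) (qpow_sq_mul_add_ne_zero σ),
      ← shiftedRho_eq, smul_mul_assoc, smul_smul, smul_smul]
    congr 1
    have c1 := (normConst_pos (q := q) (Y + k) (k - Y) σ (by omega)).ne'
    have c2 := (normConst_pos (q := q) (Y + k) ((Y + k : ℕ) : ℤ) τ (by omega)).ne'
    have c3 : (q : ℝ) ^ (((((Y + k : ℕ) : ℤ) : ℝ) - ((Y + k + 2 * x : ℕ) : ℝ)) / 2) =
        ((q : ℝ) ^ x)⁻¹ := by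
      rw [← Real.rpow_natCast, ← Real.rpow_neg (q_pos q).le]
      congr 1
      push_cast
      ring
    rw [ratioConst, a1, Int.toNat_natCast, c3]
    have c4 : ((qc q ^ x)⁻¹ / qPoch ((qc q ^ 2) ^ (Y + k + 2 * x)) (qc q ^ 2)⁻¹ x) =
        ((((q : ℝ) ^ x)⁻¹ / qPoch (((q : ℝ) ^ 2) ^ (Y + k + 2 * x)) ((q : ℝ) ^ 2)⁻¹ x : ℝ) : ℂ) := by
      rw [Complex.ofReal_div, ofReal_qPoch]
      push_cast
      rfl
    rw [c4, ← Complex.ofReal_mul, ← Complex.ofReal_mul, ← Complex.ofReal_mul, ← Complex.ofReal_mul]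
    congr 1
    field_simp
  · intro z
    rw [map_smul, character_krawElt z Y k ht hs, sub_eq_add_neg τ, qpow_add, qpow_add, qpow_neg,
      smul_eq_mul, div_eq_mul_inv]
    ring

/-- The generalised matrix elements in the range `|i| ≤ j`. -/
theorem genElement_of_abs_le' {L : ℕ} {I J : ℤ} (hJL : J ≤ L) (hJI : -J ≤ I) (hJI' : I ≤ J)
    (hIJ : Even (I - J)) (hLJ : Even ((L : ℤ) - J)) (τ σ : ℝ) :
    genElement q L I J τ σ =
        (ratioConst q L J I σ τ : ℂ) • (genElement q J.toNat I J τ σ *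
          aeval (shiftedRho q τ σ)
            (askeyWilsonJacobi (half (L - J)) (((J : ℝ) - I) / 2) (((I : ℝ) + J) / 2)
              ((q : ℝ) ^ σ) ((q : ℝ) ^ τ) ((q : ℝ) ^ 2))) ∧
      ∀ z : ℂˣ, character q z (genElement q J.toNat I J τ σ) =
        (normConst q J.toNat I τ : ℂ) * (normConst q J.toNat J σ : ℂ) * (z : ℂ) ^ (-J) *
          qPoch ((z : ℂ) ^ 2 * qpow q (σ - τ)) (qc q ^ 2) (half (J - I)) *
          qPoch (-(z : ℂ) ^ 2 * qpow q (τ + σ)) (qc q ^ 2) (half (I + J)) := by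
  -- The previous range with (i, τ) and (j, σ) exchanged, carried back by the swap automorphism,
  -- which respects characters.
  obtain ⟨h1, h2⟩ := genElement_of_abs_le (q := q) hJL hJI hJI' (by simpa using hIJ.neg) hLJ σ τ
  refine ⟨?_, fun z => ?_⟩
  · have := congr(swapHom q $h1)
    rwa [map_smul, map_mul, swapHom_genElement, swapHom_genElement, ← aeval_algHom_apply,
      swapHom_shiftedRho, add_comm (J : ℝ)] at this
  · rw [← swapHom_genElement, character_swapHom, h2, add_comm σ, add_comm J]

theorem even_sub_neg {a b : ℤ} (h : Even (a - b)) : Even (a - -b) := by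
  have := h.add (even_two_mul b)
  rwa [show a - b + 2 * b = a - -b by ring] at this

/-- The generalised matrix elements in the range `|j| ≤ -i`. -/
theorem genElement_of_abs_le_neg {L : ℕ} {I J : ℤ} (hI : |I| ≤ (L : ℤ)) (hJ : |J| ≤ (L : ℤ))
    (h1 : I ≤ J) (h2 : J ≤ -I) (hIJ : Even (I - J)) (hLI : Even ((L : ℤ) - I))
    (hLJ : Even ((L : ℤ) - J)) (τ σ : ℝ) :
    genElement q L I J τ σ =
        (ratioConst q L (-I) (-J) (-τ) (-σ) : ℂ) • (genElement q (-I).toNat I J τ σ *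
          aeval (shiftedRho q τ σ)
            (askeyWilsonJacobi (half (L + I)) (((J : ℝ) - I) / 2) ((-(I : ℝ) - J) / 2)
              ((q : ℝ) ^ (-τ)) ((q : ℝ) ^ (-σ)) ((q : ℝ) ^ 2))) ∧
      ∀ z : ℂˣ, character q z (genElement q (-I).toNat I J τ σ) =
        (normConst q (-I).toNat (-J) (-σ) : ℂ) * (normConst q (-I).toNat (-I) (-τ) : ℂ) *
          (z : ℂ) ^ I *
          qPoch ((z : ℂ) ^ 2 * qpow q (-τ + σ)) (qc q ^ 2) (half (J - I)) *
          qPoch (-(z : ℂ) ^ 2 * qpow q (-τ - σ)) (qc q ^ 2) (half (-I - J)) := by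
  have hI0 : (((-I).toNat : ℕ) : ℤ) = -I := Int.toNat_of_nonneg (by omega)
  have hs : signHom q (genElement q (-I).toNat (-I) (-J) (-τ) (-σ)) =
      genElement q (-I).toNat I J τ σ :=
    signHom_genElement (by rw [hI0, abs_le]; omega) (by rw [hI0, abs_le]; omega)
      (by rw [hI0, ← neg_add', even_neg]; exact ⟨I, rfl⟩)
      (by rw [hI0, ← neg_add', even_neg, ← sub_neg_eq_add]; exact even_sub_neg hIJ) τ σ
  -- The first range at (-i, -j, -τ, -σ), carried back by the sign automorphism, which respects
  -- characters.
  obtain ⟨e1, e2⟩ := genElement_of_abs_le (q := q) (L := L) (I := -I) (J := -J)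
    (by have := abs_le.mp hI; omega) (by omega) (by omega)
    (by rw [← neg_sub', even_neg]; exact hIJ) (even_sub_neg hLI) (-τ) (-σ)
  refine ⟨?_, fun z => ?_⟩
  · have := congr(signHom q $e1)
    rwa [map_smul, map_mul, signHom_genElement hI hJ hLI hLJ, hs, ← aeval_algHom_apply,
      signHom_shiftedRho, sub_neg_eq_add, Int.cast_neg, Int.cast_neg, neg_sub_neg,
      ← sub_eq_add_neg] at this
  · rw [← hs, character_signHom, e2, neg_neg, sub_neg_eq_add, neg_sub_neg, ← sub_eq_add_neg,
      ← sub_eq_add_neg]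

/-- The generalised matrix elements in the range `|i| ≤ -j`. -/
theorem genElement_of_abs_le_neg' {L : ℕ} {I J : ℤ} (hI : |I| ≤ (L : ℤ)) (hJ : |J| ≤ (L : ℤ))
    (h1 : J ≤ I) (h2 : I ≤ -J) (hIJ : Even (I - J)) (hLI : Even ((L : ℤ) - I))
    (hLJ : Even ((L : ℤ) - J)) (τ σ : ℝ) :
    genElement q L I J τ σ =
        (ratioConst q L (-J) (-I) (-σ) (-τ) : ℂ) • (genElement q (-J).toNat I J τ σ *
          aeval (shiftedRho q τ σ)
            (askeyWilsonJacobi (half (L + J)) (((I : ℝ) - J) / 2) ((-(I : ℝ) - J) / 2)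
              ((q : ℝ) ^ (-σ)) ((q : ℝ) ^ (-τ)) ((q : ℝ) ^ 2))) ∧
      ∀ z : ℂˣ, character q z (genElement q (-J).toNat I J τ σ) =
        (normConst q (-J).toNat (-I) (-τ) : ℂ) * (normConst q (-J).toNat (-J) (-σ) : ℂ) *
          (z : ℂ) ^ J *
          qPoch ((z : ℂ) ^ 2 * qpow q (-σ + τ)) (qc q ^ 2) (half (I - J)) *
          qPoch (-(z : ℂ) ^ 2 * qpow q (-τ - σ)) (qc q ^ 2) (half (-I - J)) := by
  obtain ⟨e1, e2⟩ := genElement_of_abs_le_neg (q := q) hJ hI h1 h2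
    (by rw [← neg_sub, even_neg]; exact hIJ) hLJ hLI σ τ
  refine ⟨?_, fun z => ?_⟩
  · have := congr(swapHom q $e1)
    rwa [map_smul, map_mul, swapHom_genElement, swapHom_genElement, ← aeval_algHom_apply,
      swapHom_shiftedRho, neg_sub_left (J : ℝ), add_comm (I : ℝ), ← neg_sub_left] at this
  · rw [← swapHom_genElement, character_swapHom, e2, neg_sub_left σ, add_comm τ,
      ← neg_sub_left, neg_sub_left J, add_comm I, ← neg_sub_left]

end MainCase

end QSU2

open QSU2 in
theorem corollary7p7 (q : QParam) (τ σ : ℝ) (L : ℕ) (I J : ℤ)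
    (hI : |I| ≤ (L : ℤ)) (hJ : |J| ≤ (L : ℤ))
    (hIJ : Even (I - J)) (hLI : Even ((L : ℤ) - I)) :
    (∀ X : EnvAlg q, pairing q X (genElement q L I J τ σ) = genFunctional q L I J τ σ X) ∧
    (-I ≤ J → J ≤ I →
      genElement q L I J τ σ =
          (ratioConst q L I J τ σ : ℂ) • (genElement q I.toNat I J τ σ *
            Polynomial.aeval (shiftedRho q τ σ)
              (askeyWilsonJacobi (half (L - I)) (((I : ℝ) - J) / 2) (((I : ℝ) + J) / 2)
                ((q : ℝ) ^ τ) ((q : ℝ) ^ σ) ((q : ℝ) ^ 2))) ∧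
      ∀ z : ℂˣ, character q z (genElement q I.toNat I J τ σ) =
          (normConst q I.toNat J σ : ℂ) * (normConst q I.toNat I τ : ℂ) * (z : ℂ) ^ (-I) *
            qPoch ((z : ℂ) ^ 2 * qpow q (τ - σ)) (qc q ^ 2) (half (I - J)) *
            qPoch (-(z : ℂ) ^ 2 * qpow q (τ + σ)) (qc q ^ 2) (half (I + J))) ∧
    (-J ≤ I → I ≤ J →
      genElement q L I J τ σ =
          (ratioConst q L J I σ τ : ℂ) • (genElement q J.toNat I J τ σ *
            Polynomial.aeval (shiftedRho q τ σ)
              (askeyWilsonJacobi (half (L - J)) (((J : ℝ) - I) / 2) (((I : ℝ) + J) / 2)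
                ((q : ℝ) ^ σ) ((q : ℝ) ^ τ) ((q : ℝ) ^ 2))) ∧
      ∀ z : ℂˣ, character q z (genElement q J.toNat I J τ σ) =
          (normConst q J.toNat I τ : ℂ) * (normConst q J.toNat J σ : ℂ) * (z : ℂ) ^ (-J) *
            qPoch ((z : ℂ) ^ 2 * qpow q (σ - τ)) (qc q ^ 2) (half (J - I)) *
            qPoch (-(z : ℂ) ^ 2 * qpow q (τ + σ)) (qc q ^ 2) (half (I + J))) ∧
    (I ≤ J → J ≤ -I →
      genElement q L I J τ σ =
          (ratioConst q L (-I) (-J) (-τ) (-σ) : ℂ) • (genElement q (-I).toNat I J τ σ *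
            Polynomial.aeval (shiftedRho q τ σ)
              (askeyWilsonJacobi (half (L + I)) (((J : ℝ) - I) / 2) ((-(I : ℝ) - J) / 2)
                ((q : ℝ) ^ (-τ)) ((q : ℝ) ^ (-σ)) ((q : ℝ) ^ 2))) ∧
      ∀ z : ℂˣ, character q z (genElement q (-I).toNat I J τ σ) =
          (normConst q (-I).toNat (-J) (-σ) : ℂ) * (normConst q (-I).toNat (-I) (-τ) : ℂ) *
            (z : ℂ) ^ I *
            qPoch ((z : ℂ) ^ 2 * qpow q (-τ + σ)) (qc q ^ 2) (half (J - I)) *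
            qPoch (-(z : ℂ) ^ 2 * qpow q (-τ - σ)) (qc q ^ 2) (half (-I - J))) ∧
    (J ≤ I → I ≤ -J →
      genElement q L I J τ σ =
          (ratioConst q L (-J) (-I) (-σ) (-τ) : ℂ) • (genElement q (-J).toNat I J τ σ *
            Polynomial.aeval (shiftedRho q τ σ)
              (askeyWilsonJacobi (half (L + J)) (((I : ℝ) - J) / 2) ((-(I : ℝ) - J) / 2)
                ((q : ℝ) ^ (-σ)) ((q : ℝ) ^ (-τ)) ((q : ℝ) ^ 2))) ∧
      ∀ z : ℂˣ, character q z (genElement q (-J).toNat I J τ σ) =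
          (normConst q (-J).toNat (-I) (-τ) : ℂ) * (normConst q (-J).toNat (-J) (-σ) : ℂ) *
            (z : ℂ) ^ J *
            qPoch ((z : ℂ) ^ 2 * qpow q (-σ + τ)) (qc q ^ 2) (half (I - J)) *
            qPoch (-(z : ℂ) ^ 2 * qpow q (-τ - σ)) (qc q ^ 2) (half (-I - J))) := by
  have hLJ : Even ((L : ℤ) - J) := by
    have := hLI.add hIJ
    rwa [sub_add_sub_cancel] at this
  exact ⟨pairing_genElement L I J τ σ,
    fun h1 h2 => genElement_of_abs_le (abs_le.mp hI).2 h1 h2 hIJ hLI τ σ,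
    fun h1 h2 => genElement_of_abs_le' (abs_le.mp hJ).2 h1 h2 hIJ hLJ τ σ,
    fun h1 h2 => genElement_of_abs_le_neg hI hJ h1 h2 hIJ hLI hLJ τ σ,
    fun h1 h2 => genElement_of_abs_le_neg' hI hJ h1 h2 hIJ hLI hLJ τ σ⟩
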